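/- Let $1\le d<D$ be integers, $\beta>1$, $0\le\alpha\le\beta-1$ and $\gamma>0$. For $s\ge 0$, $r>0$ and an open set $\Omega\subset\mathbb R^k$, let $C^{s}_r(\Omega)$ be the set of $C^{\lfloor s\rfloor}$ functions $f:\Omega\to\mathbb R$ with $$\|f\|_{C^s(\Omega)}=\sum_{|a|\le\lfloor s\rfloor}\sup_{\Omega}|f^{(a)}|+\sum_{|a|=\lfloor s\rfloor}\ \sup_{x\ne y\in\Omega}\frac{|f^{(a)}(x)-f^{(a)}(y)|}{\|x-y\|^{s-\lfloor s\rfloor}}\le r ,$$ and let $C^s_r(\Omega;\mathbb R^D)$ be the maps all of whose components are in $C^s_r(\Omega)$. For $L>0$ let $\mathcal P^*=\mathcal P^*(d,D,\alpha,\beta,L)$ be the set of probability measures $\mu$ on $\mathbb R^D$ that are supported on some compact $\beta$-smooth $d$-dimensional submanifold $\mathcal M\subset\mathbb R^D$ without boundary and have a density $p\ge 1/L$ with respect to the volume measure of $\mathcal M$, where $\mathcal M$ has an atlas $\{(U_\lambda,\phi_\lambda)\}$ such that: $\phi_\lambda^{-1}\in C^\beta_L(\phi_\lambda(U_\lambda);\mathbb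 R^D)$ and $p\circ\phi_\lambda^{-1}\in C^\alpha_L(\phi_\lambda(U_\lambda))$ for each $\lambda$; all $d$ singular values of the Jacobian of $\phi_\lambda^{-1}$ are at least $1/L$ on $\phi_\lambda(U_\lambda)$; and for every $x\in\mathcal M$ there is a $\lambda$ such that $U_\lambda\supset \mathbb B_{1/L}(x)\cap\mathcal M$ and $\phi_\lambda(U_\lambda)\supset \mathbb B_{1/L}(\phi_\lambda(x))$, with $\mathbb B_r(x)$ the closed ball. For $X_1,\dots,X_n$ i.i.d. from $\mu$ put $$\Delta_n(\mu)=\sup_{f\in C^\gamma_1(\mathbb R^D)}\Big|\mathbb E_{\mu}[f(X)]-\frac1n\sum_{i=1}^n f(X_i)\Big| .$$ 1. (Upper bound.) For every $L>0$ there is a constant $C_1>0$, depending only on $(d,D,\alpha,\beta,\gamma,L)$, such that for all $\mu^*\in\mathcal P^*(d,D,\alpha,\beta,L)$ and all $n\ge1$, with probability larger than $1-n^{-1}$, $$\Delta_n(\mu^*)\le C_1\Big(\sqrt{\tfrac{\log n}{n}}\vee n^{-\gamma/d}\Big)\quad\text{if }\gamma\ne d/2\text{ or }\gamma\text{ is an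 integer},$$ $$\Delta_n(\mu^*)\le C_1\Big(\tfrac{\log n}{\sqrt n}\vee n^{-\gamma/d}\Big)\quad\text{if }\gamma=d/2 .$$ 2. (Lower bound.) Let $\mu^*$ be the uniform distribution on the unit sphere $\{x\in\mathbb R^D:\|x_{1:d+1}\|=1,\ x_{d+2:D}=0\}$. There is $L_0>0$ such that $\mu^*\in\mathcal P^*(d,D,\alpha,\beta,L)$ for all $L\ge L_0$, and there is a constant $C_2>0$ such that for all $n\ge2$ $$\mathbb E\big[\Delta_n(\mu^*)\big]\ge C_2\Big(\sqrt{\tfrac1n}\vee\frac{n^{-\gamma/d}}{\log n}\Big).$$ -/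

import Mathlib

open MeasureTheory
open scoped ENNReal Topology

noncomputable section

/-- The `i`-th partial derivative of a real function of `d` variables. -/
def partialDeriv {d : ℕ} (i : Fin d) (f : EuclideanSpace ℝ (Fin d) → ℝ) :
    EuclideanSpace ℝ (Fin d) → ℝ :=
  fun x => fderiv ℝ f x (EuclideanSpace.single i 1)

/-- The mixed partial derivative `∂^{|a|} f / ∂x₁^{a₁} ⋯ ∂x_d^{a_d}` of multi-index `a`. -/
def mixedPartial {d : ℕ} (a : Fin d → ℕ) (f : EuclideanSpace ℝ (Fin d) → ℝ) :
    EuclideanSpace ℝ (Fin d) → ℝ :=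
  (List.finRange d).foldr (fun i g => (partialDeriv i)^[a i] g) f

/-- The Hölder norm of order `α ≥ 0` over an open set `Ω`, with values in `[0, ∞]`: the sum over
all multi-indices `|a| ≤ ⌊α⌋` of `sup_Ω |f^{(a)}|`, plus the sum over all multi-indices
`|a| = ⌊α⌋` of `sup_{x ≠ y ∈ Ω} |f^{(a)}(x) - f^{(a)}(y)| / ‖x - y‖^{α - ⌊α⌋}`. Here
`Finset.piAntidiag Finset.univ m` is the set of multi-indices of total degree `m`. -/
def holderNorm {d : ℕ} (α : ℝ) (Ω : Set (EuclideanSpace ℝ (Fin d)))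
    (f : EuclideanSpace ℝ (Fin d) → ℝ) : ℝ≥0∞ :=
  (∑ m ∈ Finset.range (⌊α⌋₊ + 1), ∑ a ∈ Finset.piAntidiag (Finset.univ : Finset (Fin d)) m,
      ⨆ x ∈ Ω, ENNReal.ofReal |mixedPartial a f x|) +
    ∑ a ∈ Finset.piAntidiag (Finset.univ : Finset (Fin d)) ⌊α⌋₊,
      ⨆ x ∈ Ω, ⨆ y ∈ Ω, ⨆ _ : x ≠ y,
        ENNReal.ofReal (|mixedPartial a f x - mixedPartial a f y| / ‖x - y‖ ^ (α - ⌊α⌋₊))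

/-- The Hölder class `C^α_r(Ω)` over an open set `Ω`. Only the values of `f` on `Ω` matter. -/
def holderBall {d : ℕ} (α r : ℝ) (Ω : Set (EuclideanSpace ℝ (Fin d))) :
    Set (EuclideanSpace ℝ (Fin d) → ℝ) :=
  {f | ContDiffOn ℝ (⌊α⌋₊ : ℕ) f Ω ∧ holderNorm α Ω f ≤ ENNReal.ofReal r}

/-- The vector valued Hölder class `C^α_r(Ω; ℝ^D)`: every component lies in `C^α_r(Ω)`. -/
def holderBallVec {d D : ℕ} (α r : ℝ) (Ω : Set (EuclideanSpace ℝ (Fin d))) :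
    Set (EuclideanSpace ℝ (Fin d) → EuclideanSpace ℝ (Fin D)) :=
  {f | ∀ j : Fin D, (fun z => f z j) ∈ holderBall α r Ω}

/-- The `D × d` Jacobian matrix of `ψ : ℝ^d → ℝ^D` at `z`. -/
def jacobianMatrix {d D : ℕ} (ψ : EuclideanSpace ℝ (Fin d) → EuclideanSpace ℝ (Fin D))
    (z : EuclideanSpace ℝ (Fin d)) : Matrix (Fin D) (Fin d) ℝ :=
  Matrix.of fun i j => (fderiv ℝ ψ z (EuclideanSpace.single j 1)) i

/-- For a chart `φ` of `M ⊆ ℝ^D` (a homeomorphism from a relatively open subset of `M` onto an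
open subset of `ℝ^d`), the local parametrization `φ⁻¹` as a map into `ℝ^D`. -/
def chartInv {d D : ℕ} {M : Set (EuclideanSpace ℝ (Fin D))}
    (φ : OpenPartialHomeomorph M (EuclideanSpace ℝ (Fin d))) :
    EuclideanSpace ℝ (Fin d) → EuclideanSpace ℝ (Fin D) :=
  fun z => (φ.symm z : EuclideanSpace ℝ (Fin D))

/-- `vol` is the (Riemannian) volume measure of the submanifold `M` with atlas `𝒜`: in each chart
it has Lebesgue density `√det(JᵀJ)`, `J` the Jacobian matrix of the inverse of the chart. As the
charts cover `M`, this determines `vol`. -/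
def IsVolumeMeasure {d D : ℕ} {M : Set (EuclideanSpace ℝ (Fin D))}
    (𝒜 : Set (OpenPartialHomeomorph M (EuclideanSpace ℝ (Fin d)))) (vol : Measure M) : Prop :=
  ∀ φ ∈ 𝒜, ∀ A : Set M, MeasurableSet A → A ⊆ φ.source →
    vol A = ∫⁻ z in φ '' A,
      ENNReal.ofReal √((jacobianMatrix (chartInv φ) z).transpose *
        jacobianMatrix (chartInv φ) z).det

/-- An atlas of the set `M ⊆ ℝ^D`, with its subspace topology, that makes it a `β`-smooth
`d`-dimensional embedded submanifold without boundary, with quantitative constant `L`: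
the charts cover `M`; their inverses lie in `C^β_L` and have Jacobians all of whose singular
values are at least `1 / L` (equivalently `‖J v‖ ≥ ‖v‖ / L` for all `v`); and around every point
there is a chart whose domain and range contain balls of radius `1 / L`. For `β > 1` the
transition maps are then `β`-smooth. -/
structure IsRegularAtlas {d D : ℕ} (β L : ℝ) (M : Set (EuclideanSpace ℝ (Fin D)))
    (𝒜 : Set (OpenPartialHomeomorph M (EuclideanSpace ℝ (Fin d)))) : Prop where
  covers : ∀ x : M, ∃ φ ∈ 𝒜, x ∈ φ.source
  smooth : ∀ φ ∈ 𝒜, chartInv φ ∈ holderBallVec (D := D) β L φ.target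
  jacobian : ∀ φ ∈ 𝒜, ∀ z ∈ φ.target, ∀ v : EuclideanSpace ℝ (Fin d),
    1 / L * ‖v‖ ≤ ‖fderiv ℝ (chartInv φ) z v‖
  balls : ∀ x : M, ∃ φ ∈ 𝒜, Metric.closedBall x (1 / L) ⊆ φ.source ∧
    Metric.closedBall (φ x) (1 / L) ⊆ φ.target

/-- The class `𝒫*(d, D, α, β, L)` of `α`-smooth probability distributions on unknown `β`-smooth
compact `d`-dimensional submanifolds of `ℝ^D` without boundary. Here `p` is the density of `μ`
relative to the volume measure of `M`. -/
def PStar (d D : ℕ) (α β L : ℝ) : Set (Measure (EuclideanSpace ℝ (Fin D))) :=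
  {μ | IsProbabilityMeasure μ ∧
    ∃ (M : Set (EuclideanSpace ℝ (Fin D)))
      (𝒜 : Set (OpenPartialHomeomorph M (EuclideanSpace ℝ (Fin d))))
      (vol : Measure M) (p : M → ℝ),
      IsCompact M ∧ IsRegularAtlas β L M 𝒜 ∧ IsVolumeMeasure 𝒜 vol ∧
      μ = (vol.withDensity fun x => ENNReal.ofReal (p x)).map Subtype.val ∧
      (∀ x, 1 / L ≤ p x) ∧
      ∀ φ ∈ 𝒜, (fun z => p (φ.symm z)) ∈ holderBall α L φ.target}

/-- The supremum over the unit Hölder ball `C^γ_1(ℝ^D)` of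
`|E_μ[f(X)] - n⁻¹ ∑ f(X_i)|`, for the sample `X = (X_1, …, X_n)`. -/
def empiricalSup {D n : ℕ} (γ : ℝ) (μ : Measure (EuclideanSpace ℝ (Fin D)))
    (X : Fin n → EuclideanSpace ℝ (Fin D)) : ℝ≥0∞ :=
  ⨆ f ∈ holderBall γ 1 (Set.univ : Set (EuclideanSpace ℝ (Fin D))),
    ENNReal.ofReal |∫ x, f x ∂μ - (n : ℝ)⁻¹ * ∑ i, f (X i)|

/-- The law of an i.i.d. sample of size `n` from `μ`. -/
def sampleLaw {D : ℕ} (n : ℕ) (μ : Measure (EuclideanSpace ℝ (Fin D))) :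
    Measure (Fin n → EuclideanSpace ℝ (Fin D)) :=
  Measure.pi fun _ => μ

/-- The inclusion `ℝ^k → ℝ^D`, `x ↦ (x, 0)`, for `k ≤ D`. -/
def padZero {k : ℕ} (D : ℕ) (x : EuclideanSpace ℝ (Fin k)) : EuclideanSpace ℝ (Fin D) :=
  WithLp.toLp 2 fun i => if h : (i : ℕ) < k then x ⟨i, h⟩ else 0

/-- The uniform distribution on the unit sphere
`{x ∈ ℝ^D : ‖x_{1:d+1}‖ = 1, x_{d+2:D} = 0}` of dimension `d`. -/
def sphereLaw (d D : ℕ) : Measure (EuclideanSpace ℝ (Fin D)) :=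
  (((volume : Measure (EuclideanSpace ℝ (Fin (d + 1)))).toSphere Set.univ)⁻¹ •
    (volume : Measure (EuclideanSpace ℝ (Fin (d + 1)))).toSphere).map
      fun x : Metric.sphere (0 : EuclideanSpace ℝ (Fin (d + 1))) 1 =>
        padZero D (x : EuclideanSpace ℝ (Fin (d + 1)))

end

set_option linter.unusedSectionVars false

noncomputable section

/-! Upper bound. The class enters only through `exists_chart_cover`: almost all of `μ` is covered by
a number of chart balls that is bounded over the class, on each of which the parametrization is
bi-Lipschitz and `μ` is comparable with Lebesgue measure on `ℝ^d`. Cutting these balls into cells of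
side of order `2^(-j)` and using, on the image of each cell, polynomials in the ambient coordinates
gives nested linear spaces `V_j` of dimension of order `2^(jd)`. By Taylor's formula they
approximate the unit ball of `C^γ` uniformly, off a null set, with error of order `2^(-jγ)`.

No entropy bound is needed, because the approximating spaces are linear. Gram-Schmidt in `L²(μ)`
yields an orthogonal family `g_r` adapted to the `V_j`. Write `Δ(h)` for the deviation of the sample
mean of `h`. For `h ∈ V_j` one has `Δ(h) = ∑ Δ(g_r) ⟨g_r, h⟩`, which is at most `(∑ Δ(g_r)²)^(1/2)
‖h‖₂`, and the first factor does not depend on `h` and has mean at most `√(dim V_j / n)`.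
Telescoping over the scales (`lintegral_iSup_meanDeviation_le`) bounds the mean of the supremum by
`2^(-Jγ) + n^(-1/2) (1 + ∑_{j<J} 2^(j(d/2-γ)))` up to a constant, with `2^(Jd)` of order `n`. The
sum is geometric unless `γ = d/2`, where it equals `J` and produces the factor `log n`.

If `γ = d/2` is an integer, half of the logarithm is saved. The Hölder ball is bounded in the
Hilbert seminorm given by the `L²(μ)` norm of the derivatives of order `γ`, and a Poincaré type
inequality on the cells shows that `V_j` approximates in `L²(μ)` with error of order `2^(-jγ)` times
this seminorm. Hence the functionals `⟨g_t, ·⟩` with `t ≥ dim V_j` are represented by vectors `w_t`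
of norm of order `2^(-jγ)`, and the supremum over `f` is controlled by the norm of the single random
vector `∑ Δ(g_t) w_t`. Its mean square is at most `n⁻¹ ∑_j 2^(jd) 2^(-2jγ) = J / n` up to a constant
(`lintegral_iSup_meanDeviation_le_of_hilbert`). In all cases the bounded differences inequality
passes from the mean to high probability.

Lower bound. It holds for every measure of the class. Among `2n` points in one chart ball with
separation of order `n^(-1/d)`, at least `n` are far from all observations; a sum of bumps at these
points vanishes on the sample but has integral of order `n^(-γ/d)`. This holds for every sample and
without a logarithm. The term `n^(-1/2)` comes from one fixed bump, whose sample mean has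
nondegenerate variance.

The sphere belongs to the class: gnomonic charts turned by linear isometries form a regular atlas,
and the volume of cones in gnomonic coordinates identifies `toSphere` with the Riemannian volume. -/

/-! ### Mixed partial derivatives and the iterated Fréchet derivative. -/

/-- Iterated partial derivatives along a list of coordinate directions. -/
def listPartial {d : ℕ} (l : List (Fin d)) (f : EuclideanSpace ℝ (Fin d) → ℝ) :
    EuclideanSpace ℝ (Fin d) → ℝ :=
  l.foldr (fun i g => partialDeriv i g) f

/-- The list in which the index `i` occurs `a i` times. -/
def multiIndexList {d : ℕ} (a : Fin d → ℕ) : List (Fin d) :=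
  (List.finRange d).flatMap fun i => List.replicate (a i) i

theorem mixedPartial_eq_listPartial {d : ℕ} (a : Fin d → ℕ)
    (f : EuclideanSpace ℝ (Fin d) → ℝ) :
    mixedPartial a f = listPartial (multiIndexList a) f := by
  have key : ∀ (l : List (Fin d)), l.foldr (fun i g => (partialDeriv i)^[a i] g) f =
      listPartial (l.flatMap fun i => List.replicate (a i) i) f := by
    intro l
    induction l with
    | nil => rfl
    | cons i l ih =>
      simp only [List.foldr_cons, List.flatMap_cons, ih, listPartial, List.foldr_append]
      generalize List.foldr _ f _ = g
      induction a i with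
      | zero => rfl
      | succ n ihn =>
        rw [Function.iterate_succ_apply', ihn, List.replicate_succ, List.foldr_cons]
  exact key _

theorem count_multiIndexList {d : ℕ} (a : Fin d → ℕ) (j : Fin d) :
    (multiIndexList a).count j = a j := by
  have h : ∀ l : List (Fin d), l.Nodup → (l.flatMap fun i => List.replicate (a i) i).count j =
      if j ∈ l then a j else 0 := by
    intro l hl
    induction l with
    | nil => simp
    | cons i l ih =>
      rw [List.nodup_cons] at hl
      rw [List.flatMap_cons, List.count_append, ih hl.2, List.count_replicate]
      by_cases hij : j = i
      · subst hij; simp [hl.1]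
      · have : ¬ i = j := fun h => hij h.symm
        simp [hij, this]
  rw [multiIndexList, h _ (List.nodup_finRange d)]
  simp

theorem length_multiIndexList {d : ℕ} (a : Fin d → ℕ) :
    (multiIndexList a).length = ∑ i, a i := by
  simp [multiIndexList, List.length_flatMap, Fin.sum_univ_def]

theorem listPartial_eq_iteratedFDeriv {d : ℕ} (l : List (Fin d))
    (f : EuclideanSpace ℝ (Fin d) → ℝ) (x : EuclideanSpace ℝ (Fin d))
    (hf : ContDiffAt ℝ (l.length : ℕ) f x) :
    listPartial l f x =
      iteratedFDeriv ℝ l.length f x fun j => EuclideanSpace.single (l.get j) (1 : ℝ) := by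
  induction l generalizing x with
  | nil => simp [listPartial]
  | cons i l ih =>
    have hf' : ContDiffAt ℝ ((l.length : ℕ) + 1) f x := by
      have := hf; simp only [List.length_cons] at this; exact_mod_cast this
    -- The induction hypothesis is about to be differentiated, so it is needed on a neighbourhood of
    -- `x`.
    have hev : ∀ᶠ y in 𝓝 x, listPartial l f y = iteratedFDeriv ℝ l.length f y
        fun j => EuclideanSpace.single (l.get j) (1 : ℝ) := by
      have := (hf'.of_le (m := (l.length : ℕ)) (by exact_mod_cast Nat.le_succ _)).eventually
        (by simp)
      filter_upwards [this] with y hy using ih y hy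
    have hd : DifferentiableAt ℝ (iteratedFDeriv ℝ l.length f) x :=
      hf'.differentiableAt_iteratedFDeriv (by exact_mod_cast Nat.lt_succ_self _)
    change fderiv ℝ (listPartial l f) x (EuclideanSpace.single i 1) = _
    rw [Filter.EventuallyEq.fderiv_eq hev, fderiv_continuousMultilinear_apply_const_apply hd]
    change _ = iteratedFDeriv ℝ (l.length + 1) f x _
    rw [iteratedFDeriv_succ_apply_left]
    rfl

theorem contDiffAt_listPartial {d n : ℕ} {l : List (Fin d)}
    {f : EuclideanSpace ℝ (Fin d) → ℝ} {x : EuclideanSpace ℝ (Fin d)}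
    (hf : ContDiffAt ℝ ((n + l.length : ℕ)) f x) :
    ContDiffAt ℝ (n : ℕ) (listPartial l f) x := by
  induction l generalizing n with
  | nil => simpa [listPartial] using hf
  | cons i l ih =>
    have h1 : ContDiffAt ℝ ((n + 1 : ℕ)) (listPartial l f) x :=
      ih (by rwa [List.length_cons, ← add_assoc, add_right_comm] at hf)
    change ContDiffAt ℝ (n : ℕ) (fun y => fderiv ℝ (listPartial l f) y
      (EuclideanSpace.single i 1)) x
    exact (h1.fderiv_right (m := n) (by exact_mod_cast le_rfl)).clm_apply contDiffAt_const

/-- A permutation is built from adjacent swaps, and for these the claim is the symmetry of the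
second derivative of `listPartial l f`. -/
theorem listPartial_perm {d : ℕ} {l l' : List (Fin d)} (h : l.Perm l')
    (f : EuclideanSpace ℝ (Fin d) → ℝ) (x : EuclideanSpace ℝ (Fin d))
    (hf : ContDiffAt ℝ (l.length : ℕ) f x) :
    listPartial l f x = listPartial l' f x := by
  induction h generalizing x with
  | nil => rfl
  | cons i hl ih =>
    rename_i l₁ l₂
    have hf' : ContDiffAt ℝ ((l₁.length : ℕ) + 1) f x := by
      have := hf; simp only [List.length_cons] at this; exact_mod_cast this
    have hev : listPartial l₁ f =ᶠ[𝓝 x] listPartial l₂ f := by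
      have := (hf'.of_le (m := (l₁.length : ℕ)) (by exact_mod_cast Nat.le_succ _)).eventually
        (by simp)
      filter_upwards [this] with y hy using ih y hy
    change fderiv ℝ (listPartial l₁ f) x _ = fderiv ℝ (listPartial l₂ f) x _
    rw [hev.fderiv_eq]
  | swap i j l =>
    have hg : ContDiffAt ℝ 2 (listPartial l f) x :=
      contDiffAt_listPartial (n := 2) (by simpa [add_comm, add_left_comm, add_assoc,
        one_add_one_eq_two] using hf)
    have hsymm := hg.isSymmSndFDerivAt (by simp)
    have hdd : DifferentiableAt ℝ (fderiv ℝ (listPartial l f)) x :=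
      (hg.fderiv_right (m := 1) (by norm_num)).differentiableAt (by norm_num)
    have h2 : ∀ i j : Fin d, listPartial (i :: j :: l) f x =
        fderiv ℝ (fderiv ℝ (listPartial l f)) x (EuclideanSpace.single i 1)
          (EuclideanSpace.single j 1) := by
      intro i j
      change fderiv ℝ (fun y => fderiv ℝ (listPartial l f) y (EuclideanSpace.single j 1)) x _ = _
      rw [fderiv_clm_apply hdd (differentiableAt_const _)]
      simp
    rw [h2, h2]
    exact hsymm _ _
  | trans h₁ h₂ ih₁ ih₂ =>
    rw [ih₁ x hf, ih₂ x (by rwa [← h₁.length_eq])]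

theorem iteratedFDeriv_single_eq_listPartial {d k : ℕ} (s : Fin k → Fin d)
    {f : EuclideanSpace ℝ (Fin d) → ℝ} {x : EuclideanSpace ℝ (Fin d)}
    (hf : ContDiffAt ℝ (k : ℕ) f x) :
    (iteratedFDeriv ℝ k f x fun j => EuclideanSpace.single (s j) (1 : ℝ)) =
      listPartial (List.ofFn s) f x := by
  rw [listPartial_eq_iteratedFDeriv _ _ _ (by simpa using hf)]
  -- The length of `List.ofFn s` is `k` only up to a proof, so the order of differentiation is
  -- generalized before substituting.
  have : ∀ (n : ℕ) (hn : k = n) (v : Fin n → EuclideanSpace ℝ (Fin d)),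
      (∀ j : Fin k, v (Fin.cast hn j) = EuclideanSpace.single (s j) (1 : ℝ)) →
      (iteratedFDeriv ℝ k f x fun j => EuclideanSpace.single (s j) (1 : ℝ)) =
        iteratedFDeriv ℝ n f x v := by
    rintro n rfl v hv
    congr 1
    ext j : 1
    exact (hv j).symm
  apply this _ (by simp)
  intro j
  simp

/-- It suffices to compare the two multilinear maps on basis vectors, where this is the commutation
of partial derivatives. Only `C^k` is assumed. -/
theorem iteratedFDeriv_comp_perm {d k : ℕ} (f : EuclideanSpace ℝ (Fin d) → ℝ)
    (x : EuclideanSpace ℝ (Fin d)) (hf : ContDiffAt ℝ (k : ℕ) f x)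
    (v : Fin k → EuclideanSpace ℝ (Fin d)) (σ : Equiv.Perm (Fin k)) :
    iteratedFDeriv ℝ k f x (v ∘ σ) = iteratedFDeriv ℝ k f x v := by
  have : (iteratedFDeriv ℝ k f x).toMultilinearMap.domDomCongr σ =
      (iteratedFDeriv ℝ k f x).toMultilinearMap := by
    refine Module.Basis.ext_multilinear
      (fun _ => (EuclideanSpace.basisFun (Fin d) ℝ).toBasis) fun s => ?_
    simp only [OrthonormalBasis.coe_toBasis, EuclideanSpace.basisFun_apply]
    change (iteratedFDeriv ℝ k f x fun j => EuclideanSpace.single ((s ∘ σ) j) (1 : ℝ)) =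
      (iteratedFDeriv ℝ k f x fun j => EuclideanSpace.single (s j) (1 : ℝ))
    rw [iteratedFDeriv_single_eq_listPartial _ hf, iteratedFDeriv_single_eq_listPartial _ hf]
    exact listPartial_perm (Equiv.Perm.ofFn_comp_perm σ s) f x (by simpa using hf)
  exact congrArg (fun M => M v) this

/-- The multi-index records how often each direction occurs in `s`. With
`mixedPartial_eq_iteratedFDeriv` this allows the Hölder norm, defined by multi-indices, to be
replaced by operator norms of iterated derivatives. -/
theorem exists_iteratedFDeriv_eq_mixedPartial {d k : ℕ} (s : Fin k → Fin d) :
    ∃ a ∈ Finset.piAntidiag (Finset.univ : Finset (Fin d)) k,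
      ∀ (f : EuclideanSpace ℝ (Fin d) → ℝ) (x : EuclideanSpace ℝ (Fin d)),
        ContDiffAt ℝ (k : ℕ) f x →
        (iteratedFDeriv ℝ k f x fun j => EuclideanSpace.single (s j) (1 : ℝ)) =
          mixedPartial a f x := by
  set a : Fin d → ℕ := fun i => (List.ofFn s).count i with ha
  have hperm : (List.ofFn s).Perm (multiIndexList a) := by
    rw [List.perm_iff_count]; intro j; rw [count_multiIndexList]
  refine ⟨a, ?_, ?_⟩
  · rw [Finset.mem_piAntidiag]
    refine ⟨?_, fun _ _ => Finset.mem_univ _⟩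
    rw [← length_multiIndexList, ← hperm.length_eq, List.length_ofFn]
  · intro f x hf
    rw [mixedPartial_eq_listPartial, ← listPartial_perm hperm f x (by simpa using hf),
      iteratedFDeriv_single_eq_listPartial _ hf]

theorem mixedPartial_eq_iteratedFDeriv {d k : ℕ} {a : Fin d → ℕ}
    (ha : a ∈ Finset.piAntidiag (Finset.univ : Finset (Fin d)) k) :
    ∃ s : Fin k → Fin d, ∀ (f : EuclideanSpace ℝ (Fin d) → ℝ) (x : EuclideanSpace ℝ (Fin d)),
        ContDiffAt ℝ (k : ℕ) f x →
        mixedPartial a f x =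
          iteratedFDeriv ℝ k f x fun j => EuclideanSpace.single (s j) (1 : ℝ) := by
  have hk : (multiIndexList a).length = k := by
    rw [length_multiIndexList]; exact (Finset.mem_piAntidiag.1 ha).1
  subst hk
  refine ⟨(multiIndexList a).get, fun f x hf => ?_⟩
  rw [mixedPartial_eq_listPartial, listPartial_eq_iteratedFDeriv _ _ _ hf]

/-- Expand every argument in the standard basis: there are `d^k` terms, and each coordinate is at
most the norm of its vector. -/
theorem multilinear_norm_le_of_basis {d k : ℕ} {F : Type*} [NormedAddCommGroup F]
    [NormedSpace ℝ F]
    (M : ContinuousMultilinearMap ℝ (fun _ : Fin k => EuclideanSpace ℝ (Fin d)) F) {B : ℝ}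
    (hB : 0 ≤ B)
    (h : ∀ s : Fin k → Fin d, ‖M fun j => EuclideanSpace.single (s j) (1 : ℝ)‖ ≤ B) :
    ‖M‖ ≤ (d : ℝ) ^ k * B := by
  refine M.opNorm_le_bound (by positivity) fun m => ?_
  have hm : ∀ j, m j = ∑ i : Fin d, (m j i) • EuclideanSpace.single i (1 : ℝ) := by
    intro j
    ext i
    simp [Pi.single_apply, Finset.sum_apply]
  have : M m = ∑ s : Fin k → Fin d, (∏ j, m j (s j)) •
      M fun j => EuclideanSpace.single (s j) (1 : ℝ) := by
    conv_lhs => rw [show m = fun j => ∑ i : Fin d, (m j i) • EuclideanSpace.single i (1 : ℝ) from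
      funext hm]
    rw [M.map_sum]
    refine Finset.sum_congr rfl fun s _ => ?_
    rw [← M.map_smul_univ]
  rw [this]
  refine (norm_sum_le _ _).trans ?_
  have hc : ∀ s ∈ (Finset.univ : Finset (Fin k → Fin d)), ‖(∏ j, m j (s j)) •
      M fun j => EuclideanSpace.single (s j) (1 : ℝ)‖ ≤ (∏ j, ‖m j‖) * B := by
    intro s _
    rw [norm_smul, norm_prod]
    gcongr
    · exact PiLp.norm_apply_le _ _
    · exact h s
  refine (Finset.sum_le_sum hc).trans (le_of_eq ?_)
  simp [Finset.card_univ]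
  ring

theorem norm_single_le {d k : ℕ} (M : ContinuousMultilinearMap ℝ
    (fun _ : Fin k => EuclideanSpace ℝ (Fin d)) ℝ) (s : Fin k → Fin d) :
    |M fun j => EuclideanSpace.single (s j) (1 : ℝ)| ≤ ‖M‖ := by
  have := M.le_opNorm fun j => EuclideanSpace.single (s j) (1 : ℝ)
  simpa using this

/-! ### The Hölder ball in terms of iterated derivatives. -/

section holder

variable {d : ℕ} {α r : ℝ} {Ω : Set (EuclideanSpace ℝ (Fin d))}
  {f : EuclideanSpace ℝ (Fin d) → ℝ}

theorem abs_mixedPartial_le_of_mem_holderBall (hr : 0 ≤ r) (hf : f ∈ holderBall α r Ω) {k : ℕ}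
    (hk : k ≤ ⌊α⌋₊) {a : Fin d → ℕ}
    (ha : a ∈ Finset.piAntidiag (Finset.univ : Finset (Fin d)) k)
    {x : EuclideanSpace ℝ (Fin d)} (hx : x ∈ Ω) : |mixedPartial a f x| ≤ r := by
  have h := hf.2
  rw [holderNorm] at h
  have h1 : ENNReal.ofReal |mixedPartial a f x| ≤ ENNReal.ofReal r := by
    refine le_trans ?_ (le_self_add.trans h)
    refine le_trans ?_ (Finset.single_le_sum (f := fun m =>
      ∑ a ∈ Finset.piAntidiag (Finset.univ : Finset (Fin d)) m,
      ⨆ x ∈ Ω, ENNReal.ofReal |mixedPartial a f x|) (fun _ _ => zero_le)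
      (Finset.mem_range.2 (Nat.lt_succ_of_le hk)))
    refine le_trans ?_ (Finset.single_le_sum (f := fun a =>
      ⨆ x ∈ Ω, ENNReal.ofReal |mixedPartial a f x|) (fun _ _ => zero_le) ha)
    exact le_iSup₂ (f := fun x (_ : x ∈ Ω) => ENNReal.ofReal |mixedPartial a f x|) x hx
  exact (ENNReal.ofReal_le_ofReal_iff hr).1 h1

theorem abs_mixedPartial_sub_le_of_mem_holderBall (hr : 0 ≤ r) (hf : f ∈ holderBall α r Ω)
    {a : Fin d → ℕ}
    (ha : a ∈ Finset.piAntidiag (Finset.univ : Finset (Fin d)) ⌊α⌋₊)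
    {x y : EuclideanSpace ℝ (Fin d)} (hx : x ∈ Ω) (hy : y ∈ Ω) (hxy : x ≠ y) :
    |mixedPartial a f x - mixedPartial a f y| ≤ r * ‖x - y‖ ^ (α - ⌊α⌋₊) := by
  have h := hf.2
  rw [holderNorm] at h
  have h1 : ENNReal.ofReal (|mixedPartial a f x - mixedPartial a f y| /
      ‖x - y‖ ^ (α - ⌊α⌋₊)) ≤ ENNReal.ofReal r := by
    refine le_trans ?_ (le_add_self.trans h)
    refine le_trans ?_ (Finset.single_le_sum (f := fun a =>
      ⨆ x ∈ Ω, ⨆ y ∈ Ω, ⨆ _ : x ≠ y,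
        ENNReal.ofReal (|mixedPartial a f x - mixedPartial a f y| / ‖x - y‖ ^ (α - ⌊α⌋₊)))
        (fun _ _ => zero_le) ha)
    refine le_trans ?_ (le_iSup₂ (f := fun x (_ : x ∈ Ω) => ⨆ y ∈ Ω, ⨆ _ : x ≠ y,
        ENNReal.ofReal (|mixedPartial a f x - mixedPartial a f y| / ‖x - y‖ ^ (α - ⌊α⌋₊))) x hx)
    refine le_trans ?_ (le_iSup₂ (f := fun y (_ : y ∈ Ω) => ⨆ _ : x ≠ y,
        ENNReal.ofReal (|mixedPartial a f x - mixedPartial a f y| / ‖x - y‖ ^ (α - ⌊α⌋₊))) y hy)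
    exact le_iSup (f := fun _ : x ≠ y =>
        ENNReal.ofReal (|mixedPartial a f x - mixedPartial a f y| / ‖x - y‖ ^ (α - ⌊α⌋₊))) hxy
  have h2 := (ENNReal.ofReal_le_ofReal_iff hr).1 h1
  have : 0 < ‖x - y‖ := norm_pos_iff.2 (sub_ne_zero.2 hxy)
  rwa [div_le_iff₀ (by positivity)] at h2

theorem contDiffAt_of_mem_holderBall (hΩ : IsOpen Ω) (hf : f ∈ holderBall α r Ω)
    {x : EuclideanSpace ℝ (Fin d)} (hx : x ∈ Ω) : ContDiffAt ℝ (⌊α⌋₊ : ℕ) f x :=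
  hf.1.contDiffAt (hΩ.mem_nhds hx)

theorem norm_iteratedFDeriv_le_of_mem_holderBall (hΩ : IsOpen Ω) (hr : 0 ≤ r)
    (hf : f ∈ holderBall α r Ω) {k : ℕ} (hk : k ≤ ⌊α⌋₊)
    {x : EuclideanSpace ℝ (Fin d)} (hx : x ∈ Ω) :
    ‖iteratedFDeriv ℝ k f x‖ ≤ (d : ℝ) ^ k * r := by
  refine multilinear_norm_le_of_basis _ hr fun s => ?_
  obtain ⟨a, ha, h⟩ := exists_iteratedFDeriv_eq_mixedPartial s
  rw [h f x ((contDiffAt_of_mem_holderBall hΩ hf hx).of_le (by exact_mod_cast hk))]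
  exact abs_mixedPartial_le_of_mem_holderBall hr hf hk ha hx

theorem norm_iteratedFDeriv_sub_le_of_mem_holderBall (hΩ : IsOpen Ω) (hr : 0 ≤ r)
    (hf : f ∈ holderBall α r Ω)
    {x y : EuclideanSpace ℝ (Fin d)} (hx : x ∈ Ω) (hy : y ∈ Ω) (hxy : x ≠ y) :
    ‖iteratedFDeriv ℝ ⌊α⌋₊ f x - iteratedFDeriv ℝ ⌊α⌋₊ f y‖ ≤
      (d : ℝ) ^ ⌊α⌋₊ * (r * ‖x - y‖ ^ (α - ⌊α⌋₊)) := by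
  refine multilinear_norm_le_of_basis _ (by positivity) fun s => ?_
  obtain ⟨a, ha, h⟩ := exists_iteratedFDeriv_eq_mixedPartial s
  rw [sub_apply, h f x (contDiffAt_of_mem_holderBall hΩ hf hx),
    h f y (contDiffAt_of_mem_holderBall hΩ hf hy)]
  exact abs_mixedPartial_sub_le_of_mem_holderBall hr hf ha hx hy hxy

/-- The number of summands in the Hölder norm whose top order is `m`. -/
def holderCount (d m : ℕ) : ℕ :=
  (∑ k ∈ Finset.range (m + 1), (Finset.piAntidiag (Finset.univ : Finset (Fin d)) k).card) +
    (Finset.piAntidiag (Finset.univ : Finset (Fin d)) m).card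

/-- Every one of the `holderCount` suprema in the norm evaluates an iterated derivative at unit
vectors, hence is at most `B`. -/
theorem mem_holderBall_of_norm_iteratedFDeriv_le (hΩ : IsOpen Ω) {B : ℝ}
    (hf : ContDiffOn ℝ (⌊α⌋₊ : ℕ) f Ω)
    (h : ∀ k ≤ ⌊α⌋₊, ∀ x ∈ Ω, ‖iteratedFDeriv ℝ k f x‖ ≤ B)
    (h' : ∀ x ∈ Ω, ∀ y ∈ Ω, x ≠ y →
      ‖iteratedFDeriv ℝ ⌊α⌋₊ f x - iteratedFDeriv ℝ ⌊α⌋₊ f y‖ ≤ B * ‖x - y‖ ^ (α - ⌊α⌋₊)) :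
    f ∈ holderBall α (holderCount d ⌊α⌋₊ * B) Ω := by
  refine ⟨hf, ?_⟩
  have hd : ∀ x ∈ Ω, ContDiffAt ℝ (⌊α⌋₊ : ℕ) f x := fun x hx => hf.contDiffAt (hΩ.mem_nhds hx)
  have e : ENNReal.ofReal (holderCount d ⌊α⌋₊ * B) =
      (∑ k ∈ Finset.range (⌊α⌋₊ + 1),
        ∑ a ∈ Finset.piAntidiag (Finset.univ : Finset (Fin d)) k, ENNReal.ofReal B) +
        ∑ a ∈ Finset.piAntidiag (Finset.univ : Finset (Fin d)) ⌊α⌋₊, ENNReal.ofReal B := by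
    rw [ENNReal.ofReal_mul (by positivity), ENNReal.ofReal_natCast]
    simp only [Finset.sum_const, nsmul_eq_mul, holderCount, Nat.cast_add, Nat.cast_sum,
      Finset.sum_mul, add_mul]
  rw [e, holderNorm]
  refine add_le_add (Finset.sum_le_sum fun k hk => Finset.sum_le_sum fun a ha => ?_)
    (Finset.sum_le_sum fun a ha => ?_)
  · refine iSup₂_le fun x hx => ENNReal.ofReal_le_ofReal ?_
    have hk' : k ≤ ⌊α⌋₊ := Nat.lt_succ_iff.1 (Finset.mem_range.1 hk)
    obtain ⟨s, hs⟩ := mixedPartial_eq_iteratedFDeriv ha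
    rw [hs f x ((hd x hx).of_le (by exact_mod_cast hk'))]
    exact (norm_single_le _ _).trans (h k hk' x hx)
  · refine iSup₂_le fun x hx => iSup₂_le fun y hy => iSup_le fun hxy =>
      ENNReal.ofReal_le_ofReal ?_
    obtain ⟨s, hs⟩ := mixedPartial_eq_iteratedFDeriv ha
    have : 0 < ‖x - y‖ := norm_pos_iff.2 (sub_ne_zero.2 hxy)
    rw [div_le_iff₀ (by positivity), hs f x (hd x hx), hs f y (hd y hy),
      ← sub_apply]
    exact (norm_single_le _ _).trans (h' x hx y hy hxy)

theorem holderBall_mono {r' : ℝ} (hr : r ≤ r') : holderBall α r Ω ⊆ holderBall α r' Ω :=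
  fun _ hf => ⟨hf.1, hf.2.trans (ENNReal.ofReal_le_ofReal hr)⟩

theorem abs_le_of_mem_holderBall (hr : 0 ≤ r) (hf : f ∈ holderBall α r Ω)
    {x : EuclideanSpace ℝ (Fin d)} (hx : x ∈ Ω) : |f x| ≤ r := by
  have h := abs_mixedPartial_le_of_mem_holderBall hr hf (Nat.zero_le _) (a := 0) (by simp) hx
  have : mixedPartial (0 : Fin d → ℕ) f = f := by
    rw [mixedPartial]
    induction List.finRange d with
    | nil => rfl
    | cons i l ih => simp only [List.foldr_cons, ih]; rfl
  rwa [this] at h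

end holder

/-! ### Bounded differences and moments of sample means. -/

section concentration

variable {Ω : Type*} [MeasurableSpace Ω] {μ : Measure Ω} [IsProbabilityMeasure μ]

theorem integrable_of_abs_le_const {Ω' : Type*} [MeasurableSpace Ω'] {ν : Measure Ω'}
    [IsFiniteMeasure ν] {h : Ω' → ℝ} (hm : Measurable h) {B : ℝ} (hB : ∀ x, |h x| ≤ B) :
    Integrable h ν :=
  Integrable.of_bound hm.aestronglyMeasurable B (Filter.Eventually.of_forall hB)

theorem measurable_fin_cons {n : ℕ} :
    Measurable fun p : Ω × (Fin n → Ω) => (Fin.cons p.1 p.2 : Fin (n + 1) → Ω) := by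
  rw [measurable_pi_iff]
  intro i
  refine Fin.cases ?_ (fun j => ?_) i
  · simpa using measurable_fst
  · simp only [Fin.cons_succ]
    exact (measurable_pi_apply j).comp measurable_snd

/-- Fubini in a form that splits off the first observation, for the induction on the sample size. -/
theorem integral_pi_succ {n : ℕ} {h : (Fin (n + 1) → Ω) → ℝ} (hm : Measurable h) {B : ℝ}
    (hB : ∀ x, |h x| ≤ B) :
    ∫ X, h X ∂(Measure.pi fun _ : Fin (n + 1) => μ) =
      ∫ x, ∫ a, h (Fin.cons a x) ∂μ ∂(Measure.pi fun _ : Fin n => μ) := by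
  have hp := (measurePreserving_piFinSuccAbove (fun _ : Fin (n + 1) => μ) 0).symm
  rw [← hp.integral_comp (MeasurableEquiv.measurableEmbedding _)]
  have : ∀ p : Ω × (Fin n → Ω),
      (MeasurableEquiv.piFinSuccAbove (fun _ : Fin (n + 1) => Ω) 0).symm p =
        Fin.cons p.1 p.2 := fun p => by
    simp [MeasurableEquiv.piFinSuccAbove, Fin.insertNthEquiv]
  simp only [this]
  rw [integral_prod_symm (fun p : Ω × (Fin n → Ω) => h (Fin.cons p.1 p.2))]
  exact integrable_of_abs_le_const (hm.comp measurable_fin_cons) fun p => hB _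

/-- Exponential moments of functions with bounded differences. -/
theorem mgf_le_of_bounded_differences {c : ℝ} (n : ℕ) (F : (Fin n → Ω) → ℝ)
    (hF : Measurable F) {B : ℝ} (hB : ∀ x, |F x| ≤ B)
    (hd : ∀ x i y, |F (Function.update x i y) - F x| ≤ c) (t : ℝ) :
    ∫ X, Real.exp (t * (F X - ∫ Y, F Y ∂(Measure.pi fun _ : Fin n => μ)))
      ∂(Measure.pi fun _ : Fin n => μ) ≤ Real.exp (n * c ^ 2 * t ^ 2 / 2) := by
  induction n with
  | zero =>
    have : ∀ X : Fin 0 → Ω, F X = F finZeroElim := fun X => by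
      congr 1; exact Subsingleton.elim _ _
    simp [this]
  | succ n ih =>
    have hFc : Measurable fun p : Ω × (Fin n → Ω) => F (Fin.cons p.1 p.2) :=
      hF.comp measurable_fin_cons
    -- Averaging over the first observation keeps measurability, the bound and the bounded
    -- differences, so the induction hypothesis applies to `G`.
    set G : (Fin n → Ω) → ℝ := fun x => ∫ a, F (Fin.cons a x) ∂μ with hG
    have hGm : Measurable G :=
      (hFc.stronglyMeasurable.integral_prod_left').measurable
    have hint : ∀ x : Fin n → Ω, Integrable (fun a => F (Fin.cons a x)) μ := fun x =>
      integrable_of_abs_le_const (hFc.comp (measurable_id.prodMk measurable_const)) fun a => hB _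
    have hGB : ∀ x, |G x| ≤ B := by
      intro x
      have := norm_integral_le_of_norm_le_const (μ := μ) (f := fun a => F (Fin.cons a x))
        (C := B) (Filter.Eventually.of_forall fun a => hB _)
      simpa using this
    have hGd : ∀ x i y, |G (Function.update x i y) - G x| ≤ c := by
      intro x i y
      simp only [hG]
      rw [← integral_sub (hint _) (hint _)]
      have := norm_integral_le_of_norm_le_const (μ := μ)
        (f := fun a => F (Fin.cons a (Function.update x i y)) - F (Fin.cons a x))
        (C := c) (Filter.Eventually.of_forall fun a => by
          have := hd (Fin.cons a x) i.succ y
          rw [Fin.cons_update]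
          exact this)
      simpa using this
    have hE : ∫ Y, F Y ∂(Measure.pi fun _ : Fin (n + 1) => μ) =
        ∫ x, G x ∂(Measure.pi fun _ : Fin n => μ) := integral_pi_succ hF hB
    set m := ∫ x, G x ∂(Measure.pi fun _ : Fin n => μ) with hmdef
    have hmB : |m| ≤ B := by
      have := norm_integral_le_of_norm_le_const (μ := Measure.pi fun _ : Fin n => μ) (f := G)
        (C := B) (Filter.Eventually.of_forall hGB)
      simpa using this
    rw [hE]
    have hbd : ∀ u : ℝ, |u| ≤ B + B → |Real.exp (t * u)| ≤ Real.exp (|t| * (B + B)) := by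
      intro u hu
      rw [Real.abs_exp]
      apply Real.exp_le_exp.2
      refine (le_abs_self _).trans ?_
      rw [abs_mul]
      gcongr
    have hbd1 : ∀ X, |Real.exp (t * (F X - m))| ≤ Real.exp (|t| * (B + B)) := fun X =>
      hbd _ ((abs_sub _ _).trans (add_le_add (hB _) hmB))
    rw [integral_pi_succ (B := Real.exp (|t| * (B + B)))
      ((hF.sub_const _).const_mul _).exp hbd1]
    -- With the other observations fixed, `F` stays within `c` of its average `G x`; Hoeffding's
    -- lemma on an interval of length `2c` gives the factor `exp (c² t² / 2)`.
    have hinner : ∀ x : Fin n → Ω, ∫ a, Real.exp (t * (F (Fin.cons a x) - m)) ∂μ ≤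
        Real.exp (c ^ 2 * t ^ 2 / 2) * Real.exp (t * (G x - m)) := by
      intro x
      have e : ∀ a, Real.exp (t * (F (Fin.cons a x) - m)) =
          Real.exp (t * (F (Fin.cons a x) - G x)) * Real.exp (t * (G x - m)) := by
        intro a; rw [← Real.exp_add]; congr 1; ring
      simp only [e]
      rw [integral_mul_const]
      gcongr
      have hfm : Measurable fun a => F (Fin.cons a x) :=
        hFc.comp (measurable_id.prodMk measurable_const)
      have hr : ∀ a, F (Fin.cons a x) ∈ Set.Icc (G x - c) (G x + c) := by
        intro a
        have h1 : |F (Fin.cons a x) - G x| ≤ c := by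
          have h2 : F (Fin.cons a x) - G x = ∫ b, (F (Fin.cons a x) - F (Fin.cons b x)) ∂μ := by
            rw [integral_sub (integrable_const _) (hint x)]; simp [hG]
          rw [h2]
          have := norm_integral_le_of_norm_le_const (μ := μ)
            (f := fun b => F (Fin.cons a x) - F (Fin.cons b x))
            (C := c) (Filter.Eventually.of_forall fun b => by
              have := hd (Fin.cons b x) 0 a
              rwa [Fin.update_cons_zero] at this)
          simpa using this
        rw [abs_le] at h1
        exact ⟨by linarith, by linarith⟩
      have hs := ProbabilityTheory.hasSubgaussianMGF_of_mem_Icc (μ := μ) hfm.aemeasurable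
        (Filter.Eventually.of_forall hr)
      have := hs.mgf_le t
      rw [ProbabilityTheory.mgf] at this
      refine this.trans (le_of_eq ?_)
      congr 1
      push_cast
      have hc : 0 ≤ c := by
        have := hr (Classical.choice μ.nonempty_of_neZero)
        rw [Set.mem_Icc] at this; linarith
      rw [Real.norm_eq_abs]
      rw [show G x + c - (G x - c) = 2 * c by ring, abs_of_nonneg (by positivity)]
      ring
    have hGe : Measurable fun x => Real.exp (t * (G x - m)) := ((hGm.sub_const _).const_mul _).exp
    have hint1 : Integrable (fun x => Real.exp (t * (G x - m))) (Measure.pi fun _ : Fin n => μ) :=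
      integrable_of_abs_le_const hGe fun x =>
        hbd _ ((abs_sub _ _).trans (add_le_add (hGB _) hmB))
    refine (integral_mono_of_nonneg (Filter.Eventually.of_forall fun x => ?_)
      (hint1.const_mul _) (Filter.Eventually.of_forall hinner)).trans ?_
    · exact integral_nonneg fun a => (Real.exp_pos _).le
    · rw [integral_const_mul]
      refine (mul_le_mul_of_nonneg_left (ih G hGm hGB hGd) (Real.exp_pos _).le).trans
        (le_of_eq ?_)
      rw [← Real.exp_add]
      congr 1
      push_cast
      ring

/-- The bounded differences inequality. -/
theorem measure_ge_le_of_bounded_differences {c : ℝ} (hc : 0 < c) {n : ℕ} (hn : 0 < n)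
    (F : (Fin n → Ω) → ℝ)
    (hF : Measurable F) {B : ℝ} (hB : ∀ x, |F x| ≤ B)
    (hd : ∀ x i y, |F (Function.update x i y) - F x| ≤ c) {s : ℝ} (hs : 0 ≤ s) :
    (Measure.pi fun _ : Fin n => μ).real
      {X | ∫ Y, F Y ∂(Measure.pi fun _ : Fin n => μ) + s ≤ F X} ≤
        Real.exp (-(s ^ 2 / (2 * n * c ^ 2))) := by
  set P := Measure.pi fun _ : Fin n => μ
  set m := ∫ Y, F Y ∂P
  have hmB : |m| ≤ B := by
    have := norm_integral_le_of_norm_le_const (μ := P) (f := F)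
      (C := B) (Filter.Eventually.of_forall hB)
    simpa using this
  -- The minimizer of the Chernoff exponent `-t s + n c² t² / 2`.
  set t := s / (n * c ^ 2) with ht
  have ht0 : 0 ≤ t := by positivity
  have h1 := ProbabilityTheory.measure_ge_le_exp_mul_mgf (μ := P) (X := fun X => F X - m) s ht0
    (integrable_of_abs_le_const (B := Real.exp (|t| * (B + B)))
      ((hF.sub_const _).const_mul _).exp fun x => by
      rw [Real.abs_exp]
      apply Real.exp_le_exp.2
      refine (le_abs_self _).trans ?_
      rw [abs_mul]
      gcongr
      exact (abs_sub _ _).trans (add_le_add (hB _) hmB))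
  have h2 := mgf_le_of_bounded_differences (μ := μ) n F hF hB hd t
  have e : {X | m + s ≤ F X} = {X | s ≤ F X - m} := by
    ext X; simp only [Set.mem_ofPred_eq]; constructor <;> intro h <;> linarith
  rw [e]
  refine h1.trans ((mul_le_mul_of_nonneg_left h2 (Real.exp_pos _).le).trans (le_of_eq ?_))
  rw [← Real.exp_add]
  congr 1
  rw [ht]
  have : (n : ℝ) ≠ 0 := by positivity
  field_simp
  ring

/-- The deviation of the sample mean from the mean. -/
def meanDeviation {n : ℕ} (μ : Measure Ω) (h : Ω → ℝ) (X : Fin n → Ω) : ℝ :=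
  ∫ x, h x ∂μ - (n : ℝ)⁻¹ * ∑ i, h (X i)

theorem memLp_meanDeviation {n : ℕ} {h : Ω → ℝ} (hh : MemLp h 2 μ) :
    MemLp (meanDeviation (n := n) μ h) 2 (Measure.pi fun _ : Fin n => μ) := by
  refine (memLp_const _).sub (MemLp.const_mul ?_ _)
  exact memLp_finsetSum _ fun i _ => hh.comp_measurePreserving (measurePreserving_eval _ i)

/-- The deviation is, up to sign, the centred sum divided by `n`, and variances of independent terms
add. -/
theorem integral_meanDeviation_sq {n : ℕ} (hn : 0 < n) {h : Ω → ℝ} (hh : MemLp h 2 μ) :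
    ∫ X, meanDeviation μ h X ^ 2 ∂(Measure.pi fun _ : Fin n => μ) =
      (n : ℝ)⁻¹ * ProbabilityTheory.variance h μ := by
  set P := Measure.pi fun _ : Fin n => μ
  have hi : ∀ i : Fin n, MemLp (fun X : Fin n → Ω => h (X i)) 2 P := fun i =>
    hh.comp_measurePreserving (measurePreserving_eval _ i)
  have hmean : ∫ X, (∑ i, h (X i)) ∂P = n * ∫ x, h x ∂μ := by
    rw [integral_finsetSum _ fun i _ => (hi i).integrable (by norm_num)]
    have : ∀ i : Fin n, ∫ X, h (X i) ∂P = ∫ x, h x ∂μ := fun i =>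
      integral_comp_eval (μ := fun _ : Fin n => μ) (f := h) hh.aestronglyMeasurable
    simp [this]
  have hsum : MemLp (fun X : Fin n → Ω => ∑ i, h (X i)) 2 P := memLp_finsetSum _ fun i _ => hi i
  have hvar := ProbabilityTheory.variance_sum_pi (μ := fun _ : Fin n => μ)
    (X := fun _ : Fin n => h) (fun _ => hh)
  have e : ∀ X : Fin n → Ω, meanDeviation μ h X ^ 2 =
      ((n : ℝ)⁻¹) ^ 2 * (∑ i, h (X i) - ∫ Y, (∑ i, h (Y i)) ∂P) ^ 2 := by
    intro X
    rw [hmean, meanDeviation]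
    have : (n : ℝ) ≠ 0 := by positivity
    field_simp
    ring
  simp only [e]
  rw [integral_const_mul]
  have hv2 : ∫ X, (∑ i, h (X i) - ∫ Y, (∑ i, h (Y i)) ∂P) ^ 2 ∂P =
      ProbabilityTheory.variance (fun X : Fin n → Ω => ∑ i, h (X i)) P :=
    (ProbabilityTheory.variance_eq_integral hsum.aestronglyMeasurable.aemeasurable).symm
  have e2 : (∑ i, fun X : Fin n → Ω => h (X i)) = fun X : Fin n → Ω => ∑ i, h (X i) := by
    ext X; simp
  rw [e2] at hvar
  rw [hv2, hvar]
  simp only [Finset.sum_const, Finset.card_univ, Fintype.card_fin, nsmul_eq_mul]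
  have : (n : ℝ) ≠ 0 := by positivity
  field_simp

theorem integral_meanDeviation_sq_le {n : ℕ} (hn : 0 < n) {h : Ω → ℝ} (hh : MemLp h 2 μ) :
    ∫ X, meanDeviation μ h X ^ 2 ∂(Measure.pi fun _ : Fin n => μ) ≤
      (n : ℝ)⁻¹ * ∫ x, h x ^ 2 ∂μ := by
  rw [integral_meanDeviation_sq hn hh]
  exact mul_le_mul_of_nonneg_left (ProbabilityTheory.variance_le_expectation_sq (μ := μ) (X := h)
    hh.aestronglyMeasurable) (by positivity)

theorem pow_four_le_exp_add_exp_neg (y : ℝ) : y ^ 4 ≤ 24 * (Real.exp y + Real.exp (-y)) := by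
  have h : ∀ y : ℝ, 0 ≤ y → y ^ 4 ≤ 24 * Real.exp y := by
    intro y hy
    have := Real.pow_div_factorial_le_exp y hy 4
    norm_num [Nat.factorial] at this
    linarith
  rcases le_total 0 y with hy | hy
  · have := h y hy
    have := Real.exp_pos (-y)
    linarith
  · have := h (-y) (by linarith)
    have := Real.exp_pos y
    rw [Even.neg_pow (by decide)] at *
    linarith

theorem measurable_meanDeviation {n : ℕ} {h : Ω → ℝ} (hm : Measurable h) :
    Measurable (meanDeviation (n := n) μ h) := by
  unfold meanDeviation
  fun_prop

theorem abs_meanDeviation_le {n : ℕ} {h : Ω → ℝ} {B : ℝ} (hB : ∀ x, |h x| ≤ B)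
    (X : Fin n → Ω) : |meanDeviation μ h X| ≤ 2 * B := by
  have hB0 : 0 ≤ B := (abs_nonneg _).trans (hB (Classical.choice μ.nonempty_of_neZero))
  have h1 : |∫ x, h x ∂μ| ≤ B := by
    have := norm_integral_le_of_norm_le_const (μ := μ) (f := h)
      (C := B) (Filter.Eventually.of_forall hB)
    simpa using this
  have h2 : |(n : ℝ)⁻¹ * ∑ i, h (X i)| ≤ B := by
    rw [abs_mul, abs_of_nonneg (by positivity)]
    have h3 : |∑ i, h (X i)| ≤ n * B := by
      refine (Finset.abs_sum_le_sum_abs _ _).trans ((Finset.sum_le_sum fun i _ => hB (X i)).trans ?_)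
      simp
    rcases Nat.eq_zero_or_pos n with rfl | hn
    · simpa using hB0
    · have : (n : ℝ) ≠ 0 := by positivity
      calc (n : ℝ)⁻¹ * |∑ i, h (X i)| ≤ (n : ℝ)⁻¹ * (n * B) := by gcongr
        _ = B := by field_simp
  have := abs_sub (∫ x, h x ∂μ) ((n : ℝ)⁻¹ * ∑ i, h (X i))
  unfold meanDeviation
  linarith

theorem meanDeviation_update_sub_le {n : ℕ} {h : Ω → ℝ} {B : ℝ} (hB : ∀ x, |h x| ≤ B)
    (X : Fin n → Ω) (i : Fin n) (y : Ω) :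
    |meanDeviation μ h (Function.update X i y) - meanDeviation μ h X| ≤ 2 * B / n := by
  have e : meanDeviation μ h (Function.update X i y) - meanDeviation μ h X =
      (n : ℝ)⁻¹ * (h (X i) - h y) := by
    have h1 : ∑ j, h (Function.update X i y j) = ∑ j, h (X j) - h (X i) + h y := by
      rw [← Finset.add_sum_erase _ _ (Finset.mem_univ i),
        ← Finset.add_sum_erase _ (fun j => h (X j)) (Finset.mem_univ i)]
      have : ∑ j ∈ Finset.univ.erase i, h (Function.update X i y j) =
          ∑ j ∈ Finset.univ.erase i, h (X j) :=
        Finset.sum_congr rfl fun j hj => by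
          rw [Function.update_of_ne (Finset.ne_of_mem_erase hj)]
      rw [this]
      simp
      ring
    simp only [meanDeviation, h1]
    ring
  rw [e, abs_mul, abs_of_nonneg (by positivity), inv_mul_eq_div]
  gcongr
  have := abs_sub (h (X i)) (h y)
  linarith [hB (X i), hB y]

/-- A non-degenerate sample mean has mean absolute deviation of order `n ^ (-1/2)`. -/
theorem exists_le_integral_abs_meanDeviation {h : Ω → ℝ} (hm : Measurable h)
    (hB : ∀ x, |h x| ≤ 1) (hv : 0 < ProbabilityTheory.variance h μ) :
    ∃ c : ℝ, 0 < c ∧ ∀ n : ℕ, 0 < n →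
      c / √n ≤ ∫ X, |meanDeviation μ h X| ∂(Measure.pi fun _ : Fin n => μ) := by
  set v := ProbabilityTheory.variance h μ with hvdef
  -- The fourth moment of the deviation will be at most `E / n²`. Use `y⁴ ≤ 24 (e^y + e^(-y))` at `y
  -- = √n D`; each exponential moment is at most `e²` by the bounded differences `2 / n`.
  set E := 48 * Real.exp 2 with hE
  have hE0 : 0 < E := by positivity
  -- With this scale the fourth moment term below takes away exactly half of the second moment term.
  set K := √(2 * E / v) with hK
  have hK0 : 0 < K := Real.sqrt_pos.2 (by positivity)
  have hK2 : K ^ 2 = 2 * E / v := Real.sq_sqrt (by positivity)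
  have hL2 : MemLp h 2 μ :=
    MemLp.of_bound hm.aestronglyMeasurable 1 (Filter.Eventually.of_forall hB)
  refine ⟨v / (2 * K), by positivity, fun n hn => ?_⟩
  set P := Measure.pi fun _ : Fin n => μ with hP
  set D := meanDeviation (n := n) μ h with hD
  have hn0 : (0 : ℝ) < n := by exact_mod_cast hn
  have hsn : √(n : ℝ) ^ 2 = n := Real.sq_sqrt hn0.le
  have hsn0 : 0 < √(n : ℝ) := Real.sqrt_pos.2 hn0
  have hDm : Measurable D := measurable_meanDeviation hm
  have hDB : ∀ X, |D X| ≤ 2 * 1 := fun X => abs_meanDeviation_le hB X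
  have hint : ∀ g : ℝ → ℝ, Continuous g → Integrable (fun X => g (D X)) P := by
    intro g hg
    obtain ⟨b, hb⟩ := (isCompact_Icc (a := (-2 : ℝ)) (b := 2)).exists_bound_of_continuousOn
      hg.continuousOn
    refine integrable_of_abs_le_const (B := b) (hg.measurable.comp hDm) fun X => hb _ ?_
    have := abs_le.1 (hDB X)
    exact ⟨by linarith, by linarith⟩
  have hD0 : ∫ X, D X ∂P = 0 := by
    have hi : ∀ i : Fin n, Integrable (fun X : Fin n → Ω => h (X i)) P := fun i =>
      integrable_of_abs_le_const (hm.comp (measurable_pi_apply i)) fun X => hB _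
    have : ∀ i : Fin n, ∫ X, h (X i) ∂P = ∫ x, h x ∂μ := fun i =>
      integral_comp_eval (μ := fun _ : Fin n => μ) (f := h) hm.aestronglyMeasurable
    simp only [hD, meanDeviation]
    rw [integral_sub (integrable_const _) ((integrable_finsetSum _ fun i _ => hi i).const_mul _),
      integral_const_mul, integral_finsetSum _ fun i _ => hi i]
    simp only [this]
    simp [hn0.ne']
  have hexp : ∀ t : ℝ, t ^ 2 = n → ∫ X, Real.exp (t * D X) ∂P ≤ Real.exp 2 := by
    intro t ht
    have := mgf_le_of_bounded_differences (μ := μ) n D hDm hDB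
      (fun x i y => meanDeviation_update_sub_le hB x i y) t
    rw [hD0] at this
    simp only [sub_zero] at this
    refine this.trans (le_of_eq ?_)
    rw [ht]
    congr 1
    field_simp
  have h4 : ∫ X, D X ^ 4 ∂P ≤ E / n ^ 2 := by
    have h1 : ∀ X, D X ^ 4 ≤ 24 / n ^ 2 *
        (Real.exp (√n * D X) + Real.exp (-√n * D X)) := by
      intro X
      have := pow_four_le_exp_add_exp_neg (√n * D X)
      have e4 : √(n : ℝ) ^ 4 = n ^ 2 := by rw [show 4 = 2 * 2 from rfl, pow_mul, hsn]
      rw [mul_pow, e4] at this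
      rw [div_mul_eq_mul_div, le_div_iff₀ (by positivity), neg_mul]
      linarith
    refine (integral_mono (hint (fun s => s ^ 4) (by fun_prop)) (((hint (fun s =>
      Real.exp (√n * s)) (by fun_prop)).add (hint (fun s =>
      Real.exp (-√n * s)) (by fun_prop))).const_mul _) h1).trans ?_
    rw [integral_const_mul]
    rw [integral_add' (hint (fun s => Real.exp (√n * s)) (by fun_prop)) (hint (fun s =>
      Real.exp (-√n * s)) (by fun_prop))]
    have a1 := hexp (√n) hsn
    have a2 := hexp (-√n) (by rw [neg_sq, hsn])
    calc _ ≤ 24 / (n : ℝ) ^ 2 * (Real.exp 2 + Real.exp 2) := by gcongr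
      _ = E / n ^ 2 := by rw [hE]; ring
  have h2 : ∫ X, D X ^ 2 ∂P = (n : ℝ)⁻¹ * v := integral_meanDeviation_sq hn hL2
  -- The inequality `u² - u⁴ ≤ u` for `u = √n |D| / K ≥ 0`; integrated, it bounds the first absolute
  -- moment below by the second and fourth moments.
  have hpt : ∀ X, √n / K * D X ^ 2 - (√n / K) ^ 3 * D X ^ 4 ≤ |D X| := by
    intro X
    set u := √n / K * |D X| with hu
    have hu0 : 0 ≤ u := by positivity
    have key : u ^ 2 - u ^ 4 ≤ u := by
      rcases le_total u 1 with h1 | h1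
      · nlinarith [pow_nonneg hu0 4]
      · nlinarith [pow_nonneg hu0 2, mul_nonneg (pow_nonneg hu0 2) (by nlinarith : 0 ≤ u ^ 2 - 1)]
    have hc : 0 < √n / K := by positivity
    have e2 : D X ^ 2 = |D X| ^ 2 := (sq_abs _).symm
    have e4 : D X ^ 4 = |D X| ^ 4 := by rw [Even.pow_abs (by decide)]
    rw [e2, e4]
    have : √n / K * (√n / K * |D X| ^ 2 - (√n / K) ^ 3 * |D X| ^ 4) ≤ √n / K * |D X| := by
      calc _ = u ^ 2 - u ^ 4 := by rw [hu]; ring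
        _ ≤ u := key
    exact le_of_mul_le_mul_left this hc
  have h5 := integral_mono (((hint (fun s => s ^ 2) (by fun_prop)).const_mul (√n / K)).sub
    ((hint (fun s => s ^ 4) (by fun_prop)).const_mul ((√n / K) ^ 3)))
    (hint (fun s => |s|) (by fun_prop)) hpt
  rw [integral_sub' ((hint (fun s => s ^ 2) (by fun_prop)).const_mul (√n / K))
    ((hint (fun s => s ^ 4) (by fun_prop)).const_mul ((√n / K) ^ 3)),
    integral_const_mul, integral_const_mul, h2] at h5
  refine le_trans ?_ h5
  have h6 : (√n / K) ^ 3 * ∫ X, D X ^ 4 ∂P ≤ (√n / K) ^ 3 * (E / n ^ 2) := by gcongr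
  have e3 : √(n : ℝ) ^ 3 = n * √n := by rw [pow_succ, hsn]
  have hKv : E = K ^ 2 * v / 2 := by rw [hK2]; field_simp
  have h7 : v / (2 * K) / √n = √n / K * ((n : ℝ)⁻¹ * v) - (√n / K) ^ 3 * (E / n ^ 2) := by
    rw [div_pow, e3, hKv]
    have hn' : (n : ℝ) = √n ^ 2 := hsn.symm
    set w := √(n : ℝ)
    rw [hn']
    field_simp
    ring
  linarith

end concentration

/-! ### The empirical supremum and its concentration. -/

section empiricalProcess

variable {D n : ℕ} {γ : ℝ} {μ : Measure (EuclideanSpace ℝ (Fin D))}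

theorem continuous_of_mem_holderBall_univ {r : ℝ} {f : EuclideanSpace ℝ (Fin D) → ℝ}
    (hf : f ∈ holderBall γ r Set.univ) : Continuous f :=
  (contDiffOn_univ.1 hf.1).continuous

theorem empiricalSup_eq (X : Fin n → EuclideanSpace ℝ (Fin D)) :
    empiricalSup γ μ X = ⨆ f ∈ holderBall γ 1 (Set.univ : Set (EuclideanSpace ℝ (Fin D))),
      ENNReal.ofReal |meanDeviation μ f X| := rfl

/-- The supremum runs over an uncountable class, but each member is continuous in the sample, so the
supremum is lower semicontinuous. -/
theorem measurable_empiricalSup :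
    Measurable fun X : Fin n → EuclideanSpace ℝ (Fin D) => empiricalSup γ μ X := by
  apply LowerSemicontinuous.measurable
  refine lowerSemicontinuous_biSup fun f hf => ?_
  apply Continuous.lowerSemicontinuous
  apply ENNReal.continuous_ofReal.comp
  have := continuous_of_mem_holderBall_univ hf
  fun_prop

variable [IsProbabilityMeasure μ]

theorem empiricalSup_le_two (X : Fin n → EuclideanSpace ℝ (Fin D)) :
    empiricalSup γ μ X ≤ ENNReal.ofReal 2 := by
  refine iSup₂_le fun f hf => ENNReal.ofReal_le_ofReal ?_
  have := abs_meanDeviation_le (μ := μ)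
    (fun x => abs_le_of_mem_holderBall zero_le_one hf (Set.mem_univ x)) X
  rw [mul_one] at this
  exact this

theorem empiricalSup_update_le (X : Fin n → EuclideanSpace ℝ (Fin D)) (i : Fin n)
    (y : EuclideanSpace ℝ (Fin D)) :
    empiricalSup γ μ (Function.update X i y) ≤
      empiricalSup γ μ X + ENNReal.ofReal (2 / n) := by
  rw [empiricalSup_eq]
  refine iSup₂_le fun f hf => ?_
  have h1 := meanDeviation_update_sub_le (μ := μ)
    (fun x => abs_le_of_mem_holderBall zero_le_one hf (Set.mem_univ x)) X i y
  have h2 : |meanDeviation μ f (Function.update X i y)| ≤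
      |meanDeviation μ f X| + 2 / n := by
    have := abs_sub_abs_le_abs_sub (meanDeviation μ f (Function.update X i y))
      (meanDeviation μ f X)
    rw [mul_one] at h1
    linarith
  refine (ENNReal.ofReal_le_ofReal h2).trans ?_
  rw [ENNReal.ofReal_add (abs_nonneg _) (by positivity)]
  gcongr
  rw [empiricalSup_eq]
  exact le_iSup₂ (f := fun f (_ : f ∈ holderBall γ 1
    (Set.univ : Set (EuclideanSpace ℝ (Fin D)))) => ENNReal.ofReal |meanDeviation μ f X|) f hf

/-- A bound in mean for the empirical process gives a bound with high probability. -/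
theorem lt_sampleLaw_of_lintegral_empiricalSup_le (hn : 2 ≤ n) {R : ℝ} (hR : 0 ≤ R)
    (h : ∫⁻ X, empiricalSup γ μ X ∂(sampleLaw n μ) ≤ ENNReal.ofReal R) {S : ℝ}
    (hS : R + 4 * √(Real.log n / n) ≤ S) :
    1 - (n : ℝ≥0∞)⁻¹ < sampleLaw n μ {X | empiricalSup γ μ X ≤ ENNReal.ofReal S} := by
  have hn0 : (0 : ℝ) < n := by positivity
  set P := sampleLaw n μ with hP
  have : IsProbabilityMeasure P := by rw [hP, sampleLaw]; infer_instance
  set F : (Fin n → EuclideanSpace ℝ (Fin D)) → ℝ := fun X => (empiricalSup γ μ X).toReal with hF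
  have hfin : ∀ X : Fin n → EuclideanSpace ℝ (Fin D), empiricalSup γ μ X ≠ ∞ := fun X =>
    ((empiricalSup_le_two X).trans_lt ENNReal.ofReal_lt_top).ne
  have hFm : Measurable F := measurable_empiricalSup.ennreal_toReal
  have hFB : ∀ X, |F X| ≤ 2 := by
    intro X
    rw [abs_of_nonneg ENNReal.toReal_nonneg]
    exact ENNReal.toReal_le_of_le_ofReal (by norm_num) (empiricalSup_le_two X)
  have hFd1 : ∀ X i y, F (Function.update X i y) ≤ F X + 2 / n := by
    intro X i y
    have := ENNReal.toReal_mono (by simp [hfin]) (empiricalSup_update_le (γ := γ) (μ := μ) X i y)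
    rwa [ENNReal.toReal_add (hfin _) (by simp), ENNReal.toReal_ofReal (by positivity)] at this
  have hFd : ∀ X i y, |F (Function.update X i y) - F X| ≤ 2 / n := by
    intro X i y
    rw [abs_le]
    have h1 := hFd1 X i y
    have h2 := hFd1 (Function.update X i y) i (X i)
    rw [Function.update_idem, Function.update_eq_self] at h2
    constructor <;> linarith
  have hmean : ∫ X, F X ∂P ≤ R := by
    rw [integral_toReal measurable_empiricalSup.aemeasurable
      (Filter.Eventually.of_forall fun X => (hfin X).lt_top)]
    exact ENNReal.toReal_le_of_le_ofReal hR h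
  have hlog : 0 < Real.log n := Real.log_pos (by exact_mod_cast hn)
  have htail := measure_ge_le_of_bounded_differences (μ := μ) (c := 2 / n) (by positivity)
    (by omega) F hFm hFB hFd (s := 4 * √(Real.log n / n)) (by positivity)
  -- For differences `2 / n` and deviation `4 √(log n / n)` the exponent is `2 log n`. The tail
  -- `n⁻²` is strictly below `n⁻¹` as `n ≥ 2`, which gives the strict inequality.
  have hexp : Real.exp (-((4 * √(Real.log n / n)) ^ 2 / (2 * n * (2 / n : ℝ) ^ 2))) =
      ((n : ℝ) ^ 2)⁻¹ := by
    rw [mul_pow, Real.sq_sqrt (by positivity), Real.exp_neg]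
    congr 1
    rw [show 4 ^ 2 * (Real.log n / n) / (2 * n * (2 / n : ℝ) ^ 2) = Real.log n + Real.log n by
      field_simp; norm_num, Real.exp_add, Real.exp_log hn0, sq]
  rw [hexp] at htail
  have hmeas : MeasurableSet {X : Fin n → EuclideanSpace ℝ (Fin D) |
      empiricalSup γ μ X ≤ ENNReal.ofReal S} := measurableSet_le measurable_empiricalSup
        measurable_const
  have hcompl : P.real {X | empiricalSup γ μ X ≤ ENNReal.ofReal S}ᶜ ≤ ((n : ℝ) ^ 2)⁻¹ := by
    refine le_trans (measureReal_mono (fun X hX => ?_)) htail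
    rw [Set.mem_compl_iff, Set.mem_ofPred_eq, not_le] at hX
    have hS0 : 0 ≤ S := le_trans (by positivity) hS
    have := (ENNReal.ofReal_lt_iff_lt_toReal hS0 (hfin X)).1 hX
    change ∫ X, F X ∂P + _ ≤ F X
    linarith
  rw [probReal_compl_eq_one_sub hmeas] at hcompl
  have hlt : ((n : ℝ) ^ 2)⁻¹ < (n : ℝ)⁻¹ := by
    have h2 : (2 : ℝ) ≤ n := by exact_mod_cast hn
    apply inv_strictAnti₀ hn0
    nlinarith
  have h1 : 1 - (n : ℝ)⁻¹ < P.real {X | empiricalSup γ μ X ≤ ENNReal.ofReal S} := by linarith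
  rw [← ofReal_measureReal]
  have e : (1 : ℝ≥0∞) - (n : ℝ≥0∞)⁻¹ = ENNReal.ofReal (1 - (n : ℝ)⁻¹) := by
    rw [ENNReal.ofReal_sub _ (by positivity), ENNReal.ofReal_one, ENNReal.ofReal_inv_of_pos hn0,
      ENNReal.ofReal_natCast]
  rw [e]
  refine (ENNReal.ofReal_lt_ofReal_iff_of_nonneg ?_).2 h1
  have : (n : ℝ)⁻¹ ≤ 1 := inv_le_one_of_one_le₀ (by exact_mod_cast (by omega : 1 ≤ n))
  linarith

end empiricalProcess

/-! ### Uniform regularity of the parametrizations. -/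

section charts

variable {d D : ℕ}

theorem euclidean_norm_le_of_abs_le {k : ℕ} {v : EuclideanSpace ℝ (Fin k)} {B : ℝ}
    (h : ∀ j, |v j| ≤ B) : ‖v‖ ≤ k * B := by
  have e : v = ∑ j, v j • EuclideanSpace.single j (1 : ℝ) := by
    ext i
    simp [Pi.single_apply, Finset.sum_apply]
  rw [e]
  refine (norm_sum_le _ _).trans ((Finset.sum_le_sum fun j _ => ?_).trans
    (le_of_eq (by simp : ∑ _j : Fin k, B = k * B)))
  simpa [norm_smul] using h j

theorem fderiv_euclidean_apply {ψ : EuclideanSpace ℝ (Fin d) → EuclideanSpace ℝ (Fin D)}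
    {z : EuclideanSpace ℝ (Fin d)} (h : DifferentiableAt ℝ ψ z) (v : EuclideanSpace ℝ (Fin d))
    (j : Fin D) : fderiv ℝ ψ z v j = fderiv ℝ (fun w => ψ w j) z v := by
  have h1 : HasFDerivAt (fun w => ψ w j)
      ((EuclideanSpace.proj j : EuclideanSpace ℝ (Fin D) →L[ℝ] ℝ).comp (fderiv ℝ ψ z)) z :=
    (EuclideanSpace.proj j : EuclideanSpace ℝ (Fin D) →L[ℝ] ℝ).hasFDerivAt.comp z h.hasFDerivAt
  rw [h1.fderiv]
  rfl

theorem norm_clm_le_of_abs_apply_le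
    {T : EuclideanSpace ℝ (Fin d) →L[ℝ] EuclideanSpace ℝ (Fin D)} {B : ℝ} (hB : 0 ≤ B)
    (h : ∀ v j, |T v j| ≤ B * ‖v‖) : ‖T‖ ≤ D * B := by
  refine T.opNorm_le_bound (by positivity) fun v => ?_
  rw [mul_assoc]
  exact euclidean_norm_le_of_abs_le (h v)

variable {β L : ℝ} {Ω : Set (EuclideanSpace ℝ (Fin d))}
  {ψ : EuclideanSpace ℝ (Fin d) → EuclideanSpace ℝ (Fin D)}

theorem contDiffOn_of_mem_holderBallVec (hψ : ψ ∈ holderBallVec β L Ω) :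
    ContDiffOn ℝ (⌊β⌋₊ : ℕ) ψ Ω :=
  contDiffOn_euclidean.2 fun j => (hψ j).1

theorem one_le_floor (hβ : 1 < β) : 1 ≤ ⌊β⌋₊ := Nat.le_floor (by simpa using hβ.le)

theorem differentiableAt_of_mem_holderBallVec (hβ : 1 < β) (hΩ : IsOpen Ω)
    (hψ : ψ ∈ holderBallVec β L Ω) {z : EuclideanSpace ℝ (Fin d)} (hz : z ∈ Ω) :
    DifferentiableAt ℝ ψ z :=
  ((contDiffOn_of_mem_holderBallVec hψ).contDiffAt (hΩ.mem_nhds hz)).differentiableAt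
    (by have := one_le_floor hβ; norm_cast; omega)

theorem norm_fderiv_le_of_mem_holderBallVec (hβ : 1 < β) (hL : 0 ≤ L) (hΩ : IsOpen Ω)
    (hψ : ψ ∈ holderBallVec β L Ω) {z : EuclideanSpace ℝ (Fin d)} (hz : z ∈ Ω) :
    ‖fderiv ℝ ψ z‖ ≤ D * (d * L) := by
  refine norm_clm_le_of_abs_apply_le (by positivity) fun v j => ?_
  rw [fderiv_euclidean_apply (differentiableAt_of_mem_holderBallVec hβ hΩ hψ hz)]
  have h1 := norm_iteratedFDeriv_le_of_mem_holderBall hΩ hL (hψ j) (one_le_floor hβ) hz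
  have h2 := (iteratedFDeriv ℝ 1 (fun w => ψ w j) z).le_opNorm fun _ => v
  rw [iteratedFDeriv_one_apply] at h2
  rw [pow_one] at h1
  refine (Real.norm_eq_abs _ ▸ h2).trans ?_
  simp only [Finset.univ_unique, Finset.prod_const, Finset.card_singleton, pow_one]
  gcongr

/-- A modulus of continuity of the derivative, uniform over the Hölder ball. -/
theorem exists_modulus_fderiv (d D : ℕ) (hβ : 1 < β) (hL : 0 < L) :
    ∃ (θ C : ℝ), 0 < θ ∧ 0 < C ∧
      ∀ (Ω : Set (EuclideanSpace ℝ (Fin d)))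
        (ψ : EuclideanSpace ℝ (Fin d) → EuclideanSpace ℝ (Fin D)), IsOpen Ω →
      ψ ∈ holderBallVec β L Ω → ∀ z w : EuclideanSpace ℝ (Fin d), segment ℝ w z ⊆ Ω →
      ‖fderiv ℝ ψ z - fderiv ℝ ψ w‖ ≤ C * ‖z - w‖ ^ θ := by
  have key : ∃ (θ C : ℝ), 0 < θ ∧ 0 < C ∧ ∀ (Ω : Set (EuclideanSpace ℝ (Fin d)))
        (f : EuclideanSpace ℝ (Fin d) → ℝ), IsOpen Ω →
      f ∈ holderBall β L Ω → ∀ z w : EuclideanSpace ℝ (Fin d), segment ℝ w z ⊆ Ω →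
      ‖iteratedFDeriv ℝ 1 f z - iteratedFDeriv ℝ 1 f w‖ ≤ C * ‖z - w‖ ^ θ := by
    -- If `⌊β⌋ = 1`, the Hölder seminorm itself is the modulus, with exponent `β - 1 > 0`. Otherwise
    -- second derivatives are bounded and the mean value inequality applies; `Ω` need not be convex,
    -- so the whole segment has to lie in it.
    rcases (one_le_floor hβ).eq_or_lt with h1 | h1
    · refine ⟨β - 1, (d + 1) * L, by linarith, by positivity, fun Ω f hΩ hf z w hzw => ?_⟩
      by_cases hne : z = w
      · subst hne; simp; positivity
      have := norm_iteratedFDeriv_sub_le_of_mem_holderBall hΩ hL.le hf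
        (hzw (right_mem_segment ℝ w z)) (hzw (left_mem_segment ℝ w z)) hne
      rw [← h1] at this
      refine this.trans ?_
      rw [pow_one, Nat.cast_one, mul_assoc]
      gcongr
      linarith
    · refine ⟨1, (d + 1) ^ 2 * L, by norm_num, by positivity, fun Ω f hΩ hf z w hzw => ?_⟩
      rw [Real.rpow_one]
      refine (convex_segment w z).norm_image_sub_le_of_norm_fderiv_le (𝕜 := ℝ)
        (f := iteratedFDeriv ℝ 1 f) (fun x hx => ?_) (fun x hx => ?_)
        (left_mem_segment ℝ w z) (right_mem_segment ℝ w z)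
      · exact ((contDiffAt_of_mem_holderBall hΩ hf (hzw hx)).of_le
          (m := 2) (by exact_mod_cast h1)).differentiableAt_iteratedFDeriv (by norm_num)
      · rw [norm_fderiv_iteratedFDeriv]
        refine (norm_iteratedFDeriv_le_of_mem_holderBall hΩ hL.le hf h1 (hzw hx)).trans ?_
        gcongr
        linarith
  obtain ⟨θ, C, hθ, hC, h⟩ := key
  refine ⟨θ, (D + 1) * C, hθ, by positivity, fun Ω ψ hΩ hψ z w hzw => ?_⟩
  have hz := hzw (right_mem_segment ℝ w z)
  have hw := hzw (left_mem_segment ℝ w z)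
  have h1 : ‖fderiv ℝ ψ z - fderiv ℝ ψ w‖ ≤ D * (C * ‖z - w‖ ^ θ) := by
    refine norm_clm_le_of_abs_apply_le (by positivity) fun v j => ?_
    have e : (fderiv ℝ ψ z - fderiv ℝ ψ w) v j =
        (iteratedFDeriv ℝ 1 (fun x => ψ x j) z - iteratedFDeriv ℝ 1 (fun x => ψ x j) w)
          (fun _ => v) := by
      rw [sub_apply, sub_apply, iteratedFDeriv_one_apply,
        iteratedFDeriv_one_apply,
        ← fderiv_euclidean_apply (differentiableAt_of_mem_holderBallVec hβ hΩ hψ hz),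
        ← fderiv_euclidean_apply (differentiableAt_of_mem_holderBallVec hβ hΩ hψ hw)]
      rfl
    rw [e]
    refine (Real.norm_eq_abs _ ▸ (ContinuousMultilinearMap.le_opNorm _ _)).trans ?_
    simp only [Finset.univ_unique, Finset.prod_const, Finset.card_singleton, pow_one]
    gcongr
    exact h Ω _ hΩ (hψ j) z w hzw
  refine h1.trans ?_
  rw [mul_assoc]
  gcongr
  linarith

/-- Parametrizations in the Hölder ball whose Jacobians are bounded below are bi-Lipschitz on
balls of a uniform size. -/
theorem exists_radius_antilipschitz (d D : ℕ) (hβ : 1 < β) (hL : 0 < L) {r₀ : ℝ} (hr₀ : 0 < r₀) :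
    ∃ ρ : ℝ, 0 < ρ ∧ ρ ≤ r₀ ∧ ∀ (Ω : Set (EuclideanSpace ℝ (Fin d)))
        (ψ : EuclideanSpace ℝ (Fin d) → EuclideanSpace ℝ (Fin D)), IsOpen Ω →
      ψ ∈ holderBallVec β L Ω → ∀ z₀, Metric.closedBall z₀ ρ ⊆ Ω →
      (∀ v, 1 / L * ‖v‖ ≤ ‖fderiv ℝ ψ z₀ v‖) →
      ∀ z ∈ Metric.closedBall z₀ ρ, ∀ w ∈ Metric.closedBall z₀ ρ,
        ‖z - w‖ ≤ 2 * L * ‖ψ z - ψ w‖ := by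
  obtain ⟨θ, C, hθ, hC, h⟩ := exists_modulus_fderiv d D hβ hL
  -- On a ball of this radius the derivative moves by at most `1 / (2L)`, half of the lower bound `1
  -- / L` at the centre; the other half survives.
  set ρ := min r₀ ((1 / (2 * L * C)) ^ θ⁻¹) with hρ
  have hρ0 : 0 < ρ := lt_min hr₀ (Real.rpow_pos_of_pos (by positivity) _)
  have hρθ : C * ρ ^ θ ≤ 1 / (2 * L) := by
    have : ρ ^ θ ≤ ((1 / (2 * L * C)) ^ θ⁻¹) ^ θ :=
      Real.rpow_le_rpow hρ0.le (min_le_right _ _) hθ.le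
    rw [← Real.rpow_mul (by positivity), inv_mul_cancel₀ hθ.ne', Real.rpow_one] at this
    calc C * ρ ^ θ ≤ C * (1 / (2 * L * C)) := by gcongr
      _ = 1 / (2 * L) := by field_simp
  refine ⟨ρ, hρ0, min_le_left _ _, fun Ω ψ hΩ hψ z₀ hb hJ z hz w hw => ?_⟩
  have hconv := convex_closedBall z₀ ρ
  have hz₀ : z₀ ∈ Metric.closedBall z₀ ρ := Metric.mem_closedBall_self hρ0.le
  have h1 := hconv.norm_image_sub_le_of_norm_fderiv_le' (𝕜 := ℝ) (f := ψ) (φ := fderiv ℝ ψ z₀)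
    (C := 1 / (2 * L)) (fun x hx => differentiableAt_of_mem_holderBallVec hβ hΩ hψ (hb hx))
    (fun x hx => by
      refine (h Ω ψ hΩ hψ x z₀ ((hconv.segment_subset hz₀ hx).trans hb)).trans ?_
      refine le_trans ?_ hρθ
      gcongr
      exact mem_closedBall_iff_norm.1 hx) hw hz
  have h2 := hJ (z - w)
  have h3 := norm_sub_norm_le (fderiv ℝ ψ z₀ (z - w)) (ψ z - ψ w)
  rw [norm_sub_rev (fderiv ℝ ψ z₀ (z - w))] at h3
  have h4 : 1 / (2 * L) * ‖z - w‖ ≤ ‖ψ z - ψ w‖ := by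
    have : 1 / L * ‖z - w‖ = 1 / (2 * L) * ‖z - w‖ + 1 / (2 * L) * ‖z - w‖ := by
      field_simp; norm_num
    linarith
  rw [one_div, inv_mul_eq_div, div_le_iff₀ (by positivity)] at h4
  linarith

theorem jacobianMatrix_mulVec {z : EuclideanSpace ℝ (Fin d)} (v : EuclideanSpace ℝ (Fin d)) :
    (jacobianMatrix ψ z).mulVec v.ofLp = (fderiv ℝ ψ z v).ofLp := by
  have e : v = ∑ j, v j • EuclideanSpace.single j (1 : ℝ) := by
    ext i
    simp [Pi.single_apply, Finset.sum_apply]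
  conv_rhs => rw [e, map_sum]
  ext i
  simp [jacobianMatrix, Matrix.mulVec, dotProduct, Finset.sum_apply, mul_comm]

/-- Bounds for the volume density of a parametrization. -/
theorem det_jacobianMatrix_bounds {z : EuclideanSpace ℝ (Fin d)} {a b : ℝ} (ha : 0 ≤ a)
    (h1 : ∀ v, a * ‖v‖ ≤ ‖fderiv ℝ ψ z v‖) (h2 : ∀ v, ‖fderiv ℝ ψ z v‖ ≤ b * ‖v‖) :
    a ^ d ≤ √((jacobianMatrix ψ z).transpose * jacobianMatrix ψ z).det ∧
      √((jacobianMatrix ψ z).transpose * jacobianMatrix ψ z).det ≤ b ^ d := by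
  set J := jacobianMatrix ψ z
  have hH : (J.transpose * J).IsHermitian := by
    rw [Matrix.IsHermitian, Matrix.conjTranspose_mul]
    simp [Matrix.conjTranspose_eq_transpose_of_trivial]
  -- The eigenvalues of the Gram matrix are the squared lengths of the images of an orthonormal
  -- eigenbasis, so the root of its determinant is a product of `d` lengths in `[a, b]`.
  have hev : ∀ i, hH.eigenvalues i = ‖fderiv ℝ ψ z (hH.eigenvectorBasis i)‖ ^ 2 := by
    intro i
    rw [hH.eigenvalues_eq, ← Matrix.mulVec_mulVec, EuclideanSpace.norm_sq_eq,
      ← jacobianMatrix_mulVec, Matrix.dotProduct_mulVec, Matrix.vecMul_transpose]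
    simp [dotProduct, sq, J]
  have hn : ∀ i, ‖hH.eigenvectorBasis i‖ = 1 := fun i => hH.eigenvectorBasis.orthonormal.1 i
  have hdet : (J.transpose * J).det =
      (∏ i, ‖fderiv ℝ ψ z (hH.eigenvectorBasis i)‖) ^ 2 := by
    rw [hH.det_eq_prod_eigenvalues, ← Finset.prod_pow]
    simp [hev]
  rw [hdet, Real.sqrt_sq (Finset.prod_nonneg fun _ _ => norm_nonneg _)]
  constructor
  · calc a ^ d = ∏ _i : Fin d, a := by simp
      _ ≤ _ := Finset.prod_le_prod (fun _ _ => ha) fun i _ => by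
        have := h1 (hH.eigenvectorBasis i); rwa [hn, mul_one] at this
  · calc _ ≤ ∏ _i : Fin d, b := Finset.prod_le_prod (fun _ _ => norm_nonneg _) fun i _ => by
          have := h2 (hH.eigenvectorBasis i); rwa [hn, mul_one] at this
      _ = b ^ d := by simp

end charts

/-! ### Uniform covers by chart balls. -/

section cover

variable {d D : ℕ}

/-- On the ball of radius `ρ` about `z`, the map `ψ` is a bi-Lipschitz `C¹` parametrization for
which the measure `μ` is comparable with Lebesgue measure. -/
structure IsChartBall (C ρ : ℝ) (μ : Measure (EuclideanSpace ℝ (Fin D)))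
    (ψ : EuclideanSpace ℝ (Fin d) → EuclideanSpace ℝ (Fin D)) (z : EuclideanSpace ℝ (Fin d)) :
    Prop where
  contDiffOn : ContDiffOn ℝ 1 ψ (Metric.ball z ρ)
  norm_fderiv_le : ∀ w ∈ Metric.ball z ρ, ‖fderiv ℝ ψ w‖ ≤ C
  antilipschitz : ∀ w ∈ Metric.ball z ρ, ∀ w' ∈ Metric.ball z ρ, ‖w - w'‖ ≤ C * ‖ψ w - ψ w'‖
  measure_image_le : ∀ B ⊆ Metric.ball z ρ, MeasurableSet B →
    μ (ψ '' B) ≤ ENNReal.ofReal C * volume B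
  le_measure_image : ∀ B ⊆ Metric.ball z ρ, MeasurableSet B →
    volume B ≤ ENNReal.ofReal C * μ (ψ '' B)

theorem IsChartBall.lipschitz {C ρ : ℝ} {μ : Measure (EuclideanSpace ℝ (Fin D))}
    {ψ : EuclideanSpace ℝ (Fin d) → EuclideanSpace ℝ (Fin D)} {z : EuclideanSpace ℝ (Fin d)}
    (h : IsChartBall C ρ μ ψ z) {w w' : EuclideanSpace ℝ (Fin d)} (hw : w ∈ Metric.ball z ρ)
    (hw' : w' ∈ Metric.ball z ρ) : ‖ψ w - ψ w'‖ ≤ C * ‖w - w'‖ :=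
  (convex_ball z ρ).norm_image_sub_le_of_norm_fderiv_le (𝕜 := ℝ)
    (fun x hx => (h.contDiffOn.contDiffAt (Metric.isOpen_ball.mem_nhds hx)).differentiableAt
      (by norm_num)) h.norm_fderiv_le hw' hw

theorem IsChartBall.injOn {C ρ : ℝ} {μ : Measure (EuclideanSpace ℝ (Fin D))}
    {ψ : EuclideanSpace ℝ (Fin d) → EuclideanSpace ℝ (Fin D)} {z : EuclideanSpace ℝ (Fin d)}
    (h : IsChartBall C ρ μ ψ z) : Set.InjOn ψ (Metric.ball z ρ) := by
  intro w hw w' hw' e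
  have := h.antilipschitz w hw w' hw'
  rw [e, sub_self, norm_zero, mul_zero] at this
  exact sub_eq_zero.1 (norm_le_zero_iff.1 this)

theorem IsChartBall.measurableSet_image {C ρ : ℝ} {μ : Measure (EuclideanSpace ℝ (Fin D))}
    {ψ : EuclideanSpace ℝ (Fin d) → EuclideanSpace ℝ (Fin D)} {z : EuclideanSpace ℝ (Fin d)}
    (h : IsChartBall C ρ μ ψ z) {B : Set (EuclideanSpace ℝ (Fin d))}
    (hB : B ⊆ Metric.ball z ρ) (hBm : MeasurableSet B) : MeasurableSet (ψ '' B) :=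
  hBm.image_of_continuousOn_injOn (h.contDiffOn.continuousOn.mono hB) (h.injOn.mono hB)

section single

variable {α β L : ℝ} {M : Set (EuclideanSpace ℝ (Fin D))}
  {𝒜 : Set (OpenPartialHomeomorph M (EuclideanSpace ℝ (Fin d)))}
  {φ : OpenPartialHomeomorph M (EuclideanSpace ℝ (Fin d))}

theorem measurableSet_symm_image {B : Set (EuclideanSpace ℝ (Fin d))} (hB : B ⊆ φ.target)
    (hBm : MeasurableSet B) : MeasurableSet (φ.symm '' B) := by
  exact hBm.image_of_continuousOn_injOn (φ.continuousOn_symm.mono hB) (φ.symm.injOn.mono hB)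

theorem continuous_density (hA : ∀ x : M, ∃ φ ∈ 𝒜, x ∈ φ.source) {p : M → ℝ}
    (hp : ∀ φ ∈ 𝒜, (fun z => p (φ.symm z)) ∈ holderBall α L φ.target) : Continuous p := by
  rw [continuous_iff_continuousAt]
  intro x
  obtain ⟨φ, hφ, hx⟩ := hA x
  have h1 : ContinuousAt (fun z => p (φ.symm z)) (φ x) :=
    ((hp φ hφ).1.continuousOn).continuousAt (φ.open_target.mem_nhds (φ.map_source hx))
  have h2 : ContinuousAt (fun y => p (φ.symm (φ y))) x :=
    ContinuousAt.comp (f := φ) (g := fun z => p (φ.symm z)) h1 (φ.continuousAt hx)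
  refine h2.congr ?_
  filter_upwards [φ.open_source.mem_nhds hx] with y hy
  rw [φ.left_inv hy]

/-- In a chart the measure has Lebesgue density `p √det(JᵀJ)`, where `p` lies between `1 / L` and
`L` and the root of the determinant between `L^(-d)` and `(D d L)^d`. -/
theorem measure_chart_image_bounds (hβ : 1 < β) (hL : 0 < L) (hreg : IsRegularAtlas β L M 𝒜)
    {vol : Measure M} (hvol : IsVolumeMeasure 𝒜 vol) (hM : IsCompact M) {p : M → ℝ}
    (hp1 : ∀ x, 1 / L ≤ p x)
    (hp : ∀ φ ∈ 𝒜, (fun z => p (φ.symm z)) ∈ holderBall α L φ.target)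
    (hφ : φ ∈ 𝒜) {B : Set (EuclideanSpace ℝ (Fin d))} (hB : B ⊆ φ.target)
    (hBm : MeasurableSet B) :
    (vol.withDensity fun x => ENNReal.ofReal (p x)).map Subtype.val (chartInv φ '' B) ≤
      ENNReal.ofReal (L * (D * (d * L)) ^ d) * volume B ∧
    volume B ≤ ENNReal.ofReal (L * L ^ d) *
      (vol.withDensity fun x => ENNReal.ofReal (p x)).map Subtype.val (chartInv φ '' B) := by
  have hSm := measurableSet_symm_image hB hBm
  have hpc := continuous_density hreg.covers hp
  have himg : chartInv φ '' B = Subtype.val '' (φ.symm '' B) := by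
    rw [Set.image_image]; rfl
  have hS : φ.symm '' B ⊆ φ.source := by
    rintro _ ⟨z, hz, rfl⟩; exact φ.map_target (hB hz)
  have hφS : φ '' (φ.symm '' B) = B := by
    rw [Set.image_image]
    ext z
    constructor
    · rintro ⟨w, hw, rfl⟩; dsimp only; rwa [φ.right_inv (hB hw)]
    · intro hz; exact ⟨z, hz, φ.right_inv (hB hz)⟩
  have e1 : (vol.withDensity fun x => ENNReal.ofReal (p x)).map Subtype.val (chartInv φ '' B) =
      ∫⁻ x in φ.symm '' B, ENNReal.ofReal (p x) ∂vol := by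
    rw [himg, (MeasurableEmbedding.subtype_coe hM.measurableSet).map_apply,
      Set.preimage_image_eq _ Subtype.val_injective, withDensity_apply _ hSm]
  have e2 : vol (φ.symm '' B) = ∫⁻ z in B,
      ENNReal.ofReal √((jacobianMatrix (chartInv φ) z).transpose *
        jacobianMatrix (chartInv φ) z).det := by
    rw [hvol φ hφ _ hSm hS, hφS]
  have hdet : ∀ z ∈ B, (1 / L) ^ d ≤ √((jacobianMatrix (chartInv φ) z).transpose *
        jacobianMatrix (chartInv φ) z).det ∧ √((jacobianMatrix (chartInv φ) z).transpose *
        jacobianMatrix (chartInv φ) z).det ≤ (D * (d * L)) ^ d := fun z hz =>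
    det_jacobianMatrix_bounds (by positivity) (hreg.jacobian φ hφ z (hB hz)) fun v =>
      ((fderiv ℝ (chartInv φ) z).le_opNorm v).trans (mul_le_mul_of_nonneg_right
        (norm_fderiv_le_of_mem_holderBallVec hβ hL.le φ.open_target (hreg.smooth φ hφ) (hB hz))
        (norm_nonneg v))
  have hpL : ∀ x ∈ φ.symm '' B, p x ≤ L := by
    rintro _ ⟨z, hz, rfl⟩
    exact (le_abs_self _).trans (abs_le_of_mem_holderBall hL.le (hp φ hφ) (hB hz))
  rw [e1]
  constructor
  · calc ∫⁻ x in φ.symm '' B, ENNReal.ofReal (p x) ∂vol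
        ≤ ∫⁻ x in φ.symm '' B, ENNReal.ofReal L ∂vol :=
          setLIntegral_mono' hSm fun x hx => ENNReal.ofReal_le_ofReal (hpL x hx)
      _ = ENNReal.ofReal L * vol (φ.symm '' B) := by rw [setLIntegral_const]
      _ ≤ ENNReal.ofReal L * ∫⁻ z in B, ENNReal.ofReal ((D * (d * L)) ^ d) := by
          rw [e2]
          exact mul_le_mul' le_rfl
            (setLIntegral_mono' hBm fun z hz => ENNReal.ofReal_le_ofReal (hdet z hz).2)
      _ = _ := by rw [setLIntegral_const, ENNReal.ofReal_mul hL.le, mul_assoc]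
  · have h1 : ENNReal.ofReal ((1 / L) ^ d) * volume B ≤ vol (φ.symm '' B) := by
      rw [e2, ← setLIntegral_const]
      exact setLIntegral_mono' hBm fun z hz => ENNReal.ofReal_le_ofReal (hdet z hz).1
    have h2 : ENNReal.ofReal (1 / L) * vol (φ.symm '' B) ≤
        ∫⁻ x in φ.symm '' B, ENNReal.ofReal (p x) ∂vol := by
      rw [← setLIntegral_const]
      exact setLIntegral_mono' hSm fun x _ => ENNReal.ofReal_le_ofReal (hp1 x)
    calc volume B = ENNReal.ofReal (L * L ^ d) * (ENNReal.ofReal (1 / L) *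
          (ENNReal.ofReal ((1 / L) ^ d) * volume B)) := by
          rw [← mul_assoc, ← mul_assoc, mul_assoc (ENNReal.ofReal _),
            ← ENNReal.ofReal_mul (by positivity), ← ENNReal.ofReal_mul (by positivity)]
          have : L * L ^ d * (1 / L * (1 / L) ^ d) = 1 := by
            rw [one_div, inv_pow]; field_simp
          rw [this]; simp
      _ ≤ _ := by gcongr; exact (by gcongr : _ ≤ ENNReal.ofReal (1 / L) * vol _).trans h2

end single

/-- Two small parametrized balls that meet: the centre of one lies in the larger version of the
other. -/
theorem chart_ball_subset {M : Set (EuclideanSpace ℝ (Fin D))}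
    {φ φ' : OpenPartialHomeomorph M (EuclideanSpace ℝ (Fin d))}
    {z z' : EuclideanSpace ℝ (Fin d)} {ρ ρ₁ b a : ℝ} (hb : 0 ≤ b) (ha : 0 ≤ a)
    (hρ : 0 < ρ) (hρ₁ : ρ₁ ≤ ρ) (hab : a * (3 * b * ρ₁) ≤ ρ / 2)
    (ht : Metric.closedBall z ρ ⊆ φ.target) (ht' : Metric.closedBall z' ρ ⊆ φ'.target)
    (hl : ∀ w ∈ Metric.closedBall z ρ, ∀ w' ∈ Metric.closedBall z ρ,
      ‖chartInv φ w - chartInv φ w'‖ ≤ b * ‖w - w'‖)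
    (hl' : ∀ w ∈ Metric.closedBall z' ρ, ∀ w' ∈ Metric.closedBall z' ρ,
      ‖chartInv φ' w - chartInv φ' w'‖ ≤ b * ‖w - w'‖)
    (hal : ∀ w ∈ Metric.closedBall z ρ, ∀ w' ∈ Metric.closedBall z ρ,
      ‖w - w'‖ ≤ a * ‖chartInv φ w - chartInv φ w'‖)
    (hne : ((φ.symm '' Metric.ball z ρ₁) ∩ (φ'.symm '' Metric.ball z' ρ₁)).Nonempty) :
    φ'.symm '' Metric.ball z' ρ₁ ⊆ φ.symm '' Metric.ball z ρ := by
  have hb1 : Metric.ball z ρ ⊆ Metric.closedBall z ρ := Metric.ball_subset_closedBall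
  have hb2 : Metric.ball z ρ₁ ⊆ Metric.closedBall z ρ := (Metric.ball_subset_ball hρ₁).trans hb1
  have hb2' : Metric.ball z' ρ₁ ⊆ Metric.closedBall z' ρ :=
    (Metric.ball_subset_ball hρ₁).trans Metric.ball_subset_closedBall
  have hb3 : Metric.closedBall z (ρ / 2) ⊆ Metric.ball z ρ :=
    Metric.closedBall_subset_ball (by linarith)
  have hz : z ∈ Metric.closedBall z ρ := Metric.mem_closedBall_self hρ.le
  set U := φ.symm '' Metric.ball z ρ
  set K := φ.symm '' Metric.closedBall z (ρ / 2) with hK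
  set S := φ'.symm '' Metric.ball z' ρ₁
  have hU : IsOpen U :=
    φ.isOpen_image_symm_of_subset_target Metric.isOpen_ball (hb1.trans ht)
  have hKc : IsClosed K := ((isCompact_closedBall z (ρ / 2)).image_of_continuousOn
    (φ.continuousOn_symm.mono ((hb3.trans hb1).trans ht))).isClosed
  have hS : IsPreconnected S := (convex_ball z' ρ₁).isPreconnected.image _
    (φ'.continuousOn_symm.mono (hb2'.trans ht'))
  have hKU : K ⊆ U := Set.image_mono hb3
  obtain ⟨q, ⟨w₁, hw₁, hq₁⟩, ⟨w₂, hw₂, hq₂⟩⟩ := hne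
  -- A point of `S` is within `2bρ₁` of the common point `q`, which is within `bρ₁` of the centre.
  -- If it also lies in `U`, the lower Lipschitz bound applies and puts it in the half ball.
  have hSU : ∀ s ∈ S, s ∈ U → s ∈ K := by
    rintro s ⟨v, hv, rfl⟩ ⟨w, hw, hws⟩
    refine ⟨w, ?_, hws⟩
    have e1 : chartInv φ w = chartInv φ' v := congrArg Subtype.val hws
    have e2 : chartInv φ w₁ = chartInv φ' w₂ := congrArg Subtype.val (hq₁.trans hq₂.symm)
    have h1 := hl' v (hb2' hv) w₂ (hb2' hw₂)
    have h2 := hl w₁ (hb2 hw₁) z hz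
    have h3 : ‖v - w₂‖ ≤ ρ₁ + ρ₁ := by
      have := dist_triangle_right v w₂ z'
      rw [dist_eq_norm] at this
      linarith [Metric.mem_ball.1 hv, Metric.mem_ball.1 hw₂]
    have h4 : ‖w₁ - z‖ ≤ ρ₁ := (mem_ball_iff_norm.1 hw₁).le
    have h5 : ‖chartInv φ w - chartInv φ z‖ ≤ 3 * b * ρ₁ := by
      have e : chartInv φ w - chartInv φ z =
          (chartInv φ' v - chartInv φ' w₂) + (chartInv φ w₁ - chartInv φ z) := by
        rw [e1, e2]; abel
      rw [e]
      refine (norm_add_le _ _).trans ?_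
      calc _ ≤ b * (ρ₁ + ρ₁) + b * ρ₁ := by
            refine add_le_add (h1.trans ?_) (h2.trans ?_) <;> gcongr
        _ = 3 * b * ρ₁ := by ring
    rw [mem_closedBall_iff_norm]
    refine (hal w (hb1 hw) z hz).trans (le_trans ?_ hab)
    gcongr
  -- Ambient closeness alone would not place `S` in this chart, since another sheet of `M` may pass
  -- nearby. But `S` is connected, meets the open set `U`, and has the same trace on `U` as on the
  -- closed set `K`, so it cannot leave `U`.
  by_contra hcon
  obtain ⟨s, hsS, hsU⟩ := Set.not_subset.1 hcon
  have hqS : q ∈ S := ⟨w₂, hw₂, hq₂⟩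
  have hqU : q ∈ U := ⟨w₁, Metric.ball_subset_ball hρ₁ hw₁, hq₁⟩
  obtain ⟨s', hs'S, hs'U, hs'K⟩ := hS U Kᶜ hU hKc.isOpen_compl
    (fun x _ => by
      by_cases hx : x ∈ K
      · exact Or.inl (hKU hx)
      · exact Or.inr hx) ⟨q, hqS, hqU⟩ ⟨s, hsS, fun h => hsU (hKU h)⟩
  exact hs'K (hSU s' hs'S hs'U)

/-- A maximal family of pairwise disjoint sets of measure bounded below. -/
theorem exists_maximal_disjoint_family {Ω ι : Type*} [MeasurableSpace Ω] (ν : Measure Ω)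
    [IsProbabilityMeasure ν] (U : ι → Set Ω) (hU : ∀ i, MeasurableSet (U i)) {K : ℕ}
    (hK : ∀ i, 1 ≤ (K : ℝ≥0∞) * ν (U i)) (hne : ∀ i, (U i).Nonempty) :
    ∃ T : Finset ι, T.card ≤ K ∧ ∀ i, ∃ j ∈ T, (U j ∩ U i).Nonempty := by
  classical
  have hbound : ∀ T : Finset ι, (T : Set ι).PairwiseDisjoint U → T.card ≤ K := by
    intro T hT
    have h1 : ∑ i ∈ T, ν (U i) ≤ 1 := by
      rw [← measure_biUnion_finset hT fun i _ => hU i]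
      exact prob_le_one
    have h2 : (T.card : ℝ≥0∞) ≤ K * ∑ i ∈ T, ν (U i) := by
      rw [Finset.mul_sum]
      refine le_trans (le_of_eq ?_) (Finset.sum_le_sum fun i _ => hK i)
      simp
    have h3 : (T.card : ℝ≥0∞) ≤ K := h2.trans (mul_le_of_le_one_right' h1)
    exact_mod_cast h3
  -- Disjoint subfamilies have at most `K` members, so one of largest cardinality exists; a set that
  -- misses all its members could be added to it.
  set P : ℕ → Prop := fun k => ∃ T : Finset ι, T.card = k ∧ (T : Set ι).PairwiseDisjoint U
  have hP0 : P 0 := ⟨∅, rfl, by simp⟩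
  obtain ⟨T, hTc, hTd⟩ := Nat.findGreatest_spec (P := P) (Nat.zero_le K) hP0
  refine ⟨T, hbound T hTd, fun i => ?_⟩
  by_contra hcon
  push Not at hcon
  have hi : i ∉ T := fun hi => by
    have := hcon i hi
    rw [Set.inter_self] at this
    exact (hne i).ne_empty this
  have hd : ((insert i T : Finset ι) : Set ι).PairwiseDisjoint U := by
    rw [Finset.coe_insert]
    refine hTd.insert fun j hj _ => ?_
    rw [Set.disjoint_iff_inter_eq_empty, Set.inter_comm]
    exact hcon j hj
  have h1 : P (T.card + 1) := ⟨insert i T, Finset.card_insert_of_notMem hi, hd⟩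
  have h2 : T.card + 1 ≤ K := by
    have := hbound _ hd
    rwa [Finset.card_insert_of_notMem hi] at this
  have := Nat.le_findGreatest h2 h1
  omega

/-- Measures of the class are uniformly covered by finitely many chart balls of fixed size. -/
theorem exists_chart_cover (d D : ℕ) {β L : ℝ} (hβ : 1 < β) (hL : 0 < L) :
    ∃ (C ρ : ℝ) (K : ℕ), 0 < C ∧ 0 < ρ ∧ ∀ α : ℝ, ∀ μ ∈ PStar d D α β L,
      ∃ (N : ℕ) (ψ : Fin N → EuclideanSpace ℝ (Fin d) → EuclideanSpace ℝ (Fin D))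
        (z : Fin N → EuclideanSpace ℝ (Fin d)), N ≤ K ∧
        (∀ i, IsChartBall C ρ μ (ψ i) (z i)) ∧
        μ (⋃ i, ψ i '' Metric.ball (z i) ρ)ᶜ = 0 := by
  obtain ⟨ρ, hρ, hρL, hanti⟩ := exists_radius_antilipschitz d D hβ hL (r₀ := 1 / L) (by positivity)
  set b : ℝ := D * (d * L) with hb
  have hb0 : 0 ≤ b := by positivity
  -- Small enough for the hypothesis `2L · 3bρ₁ ≤ ρ / 2` of `chart_ball_subset`; the summand `1`
  -- guards against `b = 0`.
  set ρ₁ := min ρ (ρ / (12 * L * (b + 1))) with hρ₁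
  have hρ₁0 : 0 < ρ₁ := lt_min hρ (by positivity)
  have hab : 2 * L * (3 * b * ρ₁) ≤ ρ / 2 := by
    have h1 : ρ₁ ≤ ρ / (12 * L * (b + 1)) := min_le_right _ _
    rw [le_div_iff₀ (by positivity)] at h1
    have : 0 ≤ ρ₁ * (12 * L) := by positivity
    nlinarith
  set C := 2 * L + b + L * b ^ d + L * L ^ d with hC
  have hC0 : 0 < C := by positivity
  set v := (volume (Metric.ball (0 : EuclideanSpace ℝ (Fin d)) ρ₁)).toReal with hv
  have hv0 : 0 < v := ENNReal.toReal_pos (Metric.measure_ball_pos _ _ hρ₁0).ne'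
    measure_ball_lt_top.ne
  -- Each small chart ball has mass at least `v / C`, so at most `C / v` of them are disjoint. The
  -- bound depends on `d`, `D`, `β`, `L` only.
  set K := ⌈C / v⌉₊ with hK
  refine ⟨C, ρ, K, hC0, hρ, ?_⟩
  rintro α μ ⟨hμp, M, 𝒜, vol, p, hM, hreg, hvol, hμ, hp1, hp⟩
  choose φ hφ hsrc htgt using hreg.balls
  have htgt' : ∀ x, Metric.closedBall (φ x x) ρ ⊆ (φ x).target := fun x =>
    (Metric.closedBall_subset_closedBall hρL).trans (htgt x)
  have hmem : ∀ x, x ∈ (φ x).source := fun x =>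
    hsrc x (Metric.mem_closedBall_self (by positivity))
  have hanti' : ∀ x, ∀ w ∈ Metric.closedBall (φ x x) ρ, ∀ w' ∈ Metric.closedBall (φ x x) ρ,
      ‖w - w'‖ ≤ 2 * L * ‖chartInv (φ x) w - chartInv (φ x) w'‖ := fun x =>
    hanti (φ x).target (chartInv (φ x)) (φ x).open_target (hreg.smooth _ (hφ x)) _ (htgt' x)
      (hreg.jacobian _ (hφ x) _ (htgt' x (Metric.mem_closedBall_self hρ.le)))
  have hlip : ∀ x, ∀ w ∈ Metric.closedBall (φ x x) ρ, ∀ w' ∈ Metric.closedBall (φ x x) ρ,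
      ‖chartInv (φ x) w - chartInv (φ x) w'‖ ≤ b * ‖w - w'‖ := fun x w hw w' hw' =>
    (convex_closedBall _ _).norm_image_sub_le_of_norm_fderiv_le (𝕜 := ℝ)
      (fun y hy => differentiableAt_of_mem_holderBallVec hβ (φ x).open_target
        (hreg.smooth _ (hφ x)) (htgt' x hy))
      (fun y hy => norm_fderiv_le_of_mem_holderBallVec hβ hL.le (φ x).open_target
        (hreg.smooth _ (hφ x)) (htgt' x hy)) hw' hw
  have hbt : ∀ x, Metric.ball (φ x x) ρ ⊆ (φ x).target := fun x =>
    Metric.ball_subset_closedBall.trans (htgt' x)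
  have hbt₁ : ∀ x, Metric.ball (φ x x) ρ₁ ⊆ (φ x).target := fun x =>
    (Metric.ball_subset_ball (min_le_left _ _)).trans (hbt x)
  have hpos1 : 0 ≤ L * b ^ d := by positivity
  have hpos2 : 0 ≤ L * L ^ d := by positivity
  have hchart : ∀ x, IsChartBall C ρ μ (chartInv (φ x)) (φ x x) := by
    intro x
    have hbounds := fun (B : Set (EuclideanSpace ℝ (Fin d))) (hB : B ⊆ Metric.ball (φ x x) ρ)
      (hBm : MeasurableSet B) => measure_chart_image_bounds hβ hL hreg hvol hM hp1 hp (hφ x)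
        (hB.trans (hbt x)) hBm
    rw [← hμ] at hbounds
    refine ⟨?_, ?_, ?_, ?_, ?_⟩
    · exact ((contDiffOn_of_mem_holderBallVec (hreg.smooth _ (hφ x))).of_le
        (by exact_mod_cast one_le_floor hβ)).mono (hbt x)
    · intro w hw
      refine (norm_fderiv_le_of_mem_holderBallVec hβ hL.le (φ x).open_target
        (hreg.smooth _ (hφ x)) (hbt x hw)).trans ?_
      rw [hC]; linarith
    · intro w hw w' hw'
      refine (hanti' x w (Metric.ball_subset_closedBall hw) w'
        (Metric.ball_subset_closedBall hw')).trans ?_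
      gcongr
      rw [hC]; linarith
    · intro B hB hBm
      refine ((hbounds B hB hBm).1).trans ?_
      gcongr
      rw [hC]; linarith
    · intro B hB hBm
      refine ((hbounds B hB hBm).2).trans ?_
      gcongr
      rw [hC]; linarith
  set ν := (vol.withDensity fun x => ENNReal.ofReal (p x)) with hν
  have hνp : IsProbabilityMeasure ν := by
    constructor
    have := hμp.measure_univ
    rwa [hμ, Measure.map_apply measurable_subtype_coe MeasurableSet.univ, Set.preimage_univ]
      at this
  have hemb := MeasurableEmbedding.subtype_coe hM.measurableSet
  have hval : ∀ S : Set M, μ (Subtype.val '' S) = ν S := by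
    intro S
    rw [hμ, hemb.map_apply, Set.preimage_image_eq _ Subtype.val_injective]
  -- A Vitali type argument: take a maximal disjoint family of small balls. The small ball of any
  -- `x` meets one of them, hence lies in the corresponding large ball, and so does `x`.
  obtain ⟨T, hTK, hT⟩ := exists_maximal_disjoint_family ν
    (fun x : M => (φ x).symm '' Metric.ball (φ x x) ρ₁)
    (fun x => measurableSet_symm_image (hbt₁ x) measurableSet_ball) (K := K)
    (fun x => by
      have h1 := (hchart x).le_measure_image (Metric.ball (φ x x) ρ₁)
        (Metric.ball_subset_ball (min_le_left _ _)) measurableSet_ball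
      have h2 : chartInv (φ x) '' Metric.ball (φ x x) ρ₁ =
          Subtype.val '' ((φ x).symm '' Metric.ball (φ x x) ρ₁) := by
        rw [Set.image_image]; rfl
      rw [h2, hval, Measure.addHaar_ball_center] at h1
      have hvv : volume (Metric.ball (0 : EuclideanSpace ℝ (Fin d)) ρ₁) = ENNReal.ofReal v := by
        rw [hv, ENNReal.ofReal_toReal measure_ball_lt_top.ne]
      rw [hvv] at h1
      have h3 : C ≤ K * v := by
        rw [← div_le_iff₀ hv0]; exact Nat.le_ceil _
      have h4 : ENNReal.ofReal v * 1 ≤ ENNReal.ofReal v *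
          (K * ν ((φ x).symm '' Metric.ball (φ x x) ρ₁)) := by
        rw [mul_one]
        refine h1.trans ?_
        rw [← mul_assoc]
        gcongr
        rw [← ENNReal.ofReal_natCast, ← ENNReal.ofReal_mul hv0.le]
        apply ENNReal.ofReal_le_ofReal
        linarith
      exact (ENNReal.mul_le_mul_iff_right (by simpa using hv0) ENNReal.ofReal_ne_top).1 h4)
    (fun x => ⟨_, ⟨φ x x, Metric.mem_ball_self hρ₁0, rfl⟩⟩)
  refine ⟨T.card, fun i => chartInv (φ (T.equivFin.symm i)),
    fun i => φ (T.equivFin.symm i) (T.equivFin.symm i), hTK, fun i => hchart _, ?_⟩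
  have hcov : ∀ x : M, (x : EuclideanSpace ℝ (Fin D)) ∈ ⋃ i : Fin T.card,
      chartInv (φ (T.equivFin.symm i)) ''
        Metric.ball (φ (T.equivFin.symm i) (T.equivFin.symm i)) ρ := by
    intro x
    obtain ⟨y, hy, hne⟩ := hT x
    have hsub := chart_ball_subset (φ := φ y) (φ' := φ x) hb0 (by positivity) hρ (min_le_left _ _)
      hab (htgt' y) (htgt' x) (hlip y) (hlip x) (hanti' y) hne
    have hx : x ∈ (φ x).symm '' Metric.ball (φ x x) ρ₁ :=
      ⟨φ x x, Metric.mem_ball_self hρ₁0, (φ x).left_inv (hmem x)⟩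
    obtain ⟨w, hw, hwx⟩ := hsub hx
    refine Set.mem_iUnion.2 ⟨T.equivFin ⟨y, hy⟩, w, ?_, ?_⟩
    · simpa using hw
    · simp only [Equiv.symm_apply_apply]
      exact congrArg Subtype.val hwx
  rw [hμ, hemb.map_apply]
  convert measure_empty (μ := ν)
  rw [Set.eq_empty_iff_forall_notMem]
  intro x hx
  exact hx (hcov x)

end cover

/-! ### Sums of separated bumps in the Hölder ball. -/

section bumps

variable {D : ℕ}

/-- A fixed smooth bump function supported in the ball of radius `3 / 4`. -/
def unitBump (D : ℕ) : ContDiffBump (0 : EuclideanSpace ℝ (Fin D)) := ⟨1 / 2, 3 / 4, by norm_num, by norm_num⟩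

/-- The sum of copies of the unit bump with centres `y i` and scale `h`. -/
def bumpSum {ι : Type*} (T : Finset ι) (h : ℝ) (y : ι → EuclideanSpace ℝ (Fin D))
    (x : EuclideanSpace ℝ (Fin D)) : ℝ :=
  ∑ i ∈ T, unitBump D (h⁻¹ • (x - y i))

theorem unitBump_nonneg (x : EuclideanSpace ℝ (Fin D)) : 0 ≤ unitBump D x := (unitBump D).nonneg

theorem unitBump_eq_one {x : EuclideanSpace ℝ (Fin D)} (hx : ‖x‖ ≤ 1 / 2) : unitBump D x = 1 :=
  (unitBump D).one_of_mem_closedBall (mem_closedBall_zero_iff.2 hx)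

theorem unitBump_eq_zero {x : EuclideanSpace ℝ (Fin D)} (hx : 1 ≤ ‖x‖) : unitBump D x = 0 :=
  (unitBump D).zero_of_le_dist (by
    rw [dist_zero_right]
    exact le_trans (by norm_num [unitBump]) hx)

theorem contDiff_unitBump {n : ℕ} : ContDiff ℝ n (unitBump D) := (unitBump D).contDiff

theorem iteratedFDeriv_unitBump_eq_zero {k : ℕ} {x : EuclideanSpace ℝ (Fin D)} (hx : 1 ≤ ‖x‖) :
    iteratedFDeriv ℝ k (unitBump D) x = 0 := by
  by_contra hne
  have h1 := support_iteratedFDeriv_subset (𝕜 := ℝ) (f := unitBump D) k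
    (Function.mem_support.2 hne)
  rw [(unitBump D).tsupport_eq, mem_closedBall_zero_iff] at h1
  have : (unitBump D).rOut = 3 / 4 := rfl
  rw [this] at h1
  linarith

theorem exists_bound_iteratedFDeriv_unitBump (D m : ℕ) : ∃ B : ℝ, 0 < B ∧ ∀ k ≤ m,
    ∀ x : EuclideanSpace ℝ (Fin D), ‖iteratedFDeriv ℝ k (unitBump D) x‖ ≤ B := by
  have : ∀ k, ∃ B : ℝ, 0 < B ∧
      ∀ x : EuclideanSpace ℝ (Fin D), ‖iteratedFDeriv ℝ k (unitBump D) x‖ ≤ B := by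
    intro k
    obtain ⟨B, hB⟩ := ((unitBump D).hasCompactSupport.iteratedFDeriv
      k).exists_bound_of_continuous (contDiff_unitBump (n := k)).continuous_iteratedFDeriv'
    exact ⟨max B 1, by positivity, fun x => (hB x).trans (le_max_left _ _)⟩
  choose B hB0 hB using this
  refine ⟨∑ k ∈ Finset.range (m + 1), B k, Finset.sum_pos (fun k _ => hB0 k) (by simp),
    fun k hk x => (hB k x).trans ?_⟩
  exact Finset.single_le_sum (f := B) (fun k _ => (hB0 k).le)
    (Finset.mem_range.2 (Nat.lt_succ_of_le hk))

theorem iteratedFDeriv_comp_smul_sub {k : ℕ} {g : EuclideanSpace ℝ (Fin D) → ℝ}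
    (hg : ContDiff ℝ k g) (c : ℝ) (y x : EuclideanSpace ℝ (Fin D)) :
    iteratedFDeriv ℝ k (fun x => g (c • (x - y))) x =
      (iteratedFDeriv ℝ k g (c • (x - y))).compContinuousLinearMap
        fun _ => c • ContinuousLinearMap.id ℝ (EuclideanSpace ℝ (Fin D)) := by
  have h1 := iteratedFDeriv_comp_sub' (𝕜 := ℝ) (f := fun x => g (c • x)) k y
  have h1' : iteratedFDeriv ℝ k (fun x => g (c • (x - y))) x =
      iteratedFDeriv ℝ k (fun x => g (c • x)) (x - y) := congrFun h1 x
  rw [h1']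
  exact (c • ContinuousLinearMap.id ℝ (EuclideanSpace ℝ (Fin D))).iteratedFDeriv_comp_right hg
    (x - y) le_rfl

theorem norm_compContinuousLinearMap_smul_id_le {k : ℕ} (c : ℝ) (hc : 0 ≤ c)
    (M : ContinuousMultilinearMap ℝ (fun _ : Fin k => EuclideanSpace ℝ (Fin D)) ℝ) :
    ‖M.compContinuousLinearMap
        fun _ => c • ContinuousLinearMap.id ℝ (EuclideanSpace ℝ (Fin D))‖ ≤ c ^ k * ‖M‖ := by
  refine (ContinuousMultilinearMap.norm_compContinuousLinearMap_le _ _).trans ?_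
  rw [Finset.prod_const, Finset.card_univ, Fintype.card_fin, mul_comm]
  gcongr
  rw [norm_smul, Real.norm_eq_abs, abs_of_nonneg hc]
  exact mul_le_of_le_one_right hc ContinuousLinearMap.norm_id_le

theorem norm_sum_le_card_mul {ι E : Type*} [NormedAddCommGroup E] (T : Finset ι) (v : ι → E)
    {A : ℝ} {m : ℕ} (hA : ∀ i ∈ T, ‖v i‖ ≤ A) (hA0 : 0 ≤ A) (S : Finset ι) (hS : S.card ≤ m)
    (hv : ∀ i ∈ T, v i ≠ 0 → i ∈ S) : ‖∑ i ∈ T, v i‖ ≤ m * A := by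
  classical
  rw [← Finset.sum_filter_ne_zero]
  refine (norm_sum_le _ _).trans ((Finset.sum_le_card_nsmul _ _ A fun i hi =>
    hA i (Finset.mem_filter.1 hi).1).trans ?_)
  rw [nsmul_eq_mul]
  gcongr
  refine le_trans (Finset.card_le_card fun i hi => ?_) hS
  rw [Finset.mem_filter] at hi
  exact hv i hi.1 hi.2

/-- Rescaled sums of separated bumps lie in the unit Hölder ball. -/
theorem exists_bumpSum_mem_holderBall (D : ℕ) {γ : ℝ} (hγ : 0 < γ) :
    ∃ ε : ℝ, 0 < ε ∧ ∀ (ι : Type) (T : Finset ι) (h : ℝ) (y : ι → EuclideanSpace ℝ (Fin D)),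
      0 < h → h ≤ 1 → (∀ i j, i ≠ j → 2 * h ≤ ‖y i - y j‖) →
      (fun x => ε * h ^ γ * bumpSum T h y x) ∈ holderBall γ 1 Set.univ := by
  set m := ⌊γ⌋₊ with hm
  obtain ⟨B, hB0, hB⟩ := exists_bound_iteratedFDeriv_unitBump D (m + 1)
  -- A factor `2` for the Hölder increment of one bump, and another because two different bumps can
  -- be active at the two points compared.
  set A : ℝ := 4 * B with hA
  set ε : ℝ := 1 / ((holderCount D m + 1) * A) with hε
  have hε0 : 0 < ε := by positivity
  refine ⟨ε, hε0, fun ι T h y hh hh1 hy => ?_⟩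
  classical
  set t : ι → EuclideanSpace ℝ (Fin D) → ℝ := fun i x => unitBump D (h⁻¹ • (x - y i)) with ht
  have hmγ : (m : ℝ) ≤ γ := Nat.floor_le hγ.le
  have hγm : γ < m + 1 := Nat.lt_floor_add_one γ
  have htc : ∀ i (n : ℕ), ContDiff ℝ n (t i) := fun i n =>
    contDiff_unitBump.comp (g := unitBump D) (f := fun x => h⁻¹ • (x - y i)) (by fun_prop)
  have hti : ∀ i k x, iteratedFDeriv ℝ k (t i) x =
      (iteratedFDeriv ℝ k (unitBump D) (h⁻¹ • (x - y i))).compContinuousLinearMap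
        fun _ => h⁻¹ • ContinuousLinearMap.id ℝ (EuclideanSpace ℝ (Fin D)) := fun i k x =>
    iteratedFDeriv_comp_smul_sub contDiff_unitBump _ _ _
  have hvan : ∀ i k x, iteratedFDeriv ℝ k (t i) x ≠ 0 → ‖x - y i‖ < h := by
    intro i k x hne
    by_contra hcon
    rw [not_lt] at hcon
    apply hne
    rw [hti, iteratedFDeriv_unitBump_eq_zero]
    · ext; rfl
    · rw [norm_smul, norm_inv, Real.norm_eq_abs, abs_of_pos hh, inv_mul_eq_div, le_div_iff₀ hh]
      linarith
  -- The centres are `2h` apart and each bump lives within `h` of its centre, so at most one is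
  -- active at a point. This is why the norm does not grow with the number of bumps.
  have hcard : ∀ k x, (T.filter fun i => iteratedFDeriv ℝ k (t i) x ≠ 0).card ≤ 1 := by
    intro k x
    rw [Finset.card_le_one]
    intro i hi j hj
    by_contra hij
    have h1 := hvan i k x (Finset.mem_filter.1 hi).2
    have h2 := hvan j k x (Finset.mem_filter.1 hj).2
    have h3 := hy i j hij
    have h4 : ‖y i - y j‖ ≤ ‖x - y i‖ + ‖x - y j‖ := by
      rw [show y i - y j = (x - y j) - (x - y i) by abel, add_comm]
      exact norm_sub_le _ _
    linarith
  have hbd : ∀ i, ∀ k ≤ m, ∀ x, ‖iteratedFDeriv ℝ k (t i) x‖ ≤ (h⁻¹) ^ k * B := by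
    intro i k hk x
    rw [hti]
    refine (norm_compContinuousLinearMap_smul_id_le _ (by positivity) _).trans ?_
    gcongr
    exact hB k (by omega) _
  -- At unit scale, use the Lipschitz bound `B` for close points and the trivial bound `2B` for
  -- distant ones. Both are at most `2B` times the distance to the power `γ - m`, as `0 ≤ γ - m ≤
  -- 1`.
  have hdiff : ∀ i x x', ‖iteratedFDeriv ℝ m (t i) x - iteratedFDeriv ℝ m (t i) x'‖ ≤
      (h⁻¹) ^ m * (2 * B * (‖x - x'‖ / h) ^ (γ - m)) := by
    intro i x x'
    rw [hti, hti]
    have e : ∀ M M' : ContinuousMultilinearMap ℝ (fun _ : Fin m => EuclideanSpace ℝ (Fin D)) ℝ,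
        (M.compContinuousLinearMap
          fun _ => h⁻¹ • ContinuousLinearMap.id ℝ (EuclideanSpace ℝ (Fin D))) -
        (M'.compContinuousLinearMap
          fun _ => h⁻¹ • ContinuousLinearMap.id ℝ (EuclideanSpace ℝ (Fin D))) =
        ((M - M').compContinuousLinearMap
          fun _ => h⁻¹ • ContinuousLinearMap.id ℝ (EuclideanSpace ℝ (Fin D))) := by
      intro M M'; ext; rfl
    rw [e]
    refine (norm_compContinuousLinearMap_smul_id_le _ (by positivity) _).trans ?_
    gcongr
    set u := h⁻¹ • (x - y i)
    set u' := h⁻¹ • (x' - y i)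
    have huu : ‖u - u'‖ = ‖x - x'‖ / h := by
      have : u - u' = h⁻¹ • (x - x') := by
        simp only [u, u', ← smul_sub]; congr 1; abel
      rw [this, norm_smul, norm_inv, Real.norm_eq_abs, abs_of_pos hh, inv_mul_eq_div]
    rw [← huu]
    rcases le_total ‖u - u'‖ 1 with h1 | h1
    · have h2 : ‖iteratedFDeriv ℝ m (unitBump D) u - iteratedFDeriv ℝ m (unitBump D) u'‖ ≤
          B * ‖u - u'‖ := by
        refine (convex_univ).norm_image_sub_le_of_norm_fderiv_le (𝕜 := ℝ)
          (fun w _ => ?_) (fun w _ => ?_) (Set.mem_univ u') (Set.mem_univ u)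
        · exact (contDiff_unitBump (n := m + 1)).contDiffAt.differentiableAt_iteratedFDeriv
            (by exact_mod_cast Nat.lt_succ_self m)
        · rw [norm_fderiv_iteratedFDeriv]; exact hB _ le_rfl _
      have h3 : ‖u - u'‖ ≤ ‖u - u'‖ ^ (γ - m) := by
        rcases (norm_nonneg (u - u')).eq_or_lt with h0 | h0
        · rw [← h0]; exact Real.rpow_nonneg le_rfl _
        · calc ‖u - u'‖ = ‖u - u'‖ ^ (1 : ℝ) := (Real.rpow_one _).symm
            _ ≤ _ := Real.rpow_le_rpow_of_exponent_ge h0 h1 (by linarith)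
      have h4 : 0 ≤ ‖u - u'‖ ^ (γ - m) := Real.rpow_nonneg (norm_nonneg _) _
      nlinarith
    · have h3 : 1 ≤ ‖u - u'‖ ^ (γ - m) := Real.one_le_rpow h1 (by linarith)
      have h2 := norm_sub_le (iteratedFDeriv ℝ m (unitBump D) u)
        (iteratedFDeriv ℝ m (unitBump D) u')
      have h4 := hB m (by omega) u
      have h5 := hB m (by omega) u'
      nlinarith
  have hFe : (fun x => ε * h ^ γ * bumpSum T h y x) = fun x => (ε * h ^ γ) • ∑ i ∈ T, t i x := by
    ext x; simp [bumpSum, t]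
  have hFd : ∀ k x, iteratedFDeriv ℝ k (fun x => ε * h ^ γ * bumpSum T h y x) x =
      (ε * h ^ γ) • ∑ i ∈ T, iteratedFDeriv ℝ k (t i) x := by
    intro k x
    rw [hFe]
    have h1 := iteratedFDeriv_const_smul_apply (𝕜 := ℝ) (i := k) (x := x) (a := ε * h ^ γ)
      (f := fun x => ∑ i ∈ T, t i x) ((ContDiff.sum fun i _ => htc i k).contDiffAt)
    have h2 := iteratedFDeriv_sum (𝕜 := ℝ) (i := k) (f := t) (u := T) (fun i _ => htc i k)
    have h2' : iteratedFDeriv ℝ k (fun x => ∑ i ∈ T, t i x) x =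
        ∑ i ∈ T, iteratedFDeriv ℝ k (t i) x := by
      have := congrFun h2 x
      simpa using this
    rw [← h2', ← h1]
    rfl
  have hc0 : 0 ≤ ε * h ^ γ := by positivity
  have hmem := mem_holderBall_of_norm_iteratedFDeriv_le (α := γ) (Ω := Set.univ) (B := ε * A)
    (f := fun x => ε * h ^ γ * bumpSum T h y x) isOpen_univ
    (by
      rw [hFe]
      exact (ContDiff.const_smul (ε * h ^ γ) (ContDiff.sum fun i _ => htc i _)).contDiffOn)
    (by
      intro k hk x _
      rw [hFd, norm_smul, Real.norm_eq_abs, abs_of_nonneg hc0]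
      have h1 := norm_sum_le_card_mul T (fun i => iteratedFDeriv ℝ k (t i) x)
        (fun i _ => hbd i k hk x) (by positivity) _ (hcard k x)
        (fun i hi hne => Finset.mem_filter.2 ⟨hi, hne⟩)
      calc ε * h ^ γ * ‖∑ i ∈ T, iteratedFDeriv ℝ k (t i) x‖
          ≤ ε * h ^ γ * ((1 : ℕ) * ((h⁻¹) ^ k * B)) := by gcongr
        _ = ε * (h ^ γ * (h⁻¹) ^ k) * B := by push_cast; ring
        _ ≤ ε * 1 * B := by
          gcongr
          rw [inv_pow, ← Real.rpow_natCast, ← Real.rpow_neg hh.le, ← Real.rpow_add hh]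
          apply Real.rpow_le_one hh.le hh1
          have : (k : ℝ) ≤ m := by exact_mod_cast hk
          linarith
        _ ≤ ε * A := by rw [hA]; nlinarith)
    (by
      intro x _ x' _ _
      rw [hFd, hFd, ← smul_sub, norm_smul, Real.norm_eq_abs, abs_of_nonneg hc0,
        ← Finset.sum_sub_distrib]
      have h1 := norm_sum_le_card_mul (m := 2) T
        (fun i => iteratedFDeriv ℝ m (t i) x - iteratedFDeriv ℝ m (t i) x')
        (fun i _ => hdiff i x x') (by positivity)
        ((T.filter fun i => iteratedFDeriv ℝ m (t i) x ≠ 0) ∪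
          (T.filter fun i => iteratedFDeriv ℝ m (t i) x' ≠ 0))
        ((Finset.card_union_le _ _).trans (by
          have := hcard m x
          have := hcard m x'
          omega))
        (fun i hi hne => by
          by_contra hcon
          rw [Finset.mem_union, Finset.mem_filter, Finset.mem_filter] at hcon
          push Not at hcon
          apply hne
          rw [hcon.1 hi, hcon.2 hi, sub_zero])
      calc _ ≤ ε * h ^ γ * ((2 : ℕ) * ((h⁻¹) ^ m * (2 * B * (‖x - x'‖ / h) ^ (γ - m)))) := by
            gcongr
        _ = ε * A * (h ^ γ * (h⁻¹) ^ m * (‖x - x'‖ / h) ^ (γ - m)) := by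
            rw [hA]; push_cast; ring
        _ = ε * A * ‖x - x'‖ ^ (γ - m) := by
            congr 1
            rw [Real.div_rpow (norm_nonneg _) hh.le, inv_pow, ← Real.rpow_natCast,
              Real.rpow_sub hh]
            have : (0 : ℝ) < h ^ γ := Real.rpow_pos_of_pos hh _
            have : (0 : ℝ) < h ^ (m : ℝ) := Real.rpow_pos_of_pos hh _
            field_simp)
  refine holderBall_mono ?_ hmem
  have e : ε * A * (holderCount D m + 1) = 1 := by
    have : A ≠ 0 := by positivity
    rw [hε]; field_simp
  have : 0 < ε * A := by positivity
  nlinarith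

theorem bumpSum_nonneg {ι : Type*} (T : Finset ι) (h : ℝ) (y : ι → EuclideanSpace ℝ (Fin D))
    (x : EuclideanSpace ℝ (Fin D)) : 0 ≤ bumpSum T h y x :=
  Finset.sum_nonneg fun _ _ => unitBump_nonneg _

theorem one_le_bumpSum {ι : Type*} {T : Finset ι} {h : ℝ} (hh : 0 < h)
    {y : ι → EuclideanSpace ℝ (Fin D)} {x : EuclideanSpace ℝ (Fin D)} {i : ι} (hi : i ∈ T)
    (hx : ‖x - y i‖ ≤ h / 2) : 1 ≤ bumpSum T h y x := by
  have h1 : unitBump D (h⁻¹ • (x - y i)) = 1 := by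
    apply unitBump_eq_one
    rw [norm_smul, norm_inv, Real.norm_eq_abs, abs_of_pos hh, inv_mul_eq_div, div_le_iff₀ hh]
    linarith
  rw [← h1]
  exact Finset.single_le_sum (f := fun i => unitBump D (h⁻¹ • (x - y i)))
    (fun _ _ => unitBump_nonneg _) hi

theorem bumpSum_eq_zero {ι : Type*} {T : Finset ι} {h : ℝ} (hh : 0 < h)
    {y : ι → EuclideanSpace ℝ (Fin D)} {x : EuclideanSpace ℝ (Fin D)}
    (hx : ∀ i ∈ T, h ≤ ‖x - y i‖) : bumpSum T h y x = 0 := by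
  refine Finset.sum_eq_zero fun i hi => unitBump_eq_zero ?_
  rw [norm_smul, norm_inv, Real.norm_eq_abs, abs_of_pos hh, inv_mul_eq_div, le_div_iff₀ hh]
  linarith [hx i hi]

end bumps

/-! ### Lower bounds for measures with a chart ball. -/

section lowerBound

variable {d D : ℕ} {C ρ : ℝ} {μ : Measure (EuclideanSpace ℝ (Fin D))}
  {ψ : EuclideanSpace ℝ (Fin d) → EuclideanSpace ℝ (Fin D)} {z : EuclideanSpace ℝ (Fin d)}

/-- A chart ball contains `N` separated points, with neighbourhoods of measure of order `1 / N`. -/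
theorem IsChartBall.exists_separated_points (h : IsChartBall C ρ μ ψ z) (hd : 1 ≤ d) (hC : 0 < C)
    (hρ : 0 < ρ) : ∃ c c' : ℝ, 0 < c ∧ c ≤ 1 ∧ 0 < c' ∧ ∀ N : ℕ, 1 ≤ N →
      ∃ y : Fin N → EuclideanSpace ℝ (Fin D),
        (∀ i j, i ≠ j → 2 * (c * (N : ℝ) ^ (-(1 / d : ℝ))) ≤ ‖y i - y j‖) ∧
        ∀ i, ENNReal.ofReal (c' / N) ≤
          μ (Metric.closedBall (y i) (c * (N : ℝ) ^ (-(1 / d : ℝ)) / 2)) := by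
  have hd0 : (0 : ℝ) < d := by exact_mod_cast hd
  -- A grid of side `s` in each coordinate direction stays within `d s = ρ / 2` of the centre.
  set s := ρ / (2 * d) with hs
  have hs0 : 0 < s := by positivity
  -- The bound `s / (4C)` turns the grid spacing `s / k ≥ s / (2q)` into separation `2c / q` of the
  -- images; the bound `ρC` keeps the balls of radius `c / (2Cq)` about grid points inside the chart
  -- ball.
  set c := min 1 (min (s / (4 * C)) (ρ * C)) with hc
  have hc0 : 0 < c := by positivity
  have hc1 : c ≤ s / (4 * C) := (min_le_right _ _).trans (min_le_left _ _)
  have hc2 : c ≤ ρ * C := (min_le_right _ _).trans (min_le_right _ _)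
  set v := (volume (Metric.ball (0 : EuclideanSpace ℝ (Fin d)) 1)).toReal with hv
  have hv0 : 0 < v := ENNReal.toReal_pos (Metric.measure_ball_pos _ _ one_pos).ne'
    measure_ball_lt_top.ne
  refine ⟨c, (c / (2 * C)) ^ d * v / C, hc0, min_le_left _ _, by positivity, fun N hN => ?_⟩
  have hN0 : (0 : ℝ) < N := by exact_mod_cast hN
  have hN1 : (1 : ℝ) ≤ N := by exact_mod_cast hN
  set q : ℝ := (N : ℝ) ^ (1 / d : ℝ) with hq
  have hq1 : 1 ≤ q := Real.one_le_rpow hN1 (by positivity)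
  have hqd : q ^ d = N := by
    rw [hq, ← Real.rpow_natCast, ← Real.rpow_mul hN0.le, one_div_mul_cancel hd0.ne', Real.rpow_one]
  have hqn : (N : ℝ) ^ (-(1 / d : ℝ)) = q⁻¹ := Real.rpow_neg hN0.le _
  rw [hqn]
  set k := ⌈q⌉₊ with hk
  have hkq : q ≤ k := Nat.le_ceil q
  have hk2 : (k : ℝ) ≤ 2 * q := by
    have := Nat.ceil_lt_add_one (by linarith : 0 ≤ q)
    linarith
  have hk0 : (0 : ℝ) < k := by linarith
  have hcard : Fintype.card (Fin N) ≤ Fintype.card (Fin d → Fin k) := by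
    simp only [Fintype.card_fin, Fintype.card_pi, Finset.prod_const, Finset.card_univ]
    have : (N : ℝ) ≤ (k : ℝ) ^ d := by rw [← hqd]; gcongr
    exact_mod_cast this
  obtain ⟨e⟩ := Function.Embedding.nonempty_of_card_le hcard
  set w : Fin N → EuclideanSpace ℝ (Fin d) := fun i =>
    z + WithLp.toLp 2 fun j => s / k * ((e i j : ℕ) : ℝ) with hw
  have hwz : ∀ i, ‖w i - z‖ ≤ ρ / 2 := by
    intro i
    rw [hw]
    simp only [add_sub_cancel_left]
    refine (euclidean_norm_le_of_abs_le (B := s) fun j => ?_).trans (le_of_eq ?_)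
    · rw [abs_of_nonneg (by positivity)]
      have : ((e i j : ℕ) : ℝ) ≤ k := by exact_mod_cast (e i j).2.le
      calc s / k * ((e i j : ℕ) : ℝ) ≤ s / k * k := by gcongr
        _ = s := by field_simp
    · rw [hs]; field_simp
  have hwb : ∀ i, w i ∈ Metric.ball z ρ := fun i =>
    mem_ball_iff_norm.2 ((hwz i).trans_lt (by linarith))
  have hsep : ∀ i j, i ≠ j → s / k ≤ ‖w i - w j‖ := by
    intro i j hij
    have hne : e i ≠ e j := fun h => hij (e.injective h)
    obtain ⟨l, hl⟩ := Function.ne_iff.1 hne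
    refine le_trans ?_ (PiLp.norm_apply_le (w i - w j) l)
    have : (w i - w j) l = s / k * (((e i l : ℕ) : ℝ) - ((e j l : ℕ) : ℝ)) := by
      simp [hw]; ring
    rw [this, Real.norm_eq_abs, abs_mul, abs_of_pos (by positivity : 0 < s / k)]
    refine le_mul_of_one_le_right (by positivity) ?_
    have h1 : ((e i l : ℕ) : ℤ) - ((e j l : ℕ) : ℤ) ≠ 0 := by
      intro h0; apply hl; apply Fin.ext; omega
    have h2 := Int.one_le_abs h1
    exact_mod_cast h2
  refine ⟨fun i => ψ (w i), fun i j hij => ?_, fun i => ?_⟩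
  · have h1 := (hsep i j hij).trans (h.antilipschitz _ (hwb i) _ (hwb j))
    have h2 : C * (2 * (c * q⁻¹)) ≤ s / k := by
      calc C * (2 * (c * q⁻¹)) ≤ C * (2 * (s / (4 * C) * q⁻¹)) := by gcongr
        _ = s / (2 * q) := by field_simp; norm_num
        _ ≤ s / k := by gcongr
    exact le_of_mul_le_mul_left (h2.trans h1) hC
  · set r := c * q⁻¹ / (2 * C) with hr
    have hr0 : 0 < r := by positivity
    have hr1 : r ≤ ρ / 2 := by
      have : c * q⁻¹ ≤ ρ * C * 1 := by
        gcongr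
        exact inv_le_one_of_one_le₀ hq1
      rw [hr, div_le_iff₀ (by positivity)]
      linarith
    have hsub : Metric.ball (w i) r ⊆ Metric.ball z ρ := by
      intro x hx
      rw [mem_ball_iff_norm] at hx ⊢
      have := norm_sub_le_norm_sub_add_norm_sub x (w i) z
      linarith [hwz i]
    have himg : ψ '' Metric.ball (w i) r ⊆ Metric.closedBall (ψ (w i)) (c * q⁻¹ / 2) := by
      rintro _ ⟨x, hx, rfl⟩
      rw [mem_closedBall_iff_norm]
      refine (h.lipschitz (hsub hx) (hwb i)).trans ?_
      calc C * ‖x - w i‖ ≤ C * r := by gcongr; exact (mem_ball_iff_norm.1 hx).le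
        _ = c * q⁻¹ / 2 := by rw [hr]; field_simp
    have h1 := h.le_measure_image _ hsub measurableSet_ball
    have h2 := h1.trans (mul_le_mul' le_rfl (measure_mono himg))
    rw [Measure.addHaar_ball_of_pos _ _ hr0, finrank_euclideanSpace, Fintype.card_fin] at h2
    have hvv : volume (Metric.ball (0 : EuclideanSpace ℝ (Fin d)) 1) = ENNReal.ofReal v := by
      rw [hv, ENNReal.ofReal_toReal measure_ball_lt_top.ne]
    rw [hvv, ← ENNReal.ofReal_mul (by positivity)] at h2
    have e1 : r ^ d * v = C * ((c / (2 * C)) ^ d * v / C / N) := by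
      rw [← hqd, hr]
      have : r ^ d = (c / (2 * C)) ^ d * (q ^ d)⁻¹ := by
        rw [hr, ← inv_pow, ← mul_pow]; congr 1; ring
      rw [← hr, this]
      field_simp
    rw [e1, ENNReal.ofReal_mul hC.le] at h2
    exact (ENNReal.mul_le_mul_iff_right (by simpa using hC) ENNReal.ofReal_ne_top).1 h2

variable {γ : ℝ}

theorem ofReal_abs_meanDeviation_le_empiricalSup {n : ℕ} {f : EuclideanSpace ℝ (Fin D) → ℝ}
    (hf : f ∈ holderBall γ 1 Set.univ) (X : Fin n → EuclideanSpace ℝ (Fin D)) :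
    ENNReal.ofReal |meanDeviation μ f X| ≤ empiricalSup γ μ X :=
  le_iSup₂ (f := fun f (_ : f ∈ holderBall γ 1
    (Set.univ : Set (EuclideanSpace ℝ (Fin D)))) => ENNReal.ofReal |meanDeviation μ f X|) f hf

variable [IsProbabilityMeasure μ]

/-- The empirical process is at least of order `n ^ (-γ / d)`, for every sample. -/
theorem IsChartBall.exists_le_empiricalSup (h : IsChartBall C ρ μ ψ z) (hd : 1 ≤ d) (hC : 0 < C)
    (hρ : 0 < ρ) (hγ : 0 < γ) : ∃ a : ℝ, 0 < a ∧ ∀ n : ℕ, 1 ≤ n →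
      ∀ X : Fin n → EuclideanSpace ℝ (Fin D),
        ENNReal.ofReal (a * (n : ℝ) ^ (-(γ / d))) ≤ empiricalSup γ μ X := by
  obtain ⟨c, c', hc0, hc1, hc'0, hpts⟩ := h.exists_separated_points hd hC hρ
  obtain ⟨ε, hε, hbump⟩ := exists_bumpSum_mem_holderBall D hγ
  have hd0 : (0 : ℝ) < d := by exact_mod_cast hd
  refine ⟨ε * (c ^ γ * 2 ^ (-(γ / d))) * (c' / 2), by positivity, fun n hn X => ?_⟩
  have hn0 : (0 : ℝ) < n := by exact_mod_cast hn
  -- Twice as many points as observations: the sample can spoil at most `n` of them.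
  obtain ⟨y, hsep, hmass⟩ := hpts (2 * n) (by omega)
  set t : ℝ := c * ((2 * n : ℕ) : ℝ) ^ (-(1 / d : ℝ)) with ht
  have ht0 : 0 < t := by positivity
  have ht1 : t ≤ 1 := by
    have : ((2 * n : ℕ) : ℝ) ^ (-(1 / d : ℝ)) ≤ 1 :=
      Real.rpow_le_one_of_one_le_of_nonpos (by exact_mod_cast (by omega : 1 ≤ 2 * n))
        (by rw [neg_nonpos]; positivity)
    calc t ≤ 1 * 1 := by rw [ht]; gcongr
      _ = 1 := one_mul 1
  have htγ : t ^ γ = c ^ γ * 2 ^ (-(γ / d)) * (n : ℝ) ^ (-(γ / d)) := by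
    rw [ht, Real.mul_rpow hc0.le (by positivity), ← Real.rpow_mul (by positivity), mul_assoc]
    congr 1
    push_cast
    rw [← Real.mul_rpow (by norm_num) hn0.le]
    congr 1
    field_simp
  classical
  -- The centres whose bumps vanish at every observation.
  set T : Finset (Fin (2 * n)) := Finset.univ.filter fun i => ∀ j, t ≤ ‖X j - y i‖ with hT
  have hTc : n ≤ T.card := by
    have h1 : Tᶜ.card ≤ n := by
      have h2 : ∀ i ∈ Tᶜ, ∃ j, ‖X j - y i‖ < t := by
        intro i hi
        rw [Finset.mem_compl, hT, Finset.mem_filter] at hi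
        push Not at hi
        exact hi (Finset.mem_univ _)
      have : Nonempty (Fin n) := ⟨⟨0, hn⟩⟩
      -- A spoiled centre has an observation within `t`; this assignment is injective, since
      -- distinct centres are `2t` apart.
      choose! J hJ using h2
      have h3 : Tᶜ.card ≤ (Finset.univ : Finset (Fin n)).card := by
        refine Finset.card_le_card_of_injOn J (fun _ _ => Finset.mem_coe.2 (Finset.mem_univ _)) ?_
        intro i hi i' hi' hJJ
        by_contra hne
        have a1 := hJ i hi
        have a2 := hJ i' hi'
        rw [← hJJ] at a2
        have a3 := hsep i i' hne
        have a4 : ‖y i - y i'‖ ≤ ‖X (J i) - y i‖ + ‖X (J i) - y i'‖ := by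
          rw [show y i - y i' = (X (J i) - y i') - (X (J i) - y i) by abel, add_comm]
          exact norm_sub_le _ _
        linarith
      simpa using h3
    have h2 := Finset.card_compl_add_card T
    rw [Fintype.card_fin] at h2
    omega
  set f : EuclideanSpace ℝ (Fin D) → ℝ := fun x => ε * t ^ γ * bumpSum T t y x with hf
  have hfm : f ∈ holderBall γ 1 Set.univ := hbump _ T t y ht0 ht1 hsep
  refine le_trans (ENNReal.ofReal_le_ofReal ?_)
    (ofReal_abs_meanDeviation_le_empiricalSup (μ := μ) hfm X)
  have hX : ∀ j, f (X j) = 0 := by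
    intro j
    rw [hf]
    simp only
    rw [bumpSum_eq_zero ht0, mul_zero]
    intro i hi
    rw [hT, Finset.mem_filter] at hi
    exact hi.2 j
  have hdev : meanDeviation μ f X = ∫ x, f x ∂μ := by simp [meanDeviation, hX]
  rw [hdev]
  refine le_trans ?_ (le_abs_self _)
  have hfc : Continuous f := continuous_of_mem_holderBall_univ hfm
  have hc0' : 0 ≤ ε * t ^ γ := by positivity
  have hint : Integrable f μ := integrable_of_abs_le_const hfc.measurable fun x =>
    abs_le_of_mem_holderBall zero_le_one hfm (Set.mem_univ x)
  have hBd : (T : Set (Fin (2 * n))).PairwiseDisjoint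
      fun i => Metric.closedBall (y i) (t / 2) := by
    intro i _ j _ hij
    apply Metric.closedBall_disjoint_closedBall
    rw [dist_eq_norm]
    linarith [hsep i j hij]
  set S := ⋃ i ∈ T, Metric.closedBall (y i) (t / 2) with hS
  have hSm : MeasurableSet S := Finset.measurableSet_biUnion _ fun i _ =>
    Metric.isClosed_closedBall.measurableSet
  have hSμ : c' / 2 ≤ μ.real S := by
    rw [hS, measureReal_biUnion_finset hBd fun i _ => Metric.isClosed_closedBall.measurableSet]
    have h1 : ∀ i ∈ T, c' / (2 * n : ℕ) ≤ μ.real (Metric.closedBall (y i) (t / 2)) := by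
      intro i _
      exact (ENNReal.ofReal_le_iff_le_toReal (measure_ne_top _ _)).1 (hmass i)
    refine le_trans ?_ (Finset.card_nsmul_le_sum _ _ _ h1)
    rw [nsmul_eq_mul]
    have h2 : (n : ℝ) ≤ T.card := by exact_mod_cast hTc
    calc c' / 2 = n * (c' / (2 * n : ℕ)) := by push_cast; field_simp
      _ ≤ _ := by gcongr
  calc ε * (c ^ γ * 2 ^ (-(γ / d))) * (c' / 2) * (n : ℝ) ^ (-(γ / d))
      = ε * t ^ γ * (c' / 2) := by rw [htγ]; ring
    _ ≤ ε * t ^ γ * μ.real S := by gcongr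
    _ = ∫ x in S, ε * t ^ γ ∂μ := by rw [setIntegral_const, smul_eq_mul, mul_comm]
    _ ≤ ∫ x in S, f x ∂μ := by
        refine setIntegral_mono_on (integrable_const _).integrableOn hint.integrableOn hSm ?_
        intro x hx
        obtain ⟨i, hi, hxi⟩ := Set.mem_iUnion₂.1 hx
        have := one_le_bumpSum (y := y) (x := x) ht0 hi (mem_closedBall_iff_norm.1 hxi)
        exact le_mul_of_one_le_right hc0' this
    _ ≤ ∫ x, f x ∂μ := setIntegral_le_integral hint
        (Filter.Eventually.of_forall fun x => mul_nonneg hc0' (bumpSum_nonneg _ _ _ _))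

/-- The mean of the empirical process is at least of order `n ^ (-1 / 2)`. -/
theorem IsChartBall.exists_le_lintegral_empiricalSup (h : IsChartBall C ρ μ ψ z) (hd : 1 ≤ d)
    (hC : 0 < C) (hρ : 0 < ρ) (hγ : 0 < γ) : ∃ a : ℝ, 0 < a ∧ ∀ n : ℕ, 1 ≤ n →
      ENNReal.ofReal (a / √n) ≤ ∫⁻ X, empiricalSup γ μ X ∂(sampleLaw n μ) := by
  obtain ⟨c, c', hc0, hc1, hc'0, hpts⟩ := h.exists_separated_points hd hC hρ
  obtain ⟨ε, hε, hbump⟩ := exists_bumpSum_mem_holderBall D hγ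
  obtain ⟨y, hsep, hmass⟩ := hpts 2 (by norm_num)
  set t : ℝ := c * ((2 : ℕ) : ℝ) ^ (-(1 / d : ℝ)) with ht
  have ht0 : 0 < t := by positivity
  have ht1 : t ≤ 1 := by
    have : ((2 : ℕ) : ℝ) ^ (-(1 / d : ℝ)) ≤ 1 :=
      Real.rpow_le_one_of_one_le_of_nonpos (by norm_num) (by rw [neg_nonpos]; positivity)
    calc t ≤ 1 * 1 := by rw [ht]; gcongr
      _ = 1 := one_mul 1
  set f : EuclideanSpace ℝ (Fin D) → ℝ := fun x => ε * t ^ γ * bumpSum {0} t y x with hf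
  have hfm : f ∈ holderBall γ 1 Set.univ := hbump _ {0} t y ht0 ht1 hsep
  have hfc : Continuous f := continuous_of_mem_holderBall_univ hfm
  have hf1 : ∀ x, |f x| ≤ 1 := fun x => abs_le_of_mem_holderBall zero_le_one hfm (Set.mem_univ x)
  have hpos : ∀ i, μ (Metric.closedBall (y i) (t / 2)) ≠ 0 := fun i =>
    (lt_of_lt_of_le (by simpa using hc'0) (hmass i)).ne'
  have hL2 : MemLp f 2 μ :=
    MemLp.of_bound hfc.aestronglyMeasurable 1 (Filter.Eventually.of_forall hf1)
  -- The function is at least `ε t^γ` near the first point and zero near the second, and both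
  -- neighbourhoods have positive mass, so it is not almost surely constant.
  have hvar : 0 < ProbabilityTheory.variance f μ := by
    refine (ProbabilityTheory.variance_nonneg f μ).lt_of_ne fun h0 => ?_
    have h1 : f =ᵐ[μ] fun _ => ∫ x, f x ∂μ := by
      have h2 : ProbabilityTheory.evariance f μ = 0 := by
        rw [← hL2.ofReal_variance_eq, ← h0, ENNReal.ofReal_zero]
      exact (ProbabilityTheory.evariance_eq_zero_iff hfc.aemeasurable).1 h2
    have h3 : ∀ i, ∃ x ∈ Metric.closedBall (y i) (t / 2), f x = ∫ x, f x ∂μ := by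
      intro i
      by_contra hcon
      push Not at hcon
      exact hpos i (measure_mono_null (fun x hx => hcon x hx) h1)
    obtain ⟨x0, hx0, e0⟩ := h3 0
    obtain ⟨x1, hx1, e1⟩ := h3 1
    have a0 : f x1 = 0 := by
      rw [hf]
      simp only
      rw [bumpSum_eq_zero ht0, mul_zero]
      intro i hi
      rw [Finset.mem_singleton] at hi
      subst hi
      have a3 := hsep 1 0 (by decide)
      have a4 := mem_closedBall_iff_norm.1 hx1
      have a5 : ‖y 1 - y 0‖ ≤ ‖x1 - y 1‖ + ‖x1 - y 0‖ := by
        rw [show y 1 - y 0 = (x1 - y 0) - (x1 - y 1) by abel, add_comm]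
        exact norm_sub_le _ _
      linarith
    have a1 := one_le_bumpSum (T := {0}) (y := y) (x := x0) ht0 (Finset.mem_singleton_self _)
      (mem_closedBall_iff_norm.1 hx0)
    have a2 : 0 < f x0 := by
      have : 0 < ε * t ^ γ := by positivity
      exact mul_pos this (by linarith)
    rw [e0, ← e1, a0] at a2
    exact lt_irrefl _ a2
  obtain ⟨a, ha, hle⟩ := exists_le_integral_abs_meanDeviation hfc.measurable hf1 hvar
  refine ⟨a, ha, fun n hn => ?_⟩
  refine (ENNReal.ofReal_le_ofReal (hle n hn)).trans ?_
  rw [ofReal_integral_eq_lintegral_ofReal]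
  · exact lintegral_mono fun X => ofReal_abs_meanDeviation_le_empiricalSup hfm X
  · exact integrable_of_abs_le_const (B := 2 * 1) (measurable_meanDeviation hfc.measurable).abs
      fun X => by rw [abs_abs]; exact abs_meanDeviation_le hf1 X
  · exact Filter.Eventually.of_forall fun X => abs_nonneg _

end lowerBound

/-! ### Taylor approximation along curves and by monomials. -/

section taylor

variable {D : ℕ}

/-- The Taylor polynomial of `f` at `x` of degree less than `n`, evaluated at `y`. -/
def taylorSum (n : ℕ) (f : EuclideanSpace ℝ (Fin D) → ℝ) (x y : EuclideanSpace ℝ (Fin D)) : ℝ :=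
  ∑ k ∈ Finset.range n, ((k.factorial : ℝ))⁻¹ * iteratedFDeriv ℝ k f x fun _ => y - x

theorem taylorSum_self {n : ℕ} (hn : 1 ≤ n) (f : EuclideanSpace ℝ (Fin D) → ℝ)
    (x : EuclideanSpace ℝ (Fin D)) : taylorSum n f x x = f x := by
  rw [taylorSum, Finset.sum_eq_single_of_mem 0 (by simp; omega)]
  · simp
  · intro k _ hk
    have : iteratedFDeriv ℝ k f x (fun _ => x - x) = 0 :=
      (iteratedFDeriv ℝ k f x).map_coord_zero (⟨0, by omega⟩ : Fin k) (sub_self x)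
    rw [this, mul_zero]

/-- By symmetry the slot holding the exceptional vector is immaterial; differentiating the
increments `y - c` slot by slot then gives equal terms. -/
theorem iteratedFDeriv_update_eq_cons {k : ℕ} {f : EuclideanSpace ℝ (Fin D) → ℝ}
    {x : EuclideanSpace ℝ (Fin D)} (hf : ContDiffAt ℝ ((k + 1 : ℕ)) f x)
    (w v : EuclideanSpace ℝ (Fin D)) (i : Fin (k + 1)) :
    iteratedFDeriv ℝ (k + 1) f x (Function.update (fun _ => w) i v) =
      iteratedFDeriv ℝ (k + 1) f x (Fin.cons v fun _ => w) := by
  rw [← iteratedFDeriv_comp_perm f x hf _ (Equiv.swap 0 i)]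
  congr 1
  ext j : 1
  simp only [Function.comp_apply]
  by_cases hj : j = 0
  · subst hj
    simp
  · obtain ⟨l, rfl⟩ := Fin.exists_succ_eq.2 hj
    rw [Fin.cons_succ]
    apply Function.update_of_ne
    intro h
    rw [Equiv.swap_apply_eq_iff, Equiv.swap_apply_right] at h
    exact Fin.succ_ne_zero _ h

/-- Differentiating the Taylor polynomial along a curve of base points. -/
theorem hasDerivAt_taylorSum {m : ℕ} {f : EuclideanSpace ℝ (Fin D) → ℝ}
    (hf : ContDiff ℝ ((m + 1 : ℕ)) f) {c : ℝ → EuclideanSpace ℝ (Fin D)}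
    {v : EuclideanSpace ℝ (Fin D)} {t : ℝ} (hc : HasDerivAt c v t)
    (y : EuclideanSpace ℝ (Fin D)) :
    HasDerivAt (fun s => taylorSum (m + 1) f (c s) y)
      (((m.factorial : ℝ))⁻¹ *
        iteratedFDeriv ℝ (m + 1) f (c t) (Fin.cons v fun _ => y - c t)) t := by
  have hterm : ∀ k < m + 1, HasDerivAt (fun s => iteratedFDeriv ℝ k f (c s) fun _ => y - c s)
      (iteratedFDeriv ℝ (k + 1) f (c t) (Fin.cons v fun _ => y - c t) +
        ∑ i : Fin k, iteratedFDeriv ℝ k f (c t) (Function.update (fun _ => y - c t) i (-v))) t := by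
    intro k hk
    have h1 : HasFDerivAt (iteratedFDeriv ℝ k f) (fderiv ℝ (iteratedFDeriv ℝ k f) (c t)) (c t) :=
      ((hf.of_le (m := ((k + 1 : ℕ))) (by exact_mod_cast hk)).differentiable_iteratedFDeriv
        (by exact_mod_cast Nat.lt_succ_self k) _).hasFDerivAt
    have h2 := (h1.comp t hc.hasFDerivAt).continuousMultilinearMap_apply
      (g := fun (_ : Fin k) s => y - c s) (fun _ => (hc.const_sub y).hasFDerivAt)
    have h3 := h2.hasDerivAt
    refine h3.congr_deriv ?_
    simp [iteratedFDeriv_succ_apply_left]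
  induction m with
  | zero =>
    have := hterm 0 (by norm_num)
    simp only [taylorSum, zero_add, Finset.range_one, Finset.sum_singleton, Nat.factorial_zero,
      Nat.cast_one, inv_one, one_mul]
    refine this.congr_deriv ?_
    simp
  | succ m ih =>
    have hf' : ContDiff ℝ ((m + 1 : ℕ)) f := hf.of_le (by exact_mod_cast Nat.le_succ _)
    have h1 := ih hf' (fun k hk => hterm k (by omega))
    have h2 := (hterm (m + 1) (by omega)).const_mul ((((m + 1).factorial : ℝ))⁻¹)
    have h3 := h1.add h2
    have e : (fun s => taylorSum (m + 1 + 1) f (c s) y) =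
        (fun s => taylorSum (m + 1) f (c s) y) + fun s => (((m + 1).factorial : ℝ))⁻¹ *
          iteratedFDeriv ℝ (m + 1) f (c s) fun _ => y - c s := by
      ext s
      simp only [Pi.add_apply]
      rw [taylorSum, Finset.sum_range_succ]
      rfl
    rw [e]
    refine h3.congr_deriv ?_
    -- The `m + 1` slots contribute equal terms, and `(m + 1) / (m + 1)! = 1 / m!`, so together they
    -- cancel the derivative of the sum of lower degree.
    have hu : ∀ i : Fin (m + 1), iteratedFDeriv ℝ (m + 1) f (c t)
        (Function.update (fun _ => y - c t) i (-v)) =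
        - iteratedFDeriv ℝ (m + 1) f (c t) (Fin.cons v fun _ => y - c t) := by
      intro i
      rw [← iteratedFDeriv_update_eq_cons hf'.contDiffAt _ v i]
      have := (iteratedFDeriv ℝ (m + 1) f (c t)).map_update_smul (fun _ => y - c t) i (-1) v
      simpa using this
    simp only [hu, Finset.sum_const, Finset.card_univ, Fintype.card_fin, nsmul_eq_mul]
    rw [Nat.factorial_succ]
    have h4 : ((m : ℝ) + 1) ≠ 0 := by positivity
    have h5 : (m.factorial : ℝ) ≠ 0 := by positivity
    push_cast
    field_simp
    ring

/-- Integral bound for the Taylor remainder along a curve. -/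
theorem abs_sub_taylorSum_le_integral {m : ℕ} {f : EuclideanSpace ℝ (Fin D) → ℝ}
    (hf : ContDiff ℝ ((m + 1 : ℕ)) f) {c c' : ℝ → EuclideanSpace ℝ (Fin D)}
    (hc : ∀ t ∈ Set.Icc (0 : ℝ) 1, HasDerivAt c (c' t) t)
    (hc' : ContinuousOn c' (Set.Icc 0 1)) {V : ℝ}
    (hV : ∀ t ∈ Set.Icc (0 : ℝ) 1, ‖c' t‖ ≤ V) :
    |f (c 1) - taylorSum (m + 1) f (c 0) (c 1)| ≤
      V ^ (m + 1) * ∫ t in (0 : ℝ)..1, ‖iteratedFDeriv ℝ (m + 1) f (c t)‖ := by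
  have h01 : (0 : ℝ) ∈ Set.Icc (0 : ℝ) 1 := ⟨le_rfl, zero_le_one⟩
  have h11 : (1 : ℝ) ∈ Set.Icc (0 : ℝ) 1 := ⟨zero_le_one, le_rfl⟩
  have hV0 : 0 ≤ V := (norm_nonneg _).trans (hV 0 h01)
  have hcc : ContinuousOn c (Set.Icc 0 1) := fun t ht => (hc t ht).continuousAt.continuousWithinAt
  have hIc : ContinuousOn (fun t => iteratedFDeriv ℝ (m + 1) f (c t)) (Set.Icc 0 1) :=
    (hf.continuous_iteratedFDeriv' (m := m + 1)).comp_continuousOn hcc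
  set G' : ℝ → ℝ := fun t => ((m.factorial : ℝ))⁻¹ *
    iteratedFDeriv ℝ (m + 1) f (c t) (Fin.cons (c' t) fun _ => c 1 - c t) with hG'
  have hG'c : ContinuousOn G' (Set.Icc 0 1) := by
    refine continuousOn_const.mul ?_
    have h1 : ContinuousOn (fun t => (Fin.cons (c' t) fun _ => c 1 - c t :
        Fin (m + 1) → EuclideanSpace ℝ (Fin D))) (Set.Icc 0 1) := by
      rw [continuousOn_pi]
      intro i
      refine Fin.cases ?_ (fun j => ?_) i
      · simpa using hc'
      · simp only [Fin.cons_succ]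
        exact continuousOn_const.sub hcc
    exact (continuous_eval (F := ContinuousMultilinearMap ℝ
      (fun _ : Fin (m + 1) => EuclideanSpace ℝ (Fin D)) ℝ)).comp_continuousOn (hIc.prodMk h1)
  have hftc := intervalIntegral.integral_eq_sub_of_hasDerivAt
    (f := fun s => taylorSum (m + 1) f (c s) (c 1)) (f' := G') (a := 0) (b := 1)
    (fun t ht => by
      rw [Set.uIcc_of_le zero_le_one] at ht
      exact hasDerivAt_taylorSum hf (hc t ht) (c 1))
    (hG'c.mono (by rw [Set.uIcc_of_le zero_le_one])).intervalIntegrable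
  rw [taylorSum_self (by omega)] at hftc
  rw [← hftc, ← Real.norm_eq_abs, ← intervalIntegral.integral_const_mul]
  refine intervalIntegral.norm_integral_le_of_norm_le zero_le_one
    (Filter.Eventually.of_forall fun t ht => ?_)
    ((continuousOn_const.mul hIc.norm).mono
      (by rw [Set.uIcc_of_le zero_le_one])).intervalIntegrable
  have ht' : t ∈ Set.Icc (0 : ℝ) 1 := ⟨ht.1.le, ht.2⟩
  -- The remaining length of the curve is at most its speed bound, so both kinds of arguments of the
  -- derivative are bounded by `V`.
  have hdist : ‖c 1 - c t‖ ≤ V := by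
    have := (convex_Icc (0 : ℝ) 1).norm_image_sub_le_of_norm_hasDerivWithin_le
      (fun s hs => (hc s hs).hasDerivWithinAt) hV ht' h11
    refine this.trans ?_
    rw [Real.norm_eq_abs, abs_of_nonneg (by linarith [ht.2])]
    nlinarith [ht.1]
  rw [hG', norm_mul]
  have h1 : ‖((m.factorial : ℝ))⁻¹‖ ≤ 1 := by
    rw [norm_inv, Real.norm_natCast]
    exact inv_le_one_of_one_le₀ (by exact_mod_cast Nat.one_le_iff_ne_zero.2 m.factorial_ne_zero)
  have h2 := (iteratedFDeriv ℝ (m + 1) f (c t)).le_opNorm (Fin.cons (c' t) fun _ => c 1 - c t)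
  have h3 : ∏ i, ‖(Fin.cons (c' t) fun _ => c 1 - c t :
      Fin (m + 1) → EuclideanSpace ℝ (Fin D)) i‖ ≤ V ^ (m + 1) := by
    rw [Fin.prod_univ_succ, pow_succ']
    simp only [Fin.cons_zero, Fin.cons_succ, Finset.prod_const, Finset.card_univ, Fintype.card_fin]
    gcongr
    exact hV t ht'
  calc _ ≤ 1 * (‖iteratedFDeriv ℝ (m + 1) f (c t)‖ * V ^ (m + 1)) := by
        gcongr
        exact h2.trans (by gcongr)
    _ = _ := by ring

/-- Taylor approximation of functions in a Hölder ball. -/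
theorem abs_sub_taylorSum_le_of_mem_holderBall {γ : ℝ} (hγ : 0 < γ)
    {f : EuclideanSpace ℝ (Fin D) → ℝ} (hf : f ∈ holderBall γ 1 Set.univ)
    (x y : EuclideanSpace ℝ (Fin D)) :
    |f y - taylorSum (⌊γ⌋₊ + 1) f x y| ≤ (D : ℝ) ^ ⌊γ⌋₊ * ‖y - x‖ ^ γ := by
  have hfc : ContDiff ℝ (⌊γ⌋₊ : ℕ) f := contDiffOn_univ.1 hf.1
  have hsub : ∀ x' : EuclideanSpace ℝ (Fin D), ‖iteratedFDeriv ℝ ⌊γ⌋₊ f x' -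
      iteratedFDeriv ℝ ⌊γ⌋₊ f x‖ ≤ (D : ℝ) ^ ⌊γ⌋₊ * ‖x' - x‖ ^ (γ - ⌊γ⌋₊) := by
    intro x'
    by_cases h : x' = x
    · subst h; simp; positivity
    · have := norm_iteratedFDeriv_sub_le_of_mem_holderBall isOpen_univ zero_le_one hf
        (Set.mem_univ x') (Set.mem_univ x) h
      rwa [one_mul] at this
  have hmγ : (⌊γ⌋₊ : ℝ) ≤ γ := Nat.floor_le hγ.le
  by_cases hxy : y = x
  · subst hxy
    rw [taylorSum_self (by omega), sub_self, abs_zero]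
    positivity
  have hv0 : 0 < ‖y - x‖ := norm_pos_iff.2 (sub_ne_zero.2 hxy)
  have hpow : ‖y - x‖ ^ γ = ‖y - x‖ ^ (γ - ⌊γ⌋₊) * ‖y - x‖ ^ ⌊γ⌋₊ := by
    rw [← Real.rpow_natCast, ← Real.rpow_add hv0]; congr 1; ring
  rw [hpow]
  generalize ⌊γ⌋₊ = m at *
  cases m with
  | zero =>
    have h1 := hsub y
    have h2 : f y - taylorSum (0 + 1) f x y =
        (iteratedFDeriv ℝ 0 f y - iteratedFDeriv ℝ 0 f x) fun _ => 0 := by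
      simp [taylorSum]
    rw [h2, ← Real.norm_eq_abs]
    refine (ContinuousMultilinearMap.le_opNorm _ _).trans ?_
    simpa using h1
  | succ m =>
    set v := y - x with hv
    set c : ℝ → EuclideanSpace ℝ (Fin D) := fun t => x + t • v with hc
    have hcd : ∀ t, HasDerivAt c v t := fun t => by
      have h := ((hasDerivAt_id t).smul_const v).const_add x
      rw [one_smul] at h
      exact h
    have hyc : ∀ t, y - c t = (1 - t) • v := fun t => by
      have hy : y = x + v := by rw [hv]; abel
      calc y - c t = (x + v) - (x + t • v) := by rw [← hy]
        _ = (1 - t) • v := by rw [sub_smul, one_smul]; abel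
    set q := iteratedFDeriv ℝ (m + 1) f x fun _ => v with hq
    -- This runs from the full Taylor sum at `t = 0` to `f y` at `t = 1`. The correction term
    -- subtracts the top derivative at `x`, so the derivative of `H` involves only its increment
    -- along the segment, to which the Hölder condition applies.
    set H : ℝ → ℝ := fun t => taylorSum (m + 1) f (c t) y +
      (((m + 1).factorial : ℝ))⁻¹ * ((1 - t) ^ (m + 1) * q) with hH
    have hcons : ∀ t x', iteratedFDeriv ℝ (m + 1) f x' (Fin.cons v fun _ => y - c t) =
        (1 - t) ^ m * iteratedFDeriv ℝ (m + 1) f x' fun _ => v := by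
      intro t x'
      have e : (Fin.cons v fun _ => y - c t : Fin (m + 1) → EuclideanSpace ℝ (Fin D)) =
          fun i => (Fin.cons 1 fun _ => 1 - t : Fin (m + 1) → ℝ) i • v := by
        ext i : 1
        refine Fin.cases ?_ (fun j => ?_) i
        · simp
        · simp [hyc]
      rw [e, ContinuousMultilinearMap.map_smul_univ, Fin.prod_univ_succ]
      simp
    have hHd : ∀ t, HasDerivAt H (((m.factorial : ℝ))⁻¹ * ((1 - t) ^ m *
        ((iteratedFDeriv ℝ (m + 1) f (c t) - iteratedFDeriv ℝ (m + 1) f x) fun _ => v))) t := by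
      intro t
      have h1 := hasDerivAt_taylorSum hfc (hcd t) y
      have h2 : HasDerivAt (fun t : ℝ => (1 - t) ^ (m + 1))
          ((m + 1 : ℕ) * (1 - t) ^ m * (-1)) t := by
        have h := ((hasDerivAt_id t).const_sub 1).pow (m + 1)
        exact HasDerivAt.congr_deriv (f := fun t : ℝ => (1 - t) ^ (m + 1)) h (by simp)
      have h3 := h1.add ((h2.mul_const q).const_mul ((((m + 1).factorial : ℝ))⁻¹))
      refine h3.congr_deriv ?_
      rw [hcons, sub_apply, Nat.factorial_succ]
      have h5 : (m.factorial : ℝ) ≠ 0 := by positivity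
      push_cast
      field_simp
      ring
    have hbd := norm_image_sub_le_of_norm_deriv_le_segment_01' (f := H)
      (C := (D : ℝ) ^ (m + 1) * (‖v‖ ^ (γ - (m + 1 : ℕ)) * ‖v‖ ^ (m + 1)))
      (fun t _ => (hHd t).hasDerivWithinAt) (fun t ht => by
        rw [norm_mul, norm_mul, norm_pow]
        have a1 : ‖((m.factorial : ℝ))⁻¹‖ ≤ 1 := by
          rw [norm_inv, Real.norm_natCast]
          exact inv_le_one_of_one_le₀
            (by exact_mod_cast Nat.one_le_iff_ne_zero.2 m.factorial_ne_zero)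
        have a2 : ‖1 - t‖ ^ m ≤ 1 := by
          apply pow_le_one₀ (norm_nonneg _)
          rw [Real.norm_eq_abs, abs_of_nonneg (by linarith [ht.2])]
          linarith [ht.1]
        have a3 : ‖(iteratedFDeriv ℝ (m + 1) f (c t) - iteratedFDeriv ℝ (m + 1) f x)
            fun _ => v‖ ≤ (D : ℝ) ^ (m + 1) * ‖v‖ ^ (γ - (m + 1 : ℕ)) * ‖v‖ ^ (m + 1) := by
          refine (ContinuousMultilinearMap.le_opNorm _ _).trans ?_
          rw [Finset.prod_const, Finset.card_univ, Fintype.card_fin]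
          gcongr
          refine (hsub (c t)).trans ?_
          gcongr
          rw [hc, add_sub_cancel_left, norm_smul, Real.norm_eq_abs, abs_of_nonneg ht.1]
          exact mul_le_of_le_one_left hv0.le ht.2.le
        calc _ ≤ 1 * (1 * ((D : ℝ) ^ (m + 1) * ‖v‖ ^ (γ - (m + 1 : ℕ)) * ‖v‖ ^ (m + 1))) := by
              gcongr
          _ = _ := by ring)
    have e1 : H 1 = f y := by
      have : c 1 = y := by rw [hc]; simp [hv]
      simp only [hH, this]
      rw [taylorSum_self (by omega)]
      simp
    have e0 : H 0 = taylorSum (m + 1 + 1) f x y := by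
      have : c 0 = x := by rw [hc]; simp
      simp only [hH, this]
      rw [show taylorSum (m + 1 + 1) f x y = taylorSum (m + 1) f x y +
        (((m + 1).factorial : ℝ))⁻¹ * iteratedFDeriv ℝ (m + 1) f x fun _ => y - x from
          Finset.sum_range_succ _ _]
      simp [hq, hv]
    rw [e1, e0, Real.norm_eq_abs] at hbd
    exact hbd

/-- The monomials with exponents less than `n`. -/
def monomialFun {n : ℕ} (s : Fin D → Fin n) (y : EuclideanSpace ℝ (Fin D)) : ℝ :=
  ∏ i, y i ^ (s i : ℕ)

/-- Total degree below `n` forces every exponent below `n`, so `n^D` monomials suffice. -/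
theorem exists_eval_eq_sum_monomialFun {n : ℕ} (p : MvPolynomial (Fin D) ℝ)
    (hp : p.totalDegree < n) : ∃ a : (Fin D → Fin n) → ℝ,
      ∀ y : EuclideanSpace ℝ (Fin D), MvPolynomial.eval y.ofLp p = ∑ s, a s * monomialFun s y := by
  classical
  have hlt : ∀ u ∈ p.support, ∀ i, u i < n := by
    intro u hu i
    refine lt_of_le_of_lt ?_ ((MvPolynomial.le_totalDegree hu).trans_lt hp)
    rw [Finsupp.sum_fintype _ _ (by simp)]
    exact Finset.single_le_sum (f := fun i => u i) (fun _ _ => Nat.zero_le _) (Finset.mem_univ i)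
  refine ⟨fun s => p.coeff (Finsupp.equivFunOnFinite.symm fun i => (s i : ℕ)), fun y => ?_⟩
  rw [MvPolynomial.eval_eq']
  set g : (Fin D → Fin n) → (Fin D →₀ ℕ) :=
    fun s => Finsupp.equivFunOnFinite.symm fun i => (s i : ℕ) with hg
  have hginj : Function.Injective g := by
    intro s s' h
    ext i
    have := DFunLike.congr_fun h i
    simpa [hg] using this
  have hsub : p.support ⊆ Finset.univ.image g := by
    intro u hu
    rw [Finset.mem_image]
    refine ⟨fun i => ⟨u i, hlt u hu i⟩, Finset.mem_univ _, ?_⟩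
    ext i
    simp [hg]
  rw [Finset.sum_subset hsub (fun u _ hu => by
    rw [MvPolynomial.notMem_support_iff.1 hu, zero_mul]),
    Finset.sum_image (fun _ _ _ _ h => hginj h)]
  refine Finset.sum_congr rfl fun s _ => ?_
  simp [hg, monomialFun]

/-- Provides a basis common to all base points: the Taylor sum is a polynomial in `y` of degree
below `m`, whatever `f` and `x`. This makes the approximating spaces linear and independent of the
function. -/
theorem exists_taylorSum_eq_sum_monomialFun {n m : ℕ} (hmn : m ≤ n)
    (f : EuclideanSpace ℝ (Fin D) → ℝ) (x : EuclideanSpace ℝ (Fin D)) :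
    ∃ a : (Fin D → Fin n) → ℝ, ∀ y, taylorSum m f x y = ∑ s, a s * monomialFun s y := by
  rcases Nat.eq_zero_or_pos m with rfl | hm
  · refine ⟨0, fun y => ?_⟩
    simp [taylorSum]
  set p : MvPolynomial (Fin D) ℝ := ∑ k ∈ Finset.range m, ∑ s : Fin k → Fin D,
    MvPolynomial.C (((k.factorial : ℝ))⁻¹ *
      iteratedFDeriv ℝ k f x fun j => EuclideanSpace.single (s j) (1 : ℝ)) *
      ∏ j, (MvPolynomial.X (s j) - MvPolynomial.C (x (s j))) with hp
  have hdeg : p.totalDegree < n := by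
    refine lt_of_le_of_lt (b := m - 1) ?_ (by omega)
    refine MvPolynomial.totalDegree_finsetSum_le fun k hk => ?_
    refine MvPolynomial.totalDegree_finsetSum_le fun s _ => ?_
    refine (MvPolynomial.totalDegree_mul _ _).trans ?_
    rw [MvPolynomial.totalDegree_C, zero_add]
    refine (MvPolynomial.totalDegree_finsetProd _ _).trans ?_
    have : ∀ j ∈ (Finset.univ : Finset (Fin k)),
        (MvPolynomial.X (s j) - MvPolynomial.C (x (s j)) : MvPolynomial (Fin D) ℝ).totalDegree
          ≤ 1 := by
      intro j _
      refine (MvPolynomial.totalDegree_sub _ _).trans ?_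
      simp [MvPolynomial.totalDegree_X]
    refine (Finset.sum_le_card_nsmul _ _ 1 this).trans ?_
    have := Finset.mem_range.1 hk
    simp
    omega
  obtain ⟨a, ha⟩ := exists_eval_eq_sum_monomialFun p hdeg
  refine ⟨a, fun y => ?_⟩
  rw [← ha y, hp, taylorSum, map_sum]
  refine Finset.sum_congr rfl fun k _ => ?_
  have e : y - x = ∑ j, (y j - x j) • EuclideanSpace.single j (1 : ℝ) := by
    ext i
    simp [Pi.single_apply, Finset.sum_apply]
  rw [e, ContinuousMultilinearMap.map_sum, map_sum, Finset.mul_sum]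
  refine Finset.sum_congr rfl fun s _ => ?_
  rw [ContinuousMultilinearMap.map_smul_univ]
  simp only [map_mul, MvPolynomial.eval_C, map_prod, map_sub, MvPolynomial.eval_X, smul_eq_mul]
  ring

theorem continuous_monomialFun {n : ℕ} (s : Fin D → Fin n) :
    Continuous (monomialFun (D := D) s) := by
  unfold monomialFun
  fun_prop

end taylor

/-! ### Orthogonal families and deviations of sample means. -/

section orthogonal

/-- Normalized Gram-Schmidt without assuming linear independence: a vector that depends on its
predecessors contributes `g t = 0`, and the expansion and orthogonality relations are unaffected. -/
theorem exists_adapted_orthogonal_family {H : Type*} [NormedAddCommGroup H]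
    [InnerProductSpace ℝ H] (e : ℕ → H) : ∃ g : ℕ → H,
      (∀ s t, s ≠ t → inner ℝ (g s) (g t) = 0) ∧ (∀ t, ‖g t‖ = 0 ∨ ‖g t‖ = 1) ∧
      (∀ t, e t = ∑ r ∈ Finset.range (t + 1), inner ℝ (g r) (e t) • g r) ∧
      (∀ r t, t < r → inner ℝ (g r) (e t) = 0) := by
  set g := InnerProductSpace.gramSchmidtNormed ℝ e with hg
  have horth : ∀ s t, s ≠ t → inner ℝ (g s) (g t) = 0 := by
    intro s t hst
    simp only [hg, InnerProductSpace.gramSchmidtNormed, inner_smul_left, inner_smul_right,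
      InnerProductSpace.gramSchmidt_orthogonal ℝ e hst, mul_zero]
  have hnorm : ∀ t, ‖g t‖ = 0 ∨ ‖g t‖ = 1 := by
    intro t
    by_cases h : g t = 0
    · left; rw [h, norm_zero]
    · right; exact InnerProductSpace.gramSchmidtNormed_unit_length' h
  have hmem : ∀ t, e t ∈ Submodule.span ℝ (g '' Set.Iic t) := by
    intro t
    rw [hg, InnerProductSpace.span_gramSchmidtNormed, InnerProductSpace.span_gramSchmidt_Iic]
    exact Submodule.subset_span ⟨t, Set.mem_Iic.2 le_rfl, rfl⟩
  have hexp : ∀ t, ∀ v ∈ Submodule.span ℝ (g '' Set.Iic t),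
      v = ∑ r ∈ Finset.range (t + 1), inner ℝ (g r) v • g r := by
    intro t v hv
    induction hv using Submodule.span_induction with
    | mem v hv =>
      obtain ⟨q, hq, rfl⟩ := hv
      rw [Finset.sum_eq_single_of_mem q (by simpa [Nat.lt_succ_iff] using hq)]
      · rcases hnorm q with h | h
        · rw [norm_eq_zero.1 h]; simp
        · rw [real_inner_self_eq_norm_sq, h]; simp
      · intro r _ hr
        rw [horth r q hr, zero_smul]
    | zero => simp
    | add u v _ _ hu hv =>
      simp only [inner_add_right, add_smul, Finset.sum_add_distrib]
      rw [← hu, ← hv]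
    | smul a v _ hv =>
      simp only [inner_smul_right, mul_smul, ← Finset.smul_sum]
      rw [← hv]
  refine ⟨g, horth, hnorm, fun t => hexp t _ (hmem t), fun r t htr => ?_⟩
  rw [hexp t _ (hmem t), inner_sum]
  refine Finset.sum_eq_zero fun q hq => ?_
  rw [inner_smul_right, horth r q, mul_zero]
  have := Finset.mem_range.1 hq
  omega

variable {Ω : Type*} [MeasurableSpace Ω] {μ : Measure Ω}

theorem inner_toLp_eq {g h : Ω → ℝ} (hg : MemLp g 2 μ) (hh : MemLp h 2 μ) :
    inner ℝ (hg.toLp) (hh.toLp) = ∫ x, g x * h x ∂μ := by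
  rw [L2.inner_def]
  apply integral_congr_ae
  filter_upwards [hg.coeFn_toLp, hh.coeFn_toLp] with x h1 h2
  rw [h1, h2]
  simp [mul_comm]

/-- An orthogonal family in `L²(μ)`, adapted to a sequence of functions. -/
structure IsAdaptedFamily (μ : Measure Ω) (e g : ℕ → Ω → ℝ) : Prop where
  memLp : ∀ t, MemLp (g t) 2 μ
  integral_sq_sum_le : ∀ (s : Finset ℕ) (c : ℕ → ℝ),
    ∫ x, (∑ t ∈ s, c t * g t x) ^ 2 ∂μ ≤ ∑ t ∈ s, c t ^ 2
  expansion : ∀ t, ∀ᵐ x ∂μ, e t x = ∑ r ∈ Finset.range (t + 1), (∫ y, g r y * e t y ∂μ) * g r x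
  orthogonal : ∀ r t, t < r → ∫ y, g r y * e t y ∂μ = 0
  bessel : ∀ (s : Finset ℕ) (h : Ω → ℝ), MemLp h 2 μ →
    ∑ t ∈ s, (∫ y, g t y * h y ∂μ) ^ 2 ≤ ∫ y, h y ^ 2 ∂μ

theorem exists_isAdaptedFamily {e : ℕ → Ω → ℝ} (he : ∀ t, MemLp (e t) 2 μ) :
    ∃ g, IsAdaptedFamily μ e g := by
  obtain ⟨G, horth, hnorm, hexp, hzero⟩ := exists_adapted_orthogonal_family fun t => (he t).toLp
  have hGm : ∀ t, MemLp (G t) 2 μ := fun t => Lp.memLp (G t)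
  have hG : ∀ t, (hGm t).toLp = G t := fun t => Lp.toLp_coeFn (G t) (hGm t)
  have hnorm1 : ∀ t, ‖G t‖ ^ 2 ≤ 1 := fun t => by
    rcases hnorm t with h | h <;> rw [h] <;> norm_num
  have hsq : ∀ {h : Ω → ℝ} (hh : MemLp h 2 μ), ‖hh.toLp‖ ^ 2 = ∫ y, h y ^ 2 ∂μ := by
    intro h hh
    rw [← real_inner_self_eq_norm_sq, inner_toLp_eq]
    simp [sq]
  have hsumsq : ∀ (s : Finset ℕ) (c : ℕ → ℝ), ‖∑ t ∈ s, c t • G t‖ ^ 2 =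
      ∑ t ∈ s, c t ^ 2 * ‖G t‖ ^ 2 := by
    intro s c
    rw [← real_inner_self_eq_norm_sq, sum_inner]
    refine Finset.sum_congr rfl fun t ht => ?_
    rw [inner_sum, Finset.sum_eq_single_of_mem t ht]
    · rw [inner_smul_left, inner_smul_right, real_inner_self_eq_norm_sq]; simp; ring
    · intro r _ hr
      rw [inner_smul_left, inner_smul_right, horth t r hr.symm]; simp
  have hcoe : ∀ (s : Finset ℕ) (c : ℕ → ℝ), ((∑ t ∈ s, c t • G t : Lp ℝ 2 μ) : Ω → ℝ) =ᵐ[μ]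
      fun x => ∑ t ∈ s, c t * G t x := by
    intro s c
    refine (Lp.coeFn_finsetSum _ _).trans ?_
    have h1 : ∀ᵐ x ∂μ, ∀ t ∈ s, (c t • G t : Lp ℝ 2 μ) x = c t * G t x := by
      rw [Filter.eventually_all_finset]
      intro t _
      filter_upwards [Lp.coeFn_smul (c t) (G t)] with x hx
      rw [hx]; simp
    filter_upwards [h1] with x hx
    rw [Finset.sum_apply]
    exact Finset.sum_congr rfl fun t ht => hx t ht
  refine ⟨fun t => G t, hGm, fun s c => ?_, fun t => ?_, fun r t htr => ?_, fun s h hh => ?_⟩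
  · have hm : MemLp (fun x => ∑ t ∈ s, c t * G t x) 2 μ :=
      memLp_finsetSum _ fun t _ => (hGm t).const_mul _
    rw [← hsq hm]
    have : hm.toLp = ∑ t ∈ s, c t • G t := by
      apply Lp.ext
      exact hm.coeFn_toLp.trans (hcoe s c).symm
    rw [this, hsumsq]
    exact Finset.sum_le_sum fun t _ => mul_le_of_le_one_right (sq_nonneg _) (hnorm1 t)
  · have h1 := hcoe (Finset.range (t + 1)) fun r => inner ℝ (G r) ((he t).toLp)
    rw [← hexp t] at h1
    filter_upwards [h1, (he t).coeFn_toLp] with x h2 h3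
    rw [← h3, h2]
    refine Finset.sum_congr rfl fun r _ => ?_
    rw [← inner_toLp_eq (hGm r) (he t), hG]
  · rw [← inner_toLp_eq (hGm r) (he t), hG]
    exact hzero r t htr
  · rw [← hsq hh]
    simp only [← inner_toLp_eq (hGm _) hh, hG]
    set v := hh.toLp
    have h1 : 0 ≤ ‖v - ∑ t ∈ s, inner ℝ (G t) v • G t‖ ^ 2 := sq_nonneg _
    rw [norm_sub_sq_real, inner_sum, hsumsq] at h1
    have h2 : ∑ t ∈ s, inner ℝ v (inner ℝ (G t) v • G t) = ∑ t ∈ s, (inner ℝ (G t) v) ^ 2 := by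
      refine Finset.sum_congr rfl fun t _ => ?_
      rw [inner_smul_right, real_inner_comm, sq]
    have h3 : ∑ t ∈ s, (inner ℝ (G t) v) ^ 2 * ‖G t‖ ^ 2 ≤ ∑ t ∈ s, (inner ℝ (G t) v) ^ 2 :=
      Finset.sum_le_sum fun t _ => mul_le_of_le_one_right (sq_nonneg _) (hnorm1 t)
    rw [h2] at h1
    linarith

variable [IsProbabilityMeasure μ] {e g : ℕ → Ω → ℝ} {n : ℕ}

theorem meanDeviation_sum {ι : Type*} (s : Finset ι) {h : ι → Ω → ℝ} (c : ι → ℝ)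
    (hh : ∀ i ∈ s, Integrable (h i) μ) (X : Fin n → Ω) :
    meanDeviation μ (fun x => ∑ i ∈ s, c i * h i x) X =
      ∑ i ∈ s, c i * meanDeviation μ (h i) X := by
  simp only [meanDeviation]
  rw [integral_finsetSum _ fun i hi => (hh i hi).const_mul (c i)]
  simp only [integral_const_mul, mul_sub, Finset.sum_sub_distrib]
  congr 1
  rw [Finset.sum_comm, Finset.mul_sum]
  refine Finset.sum_congr rfl fun i _ => ?_
  rw [← Finset.mul_sum]
  ring

theorem ae_sample {p : Ω → Prop} (hp : ∀ᵐ x ∂μ, p x) :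
    ∀ᵐ X ∂(Measure.pi fun _ : Fin n => μ), ∀ i, p (X i) := by
  rw [Filter.eventually_all]
  intro i
  exact (measurePreserving_eval (fun _ : Fin n => μ) i).quasiMeasurePreserving.ae hp

/-- Each expansion of `e t` holds almost everywhere, hence almost surely at all sample points. The
exceptional event depends only on the countable family, not on `s` or `a`; this is what permits
suprema over uncountable classes of linear combinations. -/
theorem IsAdaptedFamily.ae_meanDeviation_eq (hg : IsAdaptedFamily μ e g)
    (he : ∀ t, MemLp (e t) 2 μ) :
    ∀ᵐ X ∂(Measure.pi fun _ : Fin n => μ), ∀ (s : ℕ) (a : ℕ → ℝ),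
      meanDeviation μ (fun x => ∑ t ∈ Finset.range s, a t * e t x) X =
        ∑ r ∈ Finset.range s, meanDeviation μ (g r) X *
          ∫ y, g r y * (∑ t ∈ Finset.range s, a t * e t y) ∂μ := by
  have hgi : ∀ t, Integrable (g t) μ := fun t => (hg.memLp t).integrable (by norm_num)
  have hei : ∀ t, Integrable (e t) μ := fun t => (he t).integrable (by norm_num)
  have h1 : ∀ᵐ X ∂(Measure.pi fun _ : Fin n => μ), ∀ t, ∀ i,
      e t (X i) = ∑ r ∈ Finset.range (t + 1), (∫ y, g r y * e t y ∂μ) * g r (X i) := by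
    rw [ae_all_iff]
    exact fun t => ae_sample (hg.expansion t)
  filter_upwards [h1] with X hX s a
  have h2 : ∀ t, meanDeviation μ (e t) X =
      ∑ r ∈ Finset.range (t + 1), (∫ y, g r y * e t y ∂μ) * meanDeviation μ (g r) X := by
    intro t
    rw [← meanDeviation_sum _ _ fun r _ => hgi r]
    simp only [meanDeviation]
    rw [integral_congr_ae (hg.expansion t)]
    congr 2
    exact Finset.sum_congr rfl fun i _ => hX t i
  rw [meanDeviation_sum _ _ fun t _ => hei t]
  have h3 : ∀ t ∈ Finset.range s, a t * meanDeviation μ (e t) X =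
      ∑ r ∈ Finset.range s, a t * ((∫ y, g r y * e t y ∂μ) * meanDeviation μ (g r) X) := by
    intro t ht
    rw [h2, Finset.mul_sum]
    refine Finset.sum_subset ?_ fun r _ hr => ?_
    · intro r hr
      rw [Finset.mem_range] at *
      omega
    · rw [hg.orthogonal r t (by rw [Finset.mem_range] at hr; omega)]
      simp
  rw [Finset.sum_congr rfl h3, Finset.sum_comm]
  refine Finset.sum_congr rfl fun r _ => ?_
  have h4 : ∫ y, g r y * (∑ t ∈ Finset.range s, a t * e t y) ∂μ =
      ∑ t ∈ Finset.range s, a t * ∫ y, g r y * e t y ∂μ := by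
    simp only [Finset.mul_sum]
    rw [integral_finsetSum]
    · refine Finset.sum_congr rfl fun t _ => ?_
      rw [← integral_const_mul]
      congr 1
      ext y
      ring
    · intro t _
      exact (hg.memLp r).integrable_mul ((he t).const_mul (a t))
  rw [h4, Finset.mul_sum]
  refine Finset.sum_congr rfl fun t _ => ?_
  ring

/-- The Euclidean norm of the deviations of the first `s` members of the family. -/
def deviationNorm (μ : Measure Ω) (g : ℕ → Ω → ℝ) (s : ℕ) (X : Fin n → Ω) : ℝ :=
  √(∑ t ∈ Finset.range s, meanDeviation μ (g t) X ^ 2)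

theorem abs_sum_deviation_le (s : ℕ) (X : Fin n → Ω) (c : ℕ → ℝ) :
    |∑ t ∈ Finset.range s, meanDeviation μ (g t) X * c t| ≤
      deviationNorm μ g s X * √(∑ t ∈ Finset.range s, c t ^ 2) := by
  rw [← Real.sqrt_sq_eq_abs, deviationNorm, ← Real.sqrt_mul (Finset.sum_nonneg fun _ _ => sq_nonneg _)]
  exact Real.sqrt_le_sqrt (Finset.sum_mul_sq_le_sq_mul_sq _ _ _)

/-- Jensen's inequality for the square root, read off from the nonnegativity of the variance of
`√F`. -/
theorem lintegral_ofReal_sqrt_le {Ω' : Type*} [MeasurableSpace Ω'] {P : Measure Ω'}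
    [IsProbabilityMeasure P] {F : Ω' → ℝ} (hF : Integrable F P) (hF0 : ∀ x, 0 ≤ F x) {b : ℝ}
    (hb : ∫ x, F x ∂P ≤ b) :
    ∫⁻ x, ENNReal.ofReal √(F x) ∂P ≤ ENNReal.ofReal √b := by
  have hm : AEStronglyMeasurable (fun x => √(F x)) P :=
    Real.continuous_sqrt.comp_aestronglyMeasurable hF.aestronglyMeasurable
  have h2 : MemLp (fun x => √(F x)) 2 P := by
    rw [memLp_two_iff_integrable_sq hm]
    refine hF.congr (Filter.Eventually.of_forall fun x => ?_)
    exact (Real.sq_sqrt (hF0 x)).symm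
  have h1 : Integrable (fun x => √(F x)) P := h2.integrable (by norm_num)
  rw [← ofReal_integral_eq_lintegral_ofReal h1 (Filter.Eventually.of_forall fun x =>
    Real.sqrt_nonneg _)]
  apply ENNReal.ofReal_le_ofReal
  apply Real.le_sqrt_of_sq_le
  have hv := ProbabilityTheory.variance_nonneg (fun x => √(F x)) P
  rw [ProbabilityTheory.variance_eq_sub h2] at hv
  have e1 : ∫ x, ((fun x => √(F x)) ^ 2) x ∂P = ∫ x, F x ∂P := by
    congr 1; ext x; exact Real.sq_sqrt (hF0 x)
  rw [e1] at hv
  linarith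

/-- Each of the `s` deviations has mean square at most `1 / n`, as `g t` has `L²` norm at most one.
-/
theorem IsAdaptedFamily.lintegral_deviationNorm_le (hg : IsAdaptedFamily μ e g) (hn : 0 < n)
    (s : ℕ) : ∫⁻ X, ENNReal.ofReal (deviationNorm μ g s X) ∂(Measure.pi fun _ : Fin n => μ) ≤
      ENNReal.ofReal √(s / n) := by
  have hD : ∀ t, Integrable (fun X : Fin n → Ω => meanDeviation μ (g t) X ^ 2)
      (Measure.pi fun _ : Fin n => μ) := fun t => (memLp_meanDeviation (hg.memLp t)).integrable_sq
  refine lintegral_ofReal_sqrt_le (integrable_finsetSum _ fun t _ => hD t)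
    (fun X => Finset.sum_nonneg fun _ _ => sq_nonneg _) ?_
  rw [integral_finsetSum _ fun t _ => hD t]
  have h1 : ∀ t ∈ Finset.range s, ∫ X, meanDeviation μ (g t) X ^ 2
      ∂(Measure.pi fun _ : Fin n => μ) ≤ (n : ℝ)⁻¹ := by
    intro t _
    refine (integral_meanDeviation_sq_le hn (hg.memLp t)).trans ?_
    have := hg.integral_sq_sum_le {t} fun _ => 1
    simp at this
    exact mul_le_of_le_one_right (by positivity) this
  refine (Finset.sum_le_sum h1).trans (le_of_eq ?_)
  simp [div_eq_mul_inv]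

/-- Second moment of a random sum in a Hilbert space. -/
theorem IsAdaptedFamily.lintegral_norm_sum_le (hg : IsAdaptedFamily μ e g) (hn : 0 < n)
    {K : Type*} [NormedAddCommGroup K] [InnerProductSpace ℝ K] (s : Finset ℕ) (w : ℕ → K) :
    ∫⁻ X, ENNReal.ofReal ‖∑ t ∈ s, meanDeviation μ (g t) X • w t‖
      ∂(Measure.pi fun _ : Fin n => μ) ≤ ENNReal.ofReal √((n : ℝ)⁻¹ * ∑ t ∈ s, ‖w t‖ ^ 2) := by
  -- Only finitely many vectors occur, so Parseval in an orthonormal basis of their span reduces the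
  -- second moment to those of the scalar functions `∑ ⟨b i, w t⟩ g t`, for which
  -- `integral_sq_sum_le` is available.
  set W : Submodule ℝ K := Submodule.span ℝ (w '' (s : Set ℕ)) with hW
  have : FiniteDimensional ℝ W := FiniteDimensional.span_of_finite ℝ (s.finite_toSet.image w)
  set b := stdOrthonormalBasis ℝ W
  have hwW : ∀ t ∈ s, w t ∈ W := fun t ht => Submodule.subset_span ⟨t, ht, rfl⟩
  have hnorm : ∀ v ∈ W, ‖v‖ ^ 2 = ∑ i, (inner ℝ (b i : K) v) ^ 2 := by
    intro v hv
    have := b.sum_sq_norm_inner_right ⟨v, hv⟩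
    simp only [Submodule.coe_inner, Submodule.coe_norm] at this
    rw [← this]
    exact Finset.sum_congr rfl fun i _ => by rw [Real.norm_eq_abs, sq_abs]
  have hgi : ∀ t, Integrable (g t) μ := fun t => (hg.memLp t).integrable (by norm_num)
  set h : Fin (Module.finrank ℝ W) → Ω → ℝ := fun i x => ∑ t ∈ s, inner ℝ (b i : K) (w t) * g t x
  have hh : ∀ i, MemLp (h i) 2 μ := fun i => memLp_finsetSum _ fun t _ => (hg.memLp t).const_mul _
  have hsum : ∀ X : Fin n → Ω, ‖∑ t ∈ s, meanDeviation μ (g t) X • w t‖ ^ 2 =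
      ∑ i, meanDeviation μ (h i) X ^ 2 := by
    intro X
    rw [hnorm _ (Submodule.sum_mem _ fun t ht => Submodule.smul_mem _ _ (hwW t ht))]
    refine Finset.sum_congr rfl fun i _ => ?_
    rw [meanDeviation_sum _ _ fun t _ => hgi t, inner_sum]
    congr 1
    refine Finset.sum_congr rfl fun t _ => ?_
    rw [inner_smul_right, mul_comm]
  have hD : ∀ i, Integrable (fun X : Fin n → Ω => meanDeviation μ (h i) X ^ 2)
      (Measure.pi fun _ : Fin n => μ) := fun i => (memLp_meanDeviation (hh i)).integrable_sq
  have e1 : ∀ X : Fin n → Ω, ‖∑ t ∈ s, meanDeviation μ (g t) X • w t‖ =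
      √(∑ i, meanDeviation μ (h i) X ^ 2) := fun X => by
    rw [← hsum, Real.sqrt_sq (norm_nonneg _)]
  simp only [e1]
  refine lintegral_ofReal_sqrt_le (integrable_finsetSum _ fun i _ => hD i)
    (fun X => Finset.sum_nonneg fun _ _ => sq_nonneg _) ?_
  rw [integral_finsetSum _ fun i _ => hD i]
  calc ∑ i, ∫ X, meanDeviation μ (h i) X ^ 2 ∂(Measure.pi fun _ : Fin n => μ)
      ≤ ∑ i, (n : ℝ)⁻¹ * ∑ t ∈ s, (inner ℝ (b i : K) (w t)) ^ 2 := by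
        refine Finset.sum_le_sum fun i _ => (integral_meanDeviation_sq_le hn (hh i)).trans ?_
        gcongr
        exact hg.integral_sq_sum_le s _
    _ = (n : ℝ)⁻¹ * ∑ t ∈ s, ∑ i, (inner ℝ (b i : K) (w t)) ^ 2 := by
        rw [← Finset.mul_sum, Finset.sum_comm]
    _ = _ := by
        congr 1
        exact Finset.sum_congr rfl fun t ht => (hnorm _ (hwW t ht)).symm

/-- Representation of a functional that is dominated by a Hilbert seminorm. -/
theorem exists_inner_representation {S K : Type*} [AddCommGroup S] [Module ℝ S]
    [NormedAddCommGroup K] [InnerProductSpace ℝ K] [CompleteSpace K] (A : S →ₗ[ℝ] K)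
    (l : S →ₗ[ℝ] ℝ) {c : ℝ} (hc : 0 ≤ c) (h : ∀ f, |l f| ≤ c * ‖A f‖) :
    ∃ w : K, ‖w‖ ≤ c ∧ ∀ f, l f = inner ℝ w (A f) := by
  -- The bound makes `l` vanish on the kernel of `A`, so it factors through the range, via any
  -- linear section. Hahn-Banach extends it to `K` with the same norm and Riesz represents it.
  obtain ⟨r, hr⟩ := A.rangeRestrict.exists_rightInverse_of_surjective
    (LinearMap.range_eq_top.2 A.surjective_rangeRestrict)
  have hr' : ∀ y, A (r y) = y := fun y => by
    have := LinearMap.congr_fun hr y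
    exact congrArg Subtype.val this
  set l' : LinearMap.range A →L[ℝ] ℝ := (l.comp r).mkContinuous c (fun y => by
    have := h (r y)
    rw [hr'] at this
    exact this) with hl'
  have hl'n : ‖l'‖ ≤ c := LinearMap.mkContinuous_norm_le _ hc _
  obtain ⟨G, hG, hGn⟩ := exists_extension_norm_eq _ l'
  refine ⟨(InnerProductSpace.toDual ℝ K).symm G, ?_, fun f => ?_⟩
  · rw [LinearIsometryEquiv.norm_map, hGn]; exact hl'n
  · rw [InnerProductSpace.toDual_symm_apply]
    have h1 := hG ⟨A f, LinearMap.mem_range_self A f⟩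
    simp only at h1
    rw [h1]
    change l f = l (r ⟨A f, _⟩)
    have h2 := h (f - r ⟨A f, LinearMap.mem_range_self A f⟩)
    rw [map_sub, map_sub, hr', sub_self, norm_zero, mul_zero] at h2
    exact sub_eq_zero.1 (abs_nonpos_iff.1 h2)

end orthogonal

/-! ### Chaining along linear spaces, and its Hilbert space refinement. -/

section chaining

variable {Ω : Type*} [MeasurableSpace Ω] {μ : Measure Ω} [IsProbabilityMeasure μ]
  {e g : ℕ → Ω → ℝ} {n : ℕ} {G : Set Ω}

theorem abs_meanDeviation_le_of_abs_le_on (hG : ∀ᵐ x ∂μ, x ∈ G) {h : Ω → ℝ} {c : ℝ}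
    (hc : 0 ≤ c) (hh : ∀ x ∈ G, |h x| ≤ c) {X : Fin n → Ω} (hX : ∀ i, X i ∈ G) :
    |meanDeviation μ h X| ≤ 2 * c := by
  have h1 : |∫ x, h x ∂μ| ≤ c := by
    have := norm_integral_le_of_norm_le_const (μ := μ) (f := h) (hG.mono hh)
    simpa using this
  have h2 : |(n : ℝ)⁻¹ * ∑ i, h (X i)| ≤ c := by
    rw [abs_mul, abs_of_nonneg (by positivity : (0 : ℝ) ≤ (n : ℝ)⁻¹)]
    have h3 : |∑ i, h (X i)| ≤ n * c := by
      refine (Finset.abs_sum_le_sum_abs _ _).trans ?_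
      refine (Finset.sum_le_sum fun i _ => hh _ (hX i)).trans (le_of_eq ?_)
      simp
    rcases Nat.eq_zero_or_pos n with h0 | h0
    · subst h0; simpa using hc
    · have : (0 : ℝ) < n := Nat.cast_pos.2 h0
      rw [inv_mul_le_iff₀ this]
      exact h3
  rw [meanDeviation]
  have := abs_sub (∫ x, h x ∂μ) ((n : ℝ)⁻¹ * ∑ i, h (X i))
  linarith

theorem meanDeviation_sub {h k : Ω → ℝ} (hh : Integrable h μ) (hk : Integrable k μ)
    (X : Fin n → Ω) : meanDeviation μ (fun x => h x - k x) X =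
      meanDeviation μ h X - meanDeviation μ k X := by
  simp only [meanDeviation]
  rw [integral_sub hh hk, Finset.sum_sub_distrib]
  ring

theorem integrable_mul_of_memLp_two {h k : Ω → ℝ} (hh : MemLp h 2 μ) (hk : MemLp k 2 μ) :
    Integrable (fun x => h x * k x) μ := hh.integrable_mul hk

theorem integral_sq_le_of_abs_le_on (hG : ∀ᵐ x ∂μ, x ∈ G) {h : Ω → ℝ} {c : ℝ}
    (hh : ∀ x ∈ G, |h x| ≤ c) : ∫ x, h x ^ 2 ∂μ ≤ c ^ 2 := by
  have := norm_integral_le_of_norm_le_const (μ := μ) (f := fun x => h x ^ 2) (C := c ^ 2)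
    (hG.mono fun x hx => by
      rw [Real.norm_eq_abs, abs_of_nonneg (sq_nonneg _), ← sq_abs]
      exact pow_le_pow_left₀ (abs_nonneg _) (hh x hx) 2)
  simp only [probReal_univ, mul_one] at this
  exact (le_abs_self _).trans this

/-- Cauchy-Schwarz, with Bessel's inequality for the coefficients of `h`. The random factor is free
of `h`, so the bound is uniform over all functions of a given size. -/
theorem IsAdaptedFamily.abs_sum_integral_le (hg : IsAdaptedFamily μ e g)
    (hG : ∀ᵐ x ∂μ, x ∈ G) (s : ℕ) {h : Ω → ℝ} (hm : MemLp h 2 μ) {c : ℝ} (hc : 0 ≤ c)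
    (hh : ∀ x ∈ G, |h x| ≤ c) (X : Fin n → Ω) :
    |∑ r ∈ Finset.range s, meanDeviation μ (g r) X * ∫ y, g r y * h y ∂μ| ≤
      deviationNorm μ g s X * c := by
  refine (abs_sum_deviation_le s X _).trans ?_
  refine mul_le_mul_of_nonneg_left ?_ (Real.sqrt_nonneg _)
  refine Real.sqrt_le_iff.2 ⟨hc, ?_⟩
  exact (hg.bessel _ h hm).trans (integral_sq_le_of_abs_le_on hG hh)

theorem IsAdaptedFamily.aemeasurable_meanDeviation (hg : IsAdaptedFamily μ e g) (t : ℕ) :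
    AEMeasurable (meanDeviation (n := n) μ (g t)) (Measure.pi fun _ : Fin n => μ) :=
  (memLp_meanDeviation (hg.memLp t)).aestronglyMeasurable.aemeasurable

theorem IsAdaptedFamily.aemeasurable_deviationNorm (hg : IsAdaptedFamily μ e g) (s : ℕ) :
    AEMeasurable (deviationNorm (n := n) μ g s) (Measure.pi fun _ : Fin n => μ) := by
  unfold deviationNorm
  exact (Finset.aemeasurable_fun_sum _ fun t _ =>
    (hg.aemeasurable_meanDeviation t).pow_const 2).sqrt

variable {F : Set (Ω → ℝ)} {s : ℕ → ℕ} {ε : ℕ → ℝ}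

/-- Chaining along nested linear approximation spaces. -/
theorem lintegral_iSup_meanDeviation_le (hn : 0 < n) (he : ∀ t, MemLp (e t) 2 μ)
    (hG : ∀ᵐ x ∂μ, x ∈ G) (hs : Monotone s) (hε : Antitone ε) (hε0 : ∀ j, 0 ≤ ε j)
    (hF : ∀ f ∈ F, MemLp f 2 μ ∧ ∀ x, |f x| ≤ 1)
    (happ : ∀ f ∈ F, ∀ j, ∃ a : ℕ → ℝ, ∀ x ∈ G,
      |f x - ∑ t ∈ Finset.range (s j), a t * e t x| ≤ ε j) (J : ℕ) :
    ∫⁻ X, ⨆ f ∈ F, ENNReal.ofReal |meanDeviation μ f X| ∂(Measure.pi fun _ : Fin n => μ) ≤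
      ENNReal.ofReal (2 * ε J + (1 + ε 0) * √(s 0 / n) +
        ∑ j ∈ Finset.range J, 2 * ε j * √(s (j + 1) / n)) := by
  obtain ⟨g, hg⟩ := exists_isAdaptedFamily he
  set P := Measure.pi fun _ : Fin n => μ
  set N := fun (s : ℕ) (X : Fin n → Ω) => deviationNorm μ g s X with hN
  have hN0 : ∀ s X, 0 ≤ N s X := fun s X => Real.sqrt_nonneg _
  have hpt : ∀ᵐ X ∂P, ⨆ f ∈ F, ENNReal.ofReal |meanDeviation μ f X| ≤
      ENNReal.ofReal (2 * ε J) + ENNReal.ofReal (1 + ε 0) * ENNReal.ofReal (N (s 0) X) +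
        ∑ j ∈ Finset.range J, ENNReal.ofReal (2 * ε j) * ENNReal.ofReal (N (s (j + 1)) X) := by
    filter_upwards [hg.ae_meanDeviation_eq (n := n) he, ae_sample (n := n) hG] with X hX hXG
    refine iSup₂_le fun f hf => ?_
    have hr : |meanDeviation μ f X| ≤ 2 * ε J + (1 + ε 0) * N (s 0) X +
        ∑ j ∈ Finset.range J, 2 * ε j * N (s (j + 1)) X := by
      choose a ha using happ f hf
      set T : ℕ → Ω → ℝ := fun j x => ∑ t ∈ Finset.range (s j), a j t * e t x with hT
      have hTm : ∀ j, MemLp (T j) 2 μ := fun j =>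
        memLp_finsetSum _ fun t _ => (he t).const_mul _
      have hTi : ∀ j, Integrable (T j) μ := fun j => (hTm j).integrable (by norm_num)
      have hfi : Integrable f μ := (hF f hf).1.integrable (by norm_num)
      have hcomb : ∀ (r : ℕ) (b : ℕ → ℝ) (c : ℝ), 0 ≤ c →
          (∀ x ∈ G, |∑ t ∈ Finset.range r, b t * e t x| ≤ c) →
          |meanDeviation μ (fun x => ∑ t ∈ Finset.range r, b t * e t x) X| ≤ c * N r X := by
        intro r b c hc hb
        rw [hX, mul_comm]
        exact hg.abs_sum_integral_le hG r
          (memLp_finsetSum _ fun t _ => (he t).const_mul (b t)) hc hb X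
      have h0 : |meanDeviation μ (T 0) X| ≤ (1 + ε 0) * N (s 0) X := by
        refine hcomb _ _ _ (by linarith [hε0 0]) fun x hx => ?_
        have h1 := ha 0 x hx
        have h2 := (hF f hf).2 x
        have h3 := abs_sub_abs_le_abs_sub (∑ t ∈ Finset.range (s 0), a 0 t * e t x) (f x)
        rw [abs_sub_comm] at h3
        linarith
      -- Padding the coefficients of `T j` by zero puts both approximants in the larger span. Their
      -- difference is at most `ε (j+1) + ε j ≤ 2 ε j` on `G`.
      have hstep : ∀ j, |meanDeviation μ (T (j + 1)) X - meanDeviation μ (T j) X| ≤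
          2 * ε j * N (s (j + 1)) X := by
        intro j
        have hpad : ∀ x, T j x = ∑ t ∈ Finset.range (s (j + 1)),
            (if t < s j then a j t else 0) * e t x := by
          intro x
          simp only [hT]
          rw [← Finset.sum_subset (Finset.range_mono (hs (Nat.le_succ j)))]
          · exact Finset.sum_congr rfl fun t ht => by rw [if_pos (Finset.mem_range.1 ht)]
          · intro t _ ht
            rw [if_neg (by simpa using ht), zero_mul]
        have hdiff : ∀ x, ∑ t ∈ Finset.range (s (j + 1)),
            (a (j + 1) t - if t < s j then a j t else 0) * e t x = T (j + 1) x - T j x := by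
          intro x
          rw [hpad x]
          simp only [sub_mul, Finset.sum_sub_distrib, hT]
        have h1 := hcomb (s (j + 1)) (fun t => a (j + 1) t - if t < s j then a j t else 0)
          (2 * ε j) (by linarith [hε0 j]) (fun x hx => by
            rw [hdiff]
            have h1 := abs_le.1 (ha j x hx)
            have h2 := abs_le.1 (ha (j + 1) x hx)
            have h3 := hε (Nat.le_succ j)
            simp only [hT]
            exact abs_le.2 ⟨by linarith, by linarith⟩)
        simp only [hdiff] at h1
        rw [meanDeviation_sub (hTi _) (hTi j)] at h1
        exact h1
      have htel : ∀ k, |meanDeviation μ (T k) X| ≤ (1 + ε 0) * N (s 0) X +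
          ∑ j ∈ Finset.range k, 2 * ε j * N (s (j + 1)) X := by
        intro k
        induction k with
        | zero => simpa using h0
        | succ k ih =>
          rw [Finset.sum_range_succ]
          have h1 := abs_sub_abs_le_abs_sub (meanDeviation μ (T (k + 1)) X)
            (meanDeviation μ (T k) X)
          have h2 := hstep k
          linarith
      have hrest : |meanDeviation μ (fun x => f x - T J x) X| ≤ 2 * ε J :=
        abs_meanDeviation_le_of_abs_le_on hG (hε0 J) (fun x hx => ha J x hx) hXG
      have hsplit : meanDeviation μ f X =
          meanDeviation μ (fun x => f x - T J x) X + meanDeviation μ (T J) X := by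
        rw [meanDeviation_sub hfi (hTi J)]
        ring
      rw [hsplit]
      have h1 := abs_add_le (meanDeviation μ (fun x => f x - T J x) X) (meanDeviation μ (T J) X)
      have h2 := htel J
      linarith
    refine (ENNReal.ofReal_le_ofReal hr).trans (le_of_eq ?_)
    have hp1 : 0 ≤ (1 + ε 0) * N (s 0) X := mul_nonneg (by linarith [hε0 0]) (hN0 _ _)
    have hp2 : ∀ j, 0 ≤ 2 * ε j * N (s (j + 1)) X := fun j =>
      mul_nonneg (by linarith [hε0 j]) (hN0 _ _)
    have hp3 := hε0 J
    rw [ENNReal.ofReal_add (by linarith) (Finset.sum_nonneg fun j _ => hp2 j),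
      ENNReal.ofReal_add (by linarith) hp1, ENNReal.ofReal_mul (p := 1 + ε 0) (by linarith [hε0 0]),
      ENNReal.ofReal_sum_of_nonneg fun j _ => hp2 j]
    congr 1
    exact Finset.sum_congr rfl fun j _ => ENNReal.ofReal_mul (p := 2 * ε j) (by linarith [hε0 j])
  refine (lintegral_mono_ae hpt).trans ?_
  have hm : ∀ r, AEMeasurable (fun X => ENNReal.ofReal (N r X)) P := fun r =>
    (hg.aemeasurable_deviationNorm r).ennreal_ofReal
  have hNint : ∀ r, ∫⁻ X, ENNReal.ofReal (N r X) ∂P ≤ ENNReal.ofReal √(r / n) := fun r =>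
    hg.lintegral_deviationNorm_le hn r
  rw [lintegral_add_left' (f := fun X => ENNReal.ofReal (2 * ε J) +
      ENNReal.ofReal (1 + ε 0) * ENNReal.ofReal (N (s 0) X))
      ((aemeasurable_const).add ((hm _).const_mul _)),
    lintegral_add_left' aemeasurable_const, lintegral_const, measure_univ, mul_one,
    lintegral_const_mul' _ _ ENNReal.ofReal_ne_top,
    lintegral_finsetSum' _ fun j _ => (hm _).const_mul _]
  have hp1 : 0 ≤ (1 + ε 0) * √(s 0 / n) := mul_nonneg (by linarith [hε0 0]) (Real.sqrt_nonneg _)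
  have hp2 : ∀ j, 0 ≤ 2 * ε j * √(s (j + 1) / n) := fun j =>
    mul_nonneg (by linarith [hε0 j]) (Real.sqrt_nonneg _)
  have hp3 := hε0 J
  rw [ENNReal.ofReal_add (by linarith) (Finset.sum_nonneg fun j _ => hp2 j),
    ENNReal.ofReal_add (by linarith) hp1, ENNReal.ofReal_mul (p := 1 + ε 0) (by linarith [hε0 0]),
    ENNReal.ofReal_sum_of_nonneg fun j _ => hp2 j]
  gcongr with j _
  · exact hNint _
  · rw [lintegral_const_mul' _ _ ENNReal.ofReal_ne_top,
      ENNReal.ofReal_mul (p := 2 * ε j) (by linarith [hε0 j])]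
    gcongr
    exact hNint _

/-- A refinement of chaining for classes that are bounded in a Hilbert seminorm. -/
theorem lintegral_iSup_meanDeviation_le_of_hilbert (hn : 0 < n) (he : ∀ t, MemLp (e t) 2 μ)
    (hG : ∀ᵐ x ∂μ, x ∈ G) (hs : Monotone s) (hε0 : ∀ j, 0 ≤ ε j)
    (hF : ∀ f ∈ F, MemLp f 2 μ ∧ ∀ x, |f x| ≤ 1)
    (happ : ∀ f ∈ F, ∀ j, ∃ a : ℕ → ℝ, ∀ x ∈ G,
      |f x - ∑ t ∈ Finset.range (s j), a t * e t x| ≤ ε j)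
    {K : Type*} [NormedAddCommGroup K] [InnerProductSpace ℝ K] [CompleteSpace K]
    (S : Submodule ℝ (Ω → ℝ)) (A : S →ₗ[ℝ] K) {B : ℝ} (hB : 0 ≤ B)
    (hS : ∀ f ∈ S, MemLp f 2 μ) (hFS : ∀ f ∈ F, ∃ hf : f ∈ S, ‖A ⟨f, hf⟩‖ ≤ B)
    {δ : ℕ → ℝ} (hδ : Antitone δ) (hδ0 : ∀ j, 0 ≤ δ j)
    (happ2 : ∀ f : S, ∀ j, ∃ a : ℕ → ℝ,
      ∫ x, ((f : Ω → ℝ) x - ∑ t ∈ Finset.range (s j), a t * e t x) ^ 2 ∂μ ≤ (δ j * ‖A f‖) ^ 2)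
    (J : ℕ) :
    ∫⁻ X, ⨆ f ∈ F, ENNReal.ofReal |meanDeviation μ f X| ∂(Measure.pi fun _ : Fin n => μ) ≤
      ENNReal.ofReal (2 * ε J + ε J * √(s J / n) + √(s 0 / n) +
        B * √((n : ℝ)⁻¹ * ∑ j ∈ Finset.range J, (s (j + 1) - s j) * δ j ^ 2)) := by
  obtain ⟨g, hg⟩ := exists_isAdaptedFamily he
  set P := Measure.pi fun _ : Fin n => μ
  set N := fun (s : ℕ) (X : Fin n → Ω) => deviationNorm μ g s X with hN
  have hN0 : ∀ s X, 0 ≤ N s X := fun s X => Real.sqrt_nonneg _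
  -- For `t ≥ s j` the function `g t` is orthogonal to the whole space of level `j`, so `f` may be
  -- replaced by its approximation error, and Bessel's inequality is applied to `g t` alone.
  have hcoef : ∀ t, ∀ f : S, ∀ j, s j ≤ t → |∫ y, g t y * (f : Ω → ℝ) y ∂μ| ≤ δ j * ‖A f‖ := by
    intro t f j hj
    obtain ⟨a, ha⟩ := happ2 f j
    have hm : MemLp (fun x => ∑ r ∈ Finset.range (s j), a r * e r x) 2 μ :=
      memLp_finsetSum _ fun r _ => (he r).const_mul _
    have h0 : ∫ y, g t y * (∑ r ∈ Finset.range (s j), a r * e r y) ∂μ = 0 := by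
      simp only [Finset.mul_sum]
      rw [integral_finsetSum _ fun r _ => integrable_mul_of_memLp_two (hg.memLp t) ((he r).const_mul (a r))]
      refine Finset.sum_eq_zero fun r hr => ?_
      have h1 := hg.orthogonal t r (by rw [Finset.mem_range] at hr; omega)
      calc ∫ y, g t y * (a r * e r y) ∂μ = ∫ y, a r * (g t y * e r y) ∂μ := by
            congr 1; ext y; ring
        _ = 0 := by rw [integral_const_mul, h1, mul_zero]
    have h1 : ∫ y, g t y * (f : Ω → ℝ) y ∂μ =
        ∫ y, g t y * ((f : Ω → ℝ) y - ∑ r ∈ Finset.range (s j), a r * e r y) ∂μ := by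
      simp only [mul_sub]
      rw [integral_sub (integrable_mul_of_memLp_two (hg.memLp t) (hS f f.2)) (integrable_mul_of_memLp_two (hg.memLp t) hm),
        h0, sub_zero]
    have h2 := hg.bessel {t} _ ((hS f f.2).sub hm)
    rw [Finset.sum_singleton] at h2
    rw [h1]
    exact abs_le_of_sq_le_sq (h2.trans ha) (mul_nonneg (hδ0 j) (norm_nonneg _))
  have hrep : ∀ t, ∃ w : K, (∀ j, j ≤ J → s j ≤ t → ‖w‖ ≤ δ j) ∧
      (s 0 ≤ t → ∀ f : S, ∫ y, g t y * (f : Ω → ℝ) y ∂μ = inner ℝ w (A f)) := by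
    intro t
    by_cases ht : s 0 ≤ t
    · set j₀ := Nat.findGreatest (fun j => s j ≤ t) J
      have hj₀ : s j₀ ≤ t := Nat.findGreatest_spec (P := fun j => s j ≤ t) (Nat.zero_le J) ht
      let l : S →ₗ[ℝ] ℝ :=
        { toFun := fun f => ∫ y, g t y * (f : Ω → ℝ) y ∂μ
          map_add' := fun f k => by
            rw [← integral_add (integrable_mul_of_memLp_two (hg.memLp t) (hS f f.2))
              (integrable_mul_of_memLp_two (hg.memLp t) (hS k k.2))]
            congr 1; ext y; simp [mul_add]
          map_smul' := fun c f => by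
            rw [RingHom.id_apply, smul_eq_mul, ← integral_const_mul]
            congr 1; ext y; simp; ring }
      obtain ⟨w, hw, hw'⟩ := exists_inner_representation A l (hδ0 j₀)
        fun f => hcoef t f j₀ hj₀
      refine ⟨w, fun j hj hjt => hw.trans (hδ (Nat.le_findGreatest hj hjt)), fun _ f => hw' f⟩
    · refine ⟨0, fun j _ hj => absurd ((hs (Nat.zero_le j)).trans hj) ht, fun h => absurd h ht⟩
  choose w hw hw' using hrep
  set V := fun X : Fin n → Ω => ‖∑ t ∈ Finset.Ico (s 0) (s J), meanDeviation μ (g t) X • w t‖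
    with hV
  have hpt : ∀ᵐ X ∂P, ⨆ f ∈ F, ENNReal.ofReal |meanDeviation μ f X| ≤
      ENNReal.ofReal (2 * ε J) + ENNReal.ofReal (ε J) * ENNReal.ofReal (N (s J) X) +
        ENNReal.ofReal (N (s 0) X) + ENNReal.ofReal B * ENNReal.ofReal (V X) := by
    filter_upwards [hg.ae_meanDeviation_eq (n := n) he, ae_sample (n := n) hG] with X hX hXG
    refine iSup₂_le fun f hf => ?_
    have hr : |meanDeviation μ f X| ≤ 2 * ε J + ε J * N (s J) X + N (s 0) X + B * V X := by
      obtain ⟨a, ha⟩ := happ f hf J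
      set T : Ω → ℝ := fun x => ∑ t ∈ Finset.range (s J), a t * e t x with hT
      have hTm : MemLp T 2 μ := memLp_finsetSum _ fun t _ => (he t).const_mul _
      have hTi : Integrable T μ := hTm.integrable (by norm_num)
      have hfm := (hF f hf).1
      have hfi : Integrable f μ := hfm.integrable (by norm_num)
      obtain ⟨hfS, hfB⟩ := hFS f hf
      have h1 : |meanDeviation μ (fun x => f x - T x) X| ≤ 2 * ε J :=
        abs_meanDeviation_le_of_abs_le_on hG (hε0 J) ha hXG
      have h2 : meanDeviation μ f X =
          meanDeviation μ (fun x => f x - T x) X + meanDeviation μ T X := by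
        rw [meanDeviation_sub hfi hTi]
        ring
      -- The coefficients of `T` are traded for those of `f`, on which the Hilbert seminorm acts;
      -- the difference costs only the uniform error at the finest level.
      have h3 : meanDeviation μ T X =
          (∑ r ∈ Finset.range (s J), meanDeviation μ (g r) X * ∫ y, g r y * f y ∂μ) -
          ∑ r ∈ Finset.range (s J), meanDeviation μ (g r) X * ∫ y, g r y * (f y - T y) ∂μ := by
        rw [hT, hX, ← Finset.sum_sub_distrib]
        refine Finset.sum_congr rfl fun r _ => ?_
        simp only [mul_sub]
        rw [integral_sub (integrable_mul_of_memLp_two (hg.memLp r) hfm) (integrable_mul_of_memLp_two (hg.memLp r) hTm)]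
        ring
      have h4 : |∑ r ∈ Finset.range (s J),
          meanDeviation μ (g r) X * ∫ y, g r y * (f y - T y) ∂μ| ≤ N (s J) X * ε J :=
        hg.abs_sum_integral_le hG (s J) (hfm.sub hTm) (hε0 J) ha X
      have h5 : |∑ r ∈ Finset.range (s 0),
          meanDeviation μ (g r) X * ∫ y, g r y * f y ∂μ| ≤ N (s 0) X * 1 :=
        hg.abs_sum_integral_le hG (s 0) hfm zero_le_one (fun x _ => (hF f hf).2 x) X
      -- Here sample and function separate: the sum is the inner product of a random vector that
      -- does not involve `f` with `A f`, whose norm is at most `B`.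
      have h6 : |∑ r ∈ Finset.Ico (s 0) (s J),
          meanDeviation μ (g r) X * ∫ y, g r y * f y ∂μ| ≤ V X * B := by
        have : ∑ r ∈ Finset.Ico (s 0) (s J), meanDeviation μ (g r) X * ∫ y, g r y * f y ∂μ =
            inner ℝ (∑ t ∈ Finset.Ico (s 0) (s J), meanDeviation μ (g t) X • w t)
              (A ⟨f, hfS⟩) := by
          rw [sum_inner]
          refine Finset.sum_congr rfl fun r hr => ?_
          rw [inner_smul_left, ← hw' r (Finset.mem_Ico.1 hr).1 ⟨f, hfS⟩]
          simp
        rw [this]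
        exact (abs_real_inner_le_norm _ _).trans
          (mul_le_mul_of_nonneg_left hfB (norm_nonneg _))
      have h7 := Finset.sum_range_add_sum_Ico
        (fun r => meanDeviation μ (g r) X * ∫ y, g r y * f y ∂μ) (hs (Nat.zero_le J))
      have h1' := abs_le.1 h1
      have h4' := abs_le.1 h4
      have h5' := abs_le.1 h5
      have h6' := abs_le.1 h6
      rw [h2, h3, ← h7]
      exact abs_le.2 ⟨by nlinarith, by nlinarith⟩
    refine (ENNReal.ofReal_le_ofReal hr).trans (le_of_eq ?_)
    have hp1 := hε0 J
    have hp2 := mul_nonneg hp1 (hN0 (s J) X)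
    have hp3 := hN0 (s 0) X
    have hp4 : 0 ≤ B * V X := mul_nonneg hB (norm_nonneg _)
    rw [ENNReal.ofReal_add (by linarith) hp4, ENNReal.ofReal_add (by linarith) hp3,
      ENNReal.ofReal_add (by linarith) hp2, ENNReal.ofReal_mul (p := ε J) hp1, ENNReal.ofReal_mul (p := B) hB]
  refine (lintegral_mono_ae hpt).trans ?_
  have hm : ∀ r, AEMeasurable (fun X => ENNReal.ofReal (N r X)) P := fun r =>
    (hg.aemeasurable_deviationNorm r).ennreal_ofReal
  have hNint : ∀ r, ∫⁻ X, ENNReal.ofReal (N r X) ∂P ≤ ENNReal.ofReal √(r / n) := fun r =>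
    hg.lintegral_deviationNorm_le hn r
  have hVint : ∫⁻ X, ENNReal.ofReal (V X) ∂P ≤ ENNReal.ofReal
      √((n : ℝ)⁻¹ * ∑ j ∈ Finset.range J, (s (j + 1) - s j) * δ j ^ 2) := by
    refine (hg.lintegral_norm_sum_le hn _ w).trans
      (ENNReal.ofReal_le_ofReal (Real.sqrt_le_sqrt ?_))
    refine mul_le_mul_of_nonneg_left ?_ (by positivity)
    -- Block by block: for `t` between `s k` and `s (k+1)` the vector `w t` has norm at most `δ k`.
    have : ∀ k ≤ J, ∑ t ∈ Finset.Ico (s 0) (s k), ‖w t‖ ^ 2 ≤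
        ∑ j ∈ Finset.range k, ((s (j + 1) : ℝ) - s j) * δ j ^ 2 := by
      intro k hk
      induction k with
      | zero => simp
      | succ k ih =>
        rw [← Finset.sum_Ico_consecutive _ (hs (Nat.zero_le k)) (hs (Nat.le_succ k)),
          Finset.sum_range_succ]
        refine add_le_add (ih (by omega)) ?_
        refine (Finset.sum_le_sum fun t ht => pow_le_pow_left₀ (norm_nonneg _)
          (hw t k (by omega) (Finset.mem_Ico.1 ht).1) 2).trans (le_of_eq ?_)
        rw [Finset.sum_const, Nat.card_Ico, nsmul_eq_mul, Nat.cast_sub (hs (Nat.le_succ k))]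
    exact this J le_rfl
  rw [lintegral_add_left' (f := fun X => ENNReal.ofReal (2 * ε J) +
      ENNReal.ofReal (ε J) * ENNReal.ofReal (N (s J) X) + ENNReal.ofReal (N (s 0) X))
      (((aemeasurable_const).add ((hm _).const_mul _)).add (hm _)),
    lintegral_add_left' (f := fun X => ENNReal.ofReal (2 * ε J) +
      ENNReal.ofReal (ε J) * ENNReal.ofReal (N (s J) X))
      ((aemeasurable_const).add ((hm _).const_mul _)),
    lintegral_add_left' aemeasurable_const, lintegral_const, measure_univ, mul_one,
    lintegral_const_mul' _ _ ENNReal.ofReal_ne_top,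
    lintegral_const_mul' _ _ ENNReal.ofReal_ne_top]
  have hp1 := hε0 J
  have hp2 := mul_nonneg hp1 (Real.sqrt_nonneg (s J / n))
  have hp3 := Real.sqrt_nonneg ((s 0 : ℝ) / n)
  have hp4 := mul_nonneg hB (Real.sqrt_nonneg
    ((n : ℝ)⁻¹ * ∑ j ∈ Finset.range J, ((s (j + 1) : ℝ) - s j) * δ j ^ 2))
  rw [ENNReal.ofReal_add (by linarith) hp4, ENNReal.ofReal_add (by linarith) hp3,
    ENNReal.ofReal_add (by linarith) hp2, ENNReal.ofReal_mul (p := ε J) hp1, ENNReal.ofReal_mul (p := B) hB]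
  gcongr
  · exact hNint _
  · exact hNint _

end chaining

/-! ### Dyadic cells and piecewise polynomial spaces. -/

section cells

/-- Finite families of functions, indexed by levels, in one sequence. -/
theorem exists_enumeration {Ω : Type*} (I : ℕ → Type) [∀ j, Fintype (I j)]
    (u : ∀ j, I j → Ω → ℝ) (P : (Ω → ℝ) → Prop) (h0 : P 0) (hu : ∀ j i, P (u j i)) :
    ∃ e : ℕ → Ω → ℝ, (∀ t, P (e t)) ∧ ∀ j (c : I j → ℝ), ∃ a : ℕ → ℝ, ∀ x,
      ∑ t ∈ Finset.range (∑ i ∈ Finset.range (j + 1), Fintype.card (I i)), a t * e t x =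
        ∑ i, c i * u j i x := by
  classical
  set s : ℕ → ℕ := fun j => ∑ i ∈ Finset.range j, Fintype.card (I i) with hs
  have hsm : Monotone s := fun a b hab =>
    Finset.sum_le_sum_of_subset (Finset.range_mono hab)
  have hss : ∀ j, s (j + 1) = s j + Fintype.card (I j) := fun j => Finset.sum_range_succ _ _
  set pos : (Σ j, Fin (Fintype.card (I j))) → ℕ := fun q => s q.1 + q.2 with hpos
  have hlt : ∀ q r : Σ j, Fin (Fintype.card (I j)), q.1 < r.1 → pos q < pos r := by
    intro q r hqr
    have h1 := hsm (Nat.succ_le_of_lt hqr)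
    have h2 := hss q.1
    have h3 := q.2.2
    simp only [hpos]
    simp only [Nat.succ_eq_add_one] at h1
    omega
  have hinj : Function.Injective pos := by
    rintro ⟨j, p⟩ ⟨j', p'⟩ h
    rcases lt_trichotomy j j' with h1 | h1 | h1
    · exact absurd h (hlt ⟨j, p⟩ ⟨j', p'⟩ h1).ne
    · subst h1
      simp only [hpos, add_right_inj] at h
      rw [Fin.ext h]
    · exact absurd h (hlt ⟨j', p'⟩ ⟨j, p⟩ h1).ne'
  set v : (Σ j, Fin (Fintype.card (I j))) → Ω → ℝ := fun q =>
    u q.1 ((Fintype.equivFin (I q.1)).symm q.2) with hv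
  -- Empty levels may leave `pos` non-surjective; the remaining places are filled with the zero
  -- function, which is where `h0` enters.
  refine ⟨Function.extend pos v fun _ => 0, fun t => ?_, fun j c => ?_⟩
  · by_cases ht : ∃ q, pos q = t
    · obtain ⟨q, rfl⟩ := ht
      rw [hinj.extend_apply]
      exact hu _ _
    · rw [Function.extend_apply' _ _ _ ht]
      exact h0
  · refine ⟨fun t => if h : s j ≤ t ∧ t - s j < Fintype.card (I j) then
      c ((Fintype.equivFin (I j)).symm ⟨t - s j, h.2⟩) else 0, fun x => ?_⟩
    change ∑ t ∈ Finset.range (s (j + 1)), _ = _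
    rw [hss, Finset.sum_range_add, Finset.sum_eq_zero, zero_add, Finset.sum_range,
      ← (Fintype.equivFin (I j)).symm.sum_comp]
    · refine Finset.sum_congr rfl fun p _ => ?_
      have e1 : s j + (p : ℕ) = pos ⟨j, p⟩ := rfl
      have e2 : s j ≤ s j + (p : ℕ) ∧ s j + (p : ℕ) - s j < Fintype.card (I j) :=
        ⟨by omega, by have := p.2; omega⟩
      dsimp only
      have e3 : Function.extend pos v (fun _ => 0) (s j + (p : ℕ)) = v ⟨j, p⟩ := by
        rw [e1, hinj.extend_apply]
      rw [dif_pos e2, e3]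
      simp [hv]
    · intro t ht
      dsimp only
      rw [dif_neg, zero_mul]
      rw [Finset.mem_range] at ht
      omega

variable {d D : ℕ}

/-- The part of a ball in a half-open cube of side `2ρ/2^j`. -/
def ballCell (ρ : ℝ) (z : EuclideanSpace ℝ (Fin d)) (j : ℕ) (κ : Fin d → Fin (2 ^ j)) :
    Set (EuclideanSpace ℝ (Fin d)) :=
  {w | w ∈ Metric.ball z ρ ∧ ∀ k, (κ k : ℝ) * (2 * ρ / 2 ^ j) ≤ w k - z k + ρ ∧
    w k - z k + ρ < ((κ k : ℝ) + 1) * (2 * ρ / 2 ^ j)}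

variable {ρ : ℝ} {z : EuclideanSpace ℝ (Fin d)} {j : ℕ}

theorem ballCell_subset (κ : Fin d → Fin (2 ^ j)) : ballCell ρ z j κ ⊆ Metric.ball z ρ :=
  fun _ hw => hw.1

theorem measurableSet_ballCell (κ : Fin d → Fin (2 ^ j)) : MeasurableSet (ballCell ρ z j κ) := by
  refine Metric.isOpen_ball.measurableSet.inter ?_
  have : {w : EuclideanSpace ℝ (Fin d) | ∀ k, (κ k : ℝ) * (2 * ρ / 2 ^ j) ≤ w k - z k + ρ ∧
      w k - z k + ρ < ((κ k : ℝ) + 1) * (2 * ρ / 2 ^ j)} =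
      ⋂ k, {w | (κ k : ℝ) * (2 * ρ / 2 ^ j) ≤ w k - z k + ρ} ∩
        {w | w k - z k + ρ < ((κ k : ℝ) + 1) * (2 * ρ / 2 ^ j)} := by
    ext w
    simp [Set.mem_iInter]
  change MeasurableSet {w : EuclideanSpace ℝ (Fin d) | _}
  rw [this]
  refine MeasurableSet.iInter fun k => ?_
  refine (measurableSet_le measurable_const (by fun_prop)).inter
    (measurableSet_lt (by fun_prop) measurable_const)

theorem convex_ballCell (κ : Fin d → Fin (2 ^ j)) : Convex ℝ (ballCell ρ z j κ) := by
  intro w hw w' hw' a b ha hb hab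
  refine ⟨convex_ball z ρ hw.1 hw'.1 ha hb hab, fun k => ?_⟩
  obtain ⟨h1, h2⟩ := hw.2 k
  obtain ⟨h3, h4⟩ := hw'.2 k
  have e : (a • w + b • w') k - z k + ρ = a * (w k - z k + ρ) + b * (w' k - z k + ρ) := by
    simp only [PiLp.add_apply, PiLp.smul_apply, smul_eq_mul]
    linear_combination (z k - ρ) * hab
  rw [e]
  set A := (κ k : ℝ) * (2 * ρ / 2 ^ j)
  set B := ((κ k : ℝ) + 1) * (2 * ρ / 2 ^ j)
  have := (convex_Ico A B) (Set.mem_Ico.2 ⟨h1, h2⟩) (Set.mem_Ico.2 ⟨h3, h4⟩) ha hb hab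
  exact this

theorem norm_sub_le_of_mem_ballCell {κ : Fin d → Fin (2 ^ j)} {w w' : EuclideanSpace ℝ (Fin d)}
    (hw : w ∈ ballCell ρ z j κ) (hw' : w' ∈ ballCell ρ z j κ) :
    ‖w - w'‖ ≤ d * (2 * ρ / 2 ^ j) := by
  refine euclidean_norm_le_of_abs_le fun k => ?_
  obtain ⟨h1, h2⟩ := hw.2 k
  obtain ⟨h3, h4⟩ := hw'.2 k
  rw [PiLp.sub_apply]
  exact abs_le.2 ⟨by linarith, by linarith⟩

theorem exists_mem_ballCell (hρ : 0 < ρ) {w : EuclideanSpace ℝ (Fin d)} (hw : w ∈ Metric.ball z ρ)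
    (j : ℕ) : ∃ κ, w ∈ ballCell ρ z j κ := by
  have hh : 0 < 2 * ρ / 2 ^ j := by positivity
  have habs : ∀ k, |w k - z k| < ρ := fun k =>
    (PiLp.norm_apply_le (w - z) k).trans_lt (mem_ball_iff_norm.1 hw)
  have hlt : ∀ k, ⌊(w k - z k + ρ) / (2 * ρ / 2 ^ j)⌋₊ < 2 ^ j := by
    intro k
    have := abs_lt.1 (habs k)
    rw [Nat.floor_lt (by apply div_nonneg _ hh.le; linarith)]
    rw [div_lt_iff₀ hh]
    push_cast
    rw [mul_div_cancel₀ _ (by positivity)]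
    linarith
  refine ⟨fun k => ⟨_, hlt k⟩, hw, fun k => ?_⟩
  have := abs_lt.1 (habs k)
  have h0 : 0 ≤ (w k - z k + ρ) / (2 * ρ / 2 ^ j) := by apply div_nonneg _ hh.le; linarith
  exact ⟨(le_div_iff₀ hh).1 (Nat.floor_le h0), (div_lt_iff₀ hh).1 (Nat.lt_floor_add_one _)⟩

theorem eq_of_mem_ballCell {κ κ' : Fin d → Fin (2 ^ j)} (hρ : 0 < ρ)
    {w : EuclideanSpace ℝ (Fin d)} (hw : w ∈ ballCell ρ z j κ) (hw' : w ∈ ballCell ρ z j κ') :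
    κ = κ' := by
  have hh : 0 < 2 * ρ / 2 ^ j := by positivity
  funext k
  obtain ⟨h1, h2⟩ := hw.2 k
  obtain ⟨h3, h4⟩ := hw'.2 k
  have h5 := lt_of_mul_lt_mul_right (h1.trans_lt h4) hh.le
  have h6 := lt_of_mul_lt_mul_right (h3.trans_lt h2) hh.le
  have h7 : (κ k : ℕ) < κ' k + 1 := by exact_mod_cast h5
  have h8 : (κ' k : ℕ) < κ k + 1 := by exact_mod_cast h6
  exact Fin.ext (by omega)

/-- Piecewise polynomial functions on the images of the cells, as linear combinations of the
members of one sequence. -/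
theorem exists_piecewise_family {C ρ : ℝ} (hC : 0 < C) (hρ : 0 < ρ) (hd : 1 ≤ d)
    {μ : Measure (EuclideanSpace ℝ (Fin D))} [IsProbabilityMeasure μ] {N : ℕ}
    {ψ : Fin N → EuclideanSpace ℝ (Fin d) → EuclideanSpace ℝ (Fin D)}
    {z : Fin N → EuclideanSpace ℝ (Fin d)} (h : ∀ i, IsChartBall C ρ μ (ψ i) (z i)) (m : ℕ) :
    ∃ (e : ℕ → EuclideanSpace ℝ (Fin D) → ℝ) (s : ℕ → ℕ), (∀ t, MemLp (e t) 2 μ) ∧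
      Monotone s ∧ (∀ j, s j ≤ 2 * (N * m ^ D) * (2 ^ j) ^ d) ∧
      ∀ j, ∀ a : Fin N → (Fin d → Fin (2 ^ j)) → (Fin D → Fin m) → ℝ, ∃ b : ℕ → ℝ,
        ∀ x ∈ ⋃ i, ψ i '' Metric.ball (z i) ρ, ∃ i κ, x ∈ ψ i '' ballCell ρ (z i) j κ ∧
          ∑ t ∈ Finset.range (s j), b t * e t x = ∑ l, a i κ l * monomialFun l x := by
  classical
  let I : ℕ → Type := fun j => Fin N × (Fin d → Fin (2 ^ j)) × (Fin D → Fin m)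
  set W : Fin N → Set (EuclideanSpace ℝ (Fin D)) := fun i => ψ i '' Metric.ball (z i) ρ with hW
  have hWm : ∀ i, MeasurableSet (W i) := fun i =>
    (h i).measurableSet_image subset_rfl Metric.isOpen_ball.measurableSet
  -- Removing the images of earlier charts makes the pieces of one level disjoint, so exactly one
  -- polynomial is active at each covered point, although the chart images overlap.
  set S : ∀ j, Fin N → (Fin d → Fin (2 ^ j)) → Set (EuclideanSpace ℝ (Fin D)) := fun j i κ =>
    ψ i '' ballCell ρ (z i) j κ ∩ (⋃ i' < i, W i')ᶜ with hS
  have hSm : ∀ j i κ, MeasurableSet (S j i κ) := fun j i κ =>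
    ((h i).measurableSet_image (ballCell_subset κ) (measurableSet_ballCell κ)).inter
      (MeasurableSet.biUnion (Set.to_countable _) fun i' _ => hWm i').compl
  set u : ∀ j, I j → EuclideanSpace ℝ (Fin D) → ℝ := fun j q =>
    (S j q.1 q.2.1).indicator (monomialFun q.2.2) with hu
  have hum : ∀ j q, MemLp (u j q) 2 μ := by
    intro j q
    have hbd : Bornology.IsBounded (W q.1) := by
      rw [Metric.isBounded_iff_subset_closedBall (ψ q.1 (z q.1))]
      refine ⟨C * ρ, ?_⟩
      rintro _ ⟨w, hw, rfl⟩
      rw [mem_closedBall_iff_norm]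
      refine ((h q.1).lipschitz hw (Metric.mem_ball_self hρ)).trans ?_
      exact mul_le_mul_of_nonneg_left (mem_ball_iff_norm.1 hw).le hC.le
    obtain ⟨B, hB⟩ := (hbd.isCompact_closure.image (continuous_monomialFun q.2.2)).isBounded
      |>.exists_norm_le
    refine MemLp.of_bound ((continuous_monomialFun q.2.2).measurable.indicator
      (hSm j q.1 q.2.1)).aestronglyMeasurable (max B 0) (Filter.Eventually.of_forall fun x => ?_)
    simp only [hu]
    by_cases hx : x ∈ S j q.1 q.2.1
    · rw [Set.indicator_of_mem hx]
      refine (hB _ ⟨x, subset_closure ?_, rfl⟩).trans (le_max_left _ _)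
      exact Set.image_mono (ballCell_subset q.2.1) hx.1
    · rw [Set.indicator_of_notMem hx, norm_zero]
      exact le_max_right _ _
  obtain ⟨e, he, hexp⟩ := exists_enumeration I u (fun f => MemLp f 2 μ) MemLp.zero hum
  refine ⟨e, fun j => ∑ i ∈ Finset.range (j + 1), Fintype.card (I i), he, ?_, fun j => ?_,
    fun j a => ?_⟩
  · exact fun a b hab => Finset.sum_le_sum_of_subset (Finset.range_mono (by omega))
  · have hcard : ∀ i, Fintype.card (I i) = N * m ^ D * (2 ^ i) ^ d := by
      intro i
      simp only [I, Fintype.card_prod, Fintype.card_fin, Fintype.card_fun]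
      ring
    simp only [hcard]
    induction j with
    | zero => simp; omega
    | succ j ih =>
      rw [Finset.sum_range_succ]
      -- As `d ≥ 1`, the number of cells at least doubles from level to level; hence all levels up
      -- to `j` together have at most twice the size of level `j`.
      have h2 : 2 * (2 ^ j) ^ d ≤ (2 ^ (j + 1)) ^ d := by
        rw [pow_succ, mul_pow, mul_comm]
        exact Nat.mul_le_mul_left _ (by simpa using Nat.pow_le_pow_right (by norm_num) hd)
      nlinarith [Nat.zero_le (N * m ^ D)]
  · obtain ⟨b, hb⟩ := hexp j fun q => a q.1 q.2.1 q.2.2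
    refine ⟨b, fun x hx => ?_⟩
    have hex : ∃ i : Fin N, x ∈ W i := Set.mem_iUnion.1 hx
    obtain ⟨i, hi, hmin⟩ : ∃ i : Fin N, x ∈ W i ∧ ∀ i' < i, x ∉ W i' := by
      have hne : (Finset.univ.filter fun i => x ∈ W i).Nonempty := by
        obtain ⟨i, hi⟩ := hex
        exact ⟨i, by simpa using hi⟩
      refine ⟨Finset.min' _ hne, ?_, fun i' hi' hx' => ?_⟩
      · simpa using Finset.min'_mem _ hne
      · exact absurd (Finset.min'_le _ i' (by simpa using hx')) (not_le.2 hi')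
    obtain ⟨w, hw, hwx⟩ := hi
    obtain ⟨κ, hκ⟩ := exists_mem_ballCell hρ hw j
    refine ⟨i, κ, ⟨w, hκ, hwx⟩, ?_⟩
    have hxS : x ∈ S j i κ := ⟨⟨w, hκ, hwx⟩, by simpa using hmin⟩
    have huniq : ∀ i' κ', x ∈ S j i' κ' → i' = i ∧ κ' = κ := by
      rintro i' κ' ⟨⟨w', hw', hwx'⟩, hn'⟩
      have hi' : i' = i := by
        rcases lt_trichotomy i' i with h1 | h1 | h1
        · exact absurd ⟨w', hw'.1, hwx'⟩ (hmin i' h1)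
        · exact h1
        · exfalso
          apply hn'
          simp only [Set.mem_iUnion]
          exact ⟨i, h1, w, hw, hwx⟩
      subst hi'
      have : w' = w := (h i').injOn hw'.1 hw (hwx'.trans hwx.symm)
      subst this
      exact ⟨rfl, eq_of_mem_ballCell hρ hw' hκ⟩
    rw [hb x, Fintype.sum_prod_type, Finset.sum_eq_single_of_mem i (Finset.mem_univ _),
      Fintype.sum_prod_type, Finset.sum_eq_single_of_mem κ (Finset.mem_univ _)]
    · refine Finset.sum_congr rfl fun l _ => ?_
      simp only [hu]
      rw [Set.indicator_of_mem hxS]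
    · intro κ' _ hne
      refine Finset.sum_eq_zero fun l _ => ?_
      simp only [hu]
      rw [Set.indicator_of_notMem fun hx' => hne (huniq _ _ hx').2, mul_zero]
    · intro i' _ hne
      refine Finset.sum_eq_zero fun q _ => ?_
      simp only [hu]
      rw [Set.indicator_of_notMem fun hx' => hne (huniq _ _ hx').1, mul_zero]

/-- Take the Taylor polynomial at the image of one point of the cell: the image has diameter at most
`C d (2ρ / 2^j)`. -/
theorem exists_coeff_abs_sub_sum_le {C ρ γ : ℝ} (hC : 0 < C) (hρ : 0 < ρ) (hγ : 0 < γ)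
    {μ : Measure (EuclideanSpace ℝ (Fin D))}
    {ψ : EuclideanSpace ℝ (Fin d) → EuclideanSpace ℝ (Fin D)} {z : EuclideanSpace ℝ (Fin d)}
    (h : IsChartBall C ρ μ ψ z) {f : EuclideanSpace ℝ (Fin D) → ℝ}
    (hf : f ∈ holderBall γ 1 Set.univ) (j : ℕ) (κ : Fin d → Fin (2 ^ j)) :
    ∃ a : (Fin D → Fin (⌊γ⌋₊ + 1)) → ℝ, ∀ x ∈ ψ '' ballCell ρ z j κ,
      |f x - ∑ l, a l * monomialFun l x| ≤
        (D : ℝ) ^ ⌊γ⌋₊ * (C * (d * (2 * ρ))) ^ γ * (2 : ℝ) ^ (-(j * γ)) := by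
  rcases (ballCell ρ z j κ).eq_empty_or_nonempty with he | ⟨w₀, hw₀⟩
  · exact ⟨0, by rw [he]; simp⟩
  obtain ⟨a, ha⟩ := exists_taylorSum_eq_sum_monomialFun (le_refl (⌊γ⌋₊ + 1)) f (ψ w₀)
  refine ⟨a, ?_⟩
  rintro _ ⟨w, hw, rfl⟩
  rw [← ha]
  refine (abs_sub_taylorSum_le_of_mem_holderBall hγ hf _ _).trans ?_
  rw [mul_assoc]
  refine mul_le_mul_of_nonneg_left ?_ (by positivity)
  have h1 : ‖ψ w - ψ w₀‖ ≤ C * (d * (2 * ρ)) * (2 : ℝ) ^ (-(j : ℝ)) := by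
    refine (h.lipschitz hw.1 hw₀.1).trans ?_
    rw [Real.rpow_neg (by norm_num), Real.rpow_natCast, mul_assoc]
    refine mul_le_mul_of_nonneg_left ((norm_sub_le_of_mem_ballCell hw hw₀).trans
      (le_of_eq ?_)) hC.le
    ring
  refine (Real.rpow_le_rpow (norm_nonneg _) h1 hγ.le).trans (le_of_eq ?_)
  rw [Real.mul_rpow (by positivity) (by positivity), ← Real.rpow_mul (by norm_num), neg_mul]

end cells

/-! ### A Poincaré type inequality on images of convex sets. -/

section poincare

variable {d D : ℕ}

/-- The change of variables has Jacobian `r^(-d) ≤ 2^d`. -/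
theorem lintegral_comp_affine_le {h : EuclideanSpace ℝ (Fin d) → ℝ≥0∞} (hh : Measurable h)
    (c : EuclideanSpace ℝ (Fin d)) {r : ℝ} (hr : 1 / 2 ≤ r) :
    ∫⁻ w, h (c + r • w) ≤ 2 ^ d * ∫⁻ w, h w := by
  have hr0 : 0 < r := by linarith
  have e1 : ∫⁻ w, h (c + r • w) =
      ∫⁻ y, h (c + y) ∂(Measure.map (fun w => r • w)
        (volume : Measure (EuclideanSpace ℝ (Fin d)))) := by
    rw [lintegral_map (by fun_prop) (by fun_prop)]
  rw [e1, Measure.map_addHaar_smul _ hr0.ne', lintegral_smul_measure, lintegral_add_left_eq_self,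
    finrank_euclideanSpace_fin, smul_eq_mul]
  gcongr
  rw [abs_of_pos (by positivity)]
  have e2 : (2 : ℝ≥0∞) ^ d = ENNReal.ofReal (2 ^ d) := by
    rw [ENNReal.ofReal_pow (by norm_num), ENNReal.ofReal_ofNat]
  rw [e2]
  apply ENNReal.ofReal_le_ofReal
  rw [← inv_pow]
  exact pow_le_pow_left₀ (by positivity) (inv_le_of_inv_le₀ (by norm_num) (by linarith)) d

/-- For each `t` one of `t` and `1 - t` is at least `1 / 2`. Integrating first over the endpoint
with that weight is an affine change of variables with bounded Jacobian, so no singular kernel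
appears. -/
theorem lintegral_segments_le {h : EuclideanSpace ℝ (Fin d) → ℝ≥0∞} (hh : Measurable h)
    (q : Set (EuclideanSpace ℝ (Fin d))) :
    ∫⁻ z in q, ∫⁻ w in q, ∫⁻ t in Set.Icc (0 : ℝ) 1, h (z + t • (w - z)) ≤
      volume q * (2 ^ d * ∫⁻ w, h w) := by
  set M := 2 ^ d * ∫⁻ w, h w with hM
  have e : ∀ z w : EuclideanSpace ℝ (Fin d), ∀ t : ℝ, z + t • (w - z) = (1 - t) • z + t • w := by
    intro z w t
    module
  calc ∫⁻ z in q, ∫⁻ w in q, ∫⁻ t in Set.Icc (0 : ℝ) 1, h (z + t • (w - z))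
      = ∫⁻ z in q, ∫⁻ t in Set.Icc (0 : ℝ) 1, ∫⁻ w in q, h (z + t • (w - z)) := by
        congr 1
        ext z
        refine lintegral_lintegral_swap (Measurable.aemeasurable ?_)
        simp only [Function.uncurry_def]
        fun_prop
    _ = ∫⁻ t in Set.Icc (0 : ℝ) 1, ∫⁻ z in q, ∫⁻ w in q, h (z + t • (w - z)) := by
        refine lintegral_lintegral_swap (Measurable.aemeasurable ?_)
        simp only [Function.uncurry_def]
        exact Measurable.lintegral_prod_right'
          (f := fun p : (EuclideanSpace ℝ (Fin d) × ℝ) × EuclideanSpace ℝ (Fin d) =>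
            h (p.1.1 + p.1.2 • (p.2 - p.1.1))) (by fun_prop)
    _ ≤ ∫⁻ t in Set.Icc (0 : ℝ) 1, volume q * M := by
        refine setLIntegral_mono' measurableSet_Icc fun t _ => ?_
        rcases le_total (1 / 2) t with h2 | h2
        · calc ∫⁻ z in q, ∫⁻ w in q, h (z + t • (w - z)) ≤ ∫⁻ z in q, M := by
                refine lintegral_mono fun z => (setLIntegral_le_lintegral _ _).trans ?_
                simp only [e]
                exact lintegral_comp_affine_le hh _ h2
            _ = _ := by rw [setLIntegral_const, mul_comm]
        · calc ∫⁻ z in q, ∫⁻ w in q, h (z + t • (w - z))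
              = ∫⁻ w in q, ∫⁻ z in q, h (z + t • (w - z)) := by
                refine lintegral_lintegral_swap (Measurable.aemeasurable ?_)
                simp only [Function.uncurry_def]
                fun_prop
            _ ≤ ∫⁻ w in q, M := by
                refine lintegral_mono fun w => (setLIntegral_le_lintegral _ _).trans ?_
                simp only [e, add_comm _ (t • w)]
                exact lintegral_comp_affine_le hh _ (by linarith)
            _ = _ := by rw [setLIntegral_const, mul_comm]
    _ = _ := by simp

variable {C ρ : ℝ} {μ : Measure (EuclideanSpace ℝ (Fin D))}
  {ψ : EuclideanSpace ℝ (Fin d) → EuclideanSpace ℝ (Fin D)} {z₀ : EuclideanSpace ℝ (Fin d)}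

section transfer

variable {q : Set (EuclideanSpace ℝ (Fin d))}

theorem measurableSet_inter_preimage_of_continuousOn (hψ : ContinuousOn ψ q)
    (hqm : MeasurableSet q) {A : Set (EuclideanSpace ℝ (Fin D))} (hA : MeasurableSet A) :
    MeasurableSet (q ∩ ψ ⁻¹' A) := by
  have h1 : Measurable (q.domRestrict ψ) :=
    (continuousOn_iff_continuous_domRestrict.1 hψ).measurable
  have h2 := hqm.subtype_image (h1 hA)
  convert h2 using 1
  ext w
  simp [Set.domRestrict, and_comm]

/-- The set-wise comparison in `IsChartBall` says that `μ` on the image is dominated by a multiple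
of the push-forward of Lebesgue measure; integrals follow. -/
theorem IsChartBall.lintegral_image_le (h : IsChartBall C ρ μ ψ z₀) (hq : q ⊆ Metric.ball z₀ ρ)
    (hqm : MeasurableSet q) {F : EuclideanSpace ℝ (Fin D) → ℝ≥0∞} (hF : Measurable F) :
    ∫⁻ x in ψ '' q, F x ∂μ ≤ ENNReal.ofReal C * ∫⁻ w in q, F (ψ w) := by
  have hψ : ContinuousOn ψ q := h.contDiffOn.continuousOn.mono hq
  have hψm : AEMeasurable ψ (volume.restrict q) := hψ.aemeasurable hqm
  have hle : μ.restrict (ψ '' q) ≤ ENNReal.ofReal C • Measure.map ψ (volume.restrict q) := by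
    refine Measure.le_iff.2 fun A hA => ?_
    rw [Measure.restrict_apply hA, Measure.smul_apply, Measure.map_apply_of_aemeasurable hψm hA,
      Measure.restrict_apply' hqm, Set.inter_comm A, ← Set.image_inter_preimage, smul_eq_mul,
      Set.inter_comm (ψ ⁻¹' A)]
    exact h.measure_image_le _ (Set.inter_subset_left.trans hq)
      (measurableSet_inter_preimage_of_continuousOn hψ hqm hA)
  refine (lintegral_mono' hle le_rfl).trans (le_of_eq ?_)
  rw [lintegral_smul_measure, lintegral_map' hF.aemeasurable hψm, smul_eq_mul]

theorem IsChartBall.lintegral_le_image (h : IsChartBall C ρ μ ψ z₀) (hq : q ⊆ Metric.ball z₀ ρ)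
    (hqm : MeasurableSet q) {F : EuclideanSpace ℝ (Fin D) → ℝ≥0∞} (hF : Measurable F) :
    ∫⁻ w in q, F (ψ w) ≤ ENNReal.ofReal C * ∫⁻ x in ψ '' q, F x ∂μ := by
  have hψ : ContinuousOn ψ q := h.contDiffOn.continuousOn.mono hq
  have hψm : AEMeasurable ψ (volume.restrict q) := hψ.aemeasurable hqm
  have hle : Measure.map ψ (volume.restrict q) ≤ ENNReal.ofReal C • μ.restrict (ψ '' q) := by
    refine Measure.le_iff.2 fun A hA => ?_
    rw [Measure.smul_apply, Measure.restrict_apply hA, Measure.map_apply_of_aemeasurable hψm hA,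
      Measure.restrict_apply' hqm, Set.inter_comm A, ← Set.image_inter_preimage, smul_eq_mul,
      Set.inter_comm (ψ ⁻¹' A)]
    exact h.le_measure_image _ (Set.inter_subset_left.trans hq)
      (measurableSet_inter_preimage_of_continuousOn hψ hqm hA)
  rw [← lintegral_map' hF.aemeasurable hψm, ← smul_eq_mul, ← lintegral_smul_measure]
  exact lintegral_mono' hle le_rfl

end transfer

theorem sq_intervalIntegral_le {H : ℝ → ℝ} (hH : ContinuousOn H (Set.Icc 0 1)) :
    (∫ t in (0 : ℝ)..1, H t) ^ 2 ≤ ∫ t in (0 : ℝ)..1, H t ^ 2 := by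
  set a := ∫ t in (0 : ℝ)..1, H t with ha
  have hi : IntervalIntegrable H volume 0 1 :=
    (hH.mono (by rw [Set.uIcc_of_le zero_le_one])).intervalIntegrable
  have hi2 : IntervalIntegrable (fun t => H t ^ 2) volume 0 1 :=
    ((hH.pow 2).mono (by rw [Set.uIcc_of_le zero_le_one])).intervalIntegrable
  have h0 : 0 ≤ ∫ t in (0 : ℝ)..1, (H t - a) ^ 2 :=
    intervalIntegral.integral_nonneg zero_le_one fun t _ => sq_nonneg _
  have e : ∀ t, (H t - a) ^ 2 = H t ^ 2 - 2 * a * H t + a ^ 2 := fun t => by ring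
  simp only [e] at h0
  rw [intervalIntegral.integral_add (hi2.sub (hi.const_mul _)) (by simp),
    intervalIntegral.integral_sub hi2 (hi.const_mul _), intervalIntegral.integral_const_mul,
    intervalIntegral.integral_const, ← ha] at h0
  simp only [sub_zero, one_smul] at h0
  nlinarith

/-- Taylor's formula along the image of a segment, in mean square. -/
theorem IsChartBall.ofReal_sq_sub_taylorSum_le (h : IsChartBall C ρ μ ψ z₀) (hC : 0 ≤ C) {m : ℕ}
    {f : EuclideanSpace ℝ (Fin D) → ℝ} (hf : ContDiff ℝ ((m + 1 : ℕ)) f)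
    {z w : EuclideanSpace ℝ (Fin d)} (hz : z ∈ Metric.ball z₀ ρ) (hw : w ∈ Metric.ball z₀ ρ)
    {δ : ℝ} (hδ : ‖w - z‖ ≤ δ) :
    ENNReal.ofReal ((f (ψ w) - taylorSum (m + 1) f (ψ z) (ψ w)) ^ 2) ≤
      ENNReal.ofReal ((C * δ) ^ (2 * (m + 1))) * ∫⁻ t in Set.Icc (0 : ℝ) 1,
        ENNReal.ofReal (‖iteratedFDeriv ℝ (m + 1) f (ψ (z + t • (w - z)))‖ ^ 2) := by
  have hseg : ∀ t ∈ Set.Icc (0 : ℝ) 1, z + t • (w - z) ∈ Metric.ball z₀ ρ := fun t ht =>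
    (convex_ball z₀ ρ).add_smul_sub_mem hz hw ht
  have hcd : ∀ t ∈ Set.Icc (0 : ℝ) 1, ContDiffAt ℝ 1 ψ (z + t • (w - z)) := fun t ht =>
    h.contDiffOn.contDiffAt (Metric.isOpen_ball.mem_nhds (hseg t ht))
  -- The curve is the image of a segment, not an ambient segment, so that it stays on the part of
  -- the manifold where the derivatives of `f` are controlled in `L²(μ)`.
  set c : ℝ → EuclideanSpace ℝ (Fin D) := fun t => ψ (z + t • (w - z)) with hc
  set c' : ℝ → EuclideanSpace ℝ (Fin D) := fun t => fderiv ℝ ψ (z + t • (w - z)) (w - z) with hc'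
  have hline : ∀ t : ℝ, HasDerivAt (fun t : ℝ => z + t • (w - z)) (w - z) t := fun t => by
    simpa using ((hasDerivAt_id t).smul_const (w - z)).const_add z
  have h1 : ∀ t ∈ Set.Icc (0 : ℝ) 1, HasDerivAt c (c' t) t := fun t ht =>
    (((hcd t ht).differentiableAt (by norm_num)).hasFDerivAt).comp_hasDerivAt t (hline t)
  have hlc : Continuous fun t : ℝ => z + t • (w - z) := by fun_prop
  have h2 : ContinuousOn c' (Set.Icc 0 1) := by
    have := (h.contDiffOn.continuousOn_fderiv_of_isOpen Metric.isOpen_ball le_rfl).comp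
      hlc.continuousOn hseg
    exact this.clm_apply continuousOn_const
  have h3 : ∀ t ∈ Set.Icc (0 : ℝ) 1, ‖c' t‖ ≤ C * δ := fun t ht =>
    ((fderiv ℝ ψ _).le_opNorm _).trans
      (mul_le_mul (h.norm_fderiv_le _ (hseg t ht)) hδ (norm_nonneg _) hC)
  have h4 := abs_sub_taylorSum_le_integral hf h1 h2 h3
  have hc0 : c 0 = ψ z := by simp [hc]
  have hc1 : c 1 = ψ w := by simp [hc]
  rw [hc0, hc1] at h4
  have hcc : ContinuousOn c (Set.Icc 0 1) := fun t ht => (h1 t ht).continuousAt.continuousWithinAt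
  have hHc : ContinuousOn (fun t => ‖iteratedFDeriv ℝ (m + 1) f (c t)‖) (Set.Icc 0 1) :=
    ((hf.continuous_iteratedFDeriv le_rfl).comp_continuousOn hcc).norm
  have hH2 : ContinuousOn (fun t => ‖iteratedFDeriv ℝ (m + 1) f (c t)‖ ^ 2) (Set.Icc 0 1) :=
    hHc.pow 2
  have h5 : (f (ψ w) - taylorSum (m + 1) f (ψ z) (ψ w)) ^ 2 ≤
      (C * δ) ^ (2 * (m + 1)) * ∫ t in (0 : ℝ)..1, ‖iteratedFDeriv ℝ (m + 1) f (c t)‖ ^ 2 := by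
    rw [← sq_abs]
    refine (pow_le_pow_left₀ (abs_nonneg _) h4 2).trans ?_
    rw [mul_pow, ← pow_mul, mul_comm (m + 1) 2]
    exact mul_le_mul_of_nonneg_left (sq_intervalIntegral_le hHc)
      (by rw [pow_mul]; positivity)
  refine (ENNReal.ofReal_le_ofReal h5).trans (le_of_eq ?_)
  rw [ENNReal.ofReal_mul (by rw [pow_mul]; positivity)]
  congr 1
  rw [intervalIntegral.integral_of_le zero_le_one, ← integral_Icc_eq_integral_Ioc,
    ofReal_integral_eq_lintegral_ofReal
      (f := fun t => ‖iteratedFDeriv ℝ (m + 1) f (c t)‖ ^ 2) hH2.integrableOn_Icc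
      (Filter.Eventually.of_forall fun t => sq_nonneg _)]

/-- Polynomial approximation in mean square on the image of a convex set. -/
theorem IsChartBall.exists_coeff_lintegral_sq_le (h : IsChartBall C ρ μ ψ z₀) (hC : 0 ≤ C)
    {m n : ℕ} (hmn : m + 1 ≤ n) {f : EuclideanSpace ℝ (Fin D) → ℝ}
    (hf : ContDiff ℝ ((m + 1 : ℕ)) f)
    {q : Set (EuclideanSpace ℝ (Fin d))} (hq : q ⊆ Metric.ball z₀ ρ) (hqm : MeasurableSet q)
    (hqc : Convex ℝ q) {δ : ℝ} (hδ : ∀ w ∈ q, ∀ z ∈ q, ‖w - z‖ ≤ δ) :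
    ∃ a : (Fin D → Fin n) → ℝ,
      ∫⁻ x in ψ '' q, ENNReal.ofReal ((f x - ∑ l, a l * monomialFun l x) ^ 2) ∂μ ≤
        ENNReal.ofReal (C ^ 2 * 2 ^ d * (C * δ) ^ (2 * (m + 1))) *
          ∫⁻ x in ψ '' q, ENNReal.ofReal (‖iteratedFDeriv ℝ (m + 1) f x‖ ^ 2) ∂μ := by
  set F : EuclideanSpace ℝ (Fin D) → ℝ≥0∞ := fun x =>
    ENNReal.ofReal (‖iteratedFDeriv ℝ (m + 1) f x‖ ^ 2) with hF
  have hFm : Measurable F :=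
    ((hf.continuous_iteratedFDeriv le_rfl).norm.pow 2).measurable.ennreal_ofReal
  have hFc : Continuous F :=
    ENNReal.continuous_ofReal.comp ((hf.continuous_iteratedFDeriv le_rfl).norm.pow 2)
  have hψ : ContinuousOn ψ q := h.contDiffOn.continuousOn.mono hq
  by_cases hq0 : volume q = 0
  · refine ⟨0, ?_⟩
    have : μ (ψ '' q) = 0 := by
      have := h.measure_image_le q hq hqm
      rw [hq0, mul_zero] at this
      exact le_antisymm this (zero_le)
    rw [setLIntegral_measure_zero _ _ this]
    exact zero_le
  have hqfin : volume q ≠ ∞ := ((measure_mono hq).trans_lt measure_ball_lt_top).ne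
  -- Extension by zero loses nothing, because segments between points of the convex set `q` stay in
  -- `q`, and it keeps the right-hand side local to `q`.
  set H : EuclideanSpace ℝ (Fin d) → ℝ≥0∞ := q.indicator fun w => F (ψ w) with hH
  have hHm : Measurable H := by
    classical
    rw [hH, ← Set.piecewise_eq_indicator]
    exact (hFc.comp_continuousOn hψ).measurable_piecewise continuousOn_const hqm
  set V := ENNReal.ofReal ((C * δ) ^ (2 * (m + 1))) with hV
  set Φ : EuclideanSpace ℝ (Fin d) → ℝ≥0∞ := fun z =>
    ∫⁻ w in q, ∫⁻ t in Set.Icc (0 : ℝ) 1, H (z + t • (w - z)) with hΦ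
  have hΦm : Measurable Φ := by
    refine Measurable.lintegral_prod_right' (f := fun p : EuclideanSpace ℝ (Fin d) ×
      EuclideanSpace ℝ (Fin d) => ∫⁻ t in Set.Icc (0 : ℝ) 1, H (p.1 + t • (p.2 - p.1))) ?_
    exact Measurable.lintegral_prod_right' (f := fun p : (EuclideanSpace ℝ (Fin d) ×
      EuclideanSpace ℝ (Fin d)) × ℝ => H (p.1.1 + p.2 • (p.1.2 - p.1.1))) (by fun_prop)
  -- Averaging over the base point: some `z` does no worse than the mean, and the Taylor polynomial
  -- at that point is used.
  obtain ⟨z, hz, hzle⟩ := exists_le_setLAverage hq0 hqfin hΦm.aemeasurable.restrict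
  have hΦz : Φ z ≤ 2 ^ d * ∫⁻ w in q, F (ψ w) := by
    refine hzle.trans ?_
    rw [setLAverage_eq, ENNReal.div_le_iff hq0 hqfin, mul_comm _ (volume q)]
    refine (lintegral_segments_le hHm q).trans (le_of_eq ?_)
    rw [hH, lintegral_indicator hqm]
  obtain ⟨a, ha⟩ := exists_taylorSum_eq_sum_monomialFun hmn f (ψ z)
  refine ⟨a, ?_⟩
  simp only [← ha]
  have hTm : Measurable fun x => ENNReal.ofReal ((f x - taylorSum (m + 1) f (ψ z) x) ^ 2) := by
    simp only [ha]
    refine Measurable.ennreal_ofReal ?_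
    refine ((hf.continuous.sub ?_).pow 2).measurable
    exact continuous_finsetSum _ fun l _ => continuous_const.mul (continuous_monomialFun l)
  have hint : ∫⁻ w in q, ENNReal.ofReal ((f (ψ w) - taylorSum (m + 1) f (ψ z) (ψ w)) ^ 2) ≤
      V * Φ z := by
    rw [hΦ, ← lintegral_const_mul' _ _ ENNReal.ofReal_ne_top]
    refine setLIntegral_mono' hqm fun w hw => ?_
    refine (h.ofReal_sq_sub_taylorSum_le hC hf (hq hz) (hq hw) (hδ w hw z hz)).trans ?_
    refine mul_le_mul' le_rfl (setLIntegral_mono' measurableSet_Icc fun t ht => ?_)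
    rw [hH, Set.indicator_of_mem (hqc.add_smul_sub_mem hz hw ht)]
  have e2 : (2 : ℝ≥0∞) ^ d = ENNReal.ofReal (2 ^ d) := by
    rw [ENNReal.ofReal_pow (by norm_num), ENNReal.ofReal_ofNat]
  calc ∫⁻ x in ψ '' q, ENNReal.ofReal ((f x - taylorSum (m + 1) f (ψ z) x) ^ 2) ∂μ
      ≤ ENNReal.ofReal C * (V * (2 ^ d * (ENNReal.ofReal C * ∫⁻ x in ψ '' q, F x ∂μ))) := by
        refine (h.lintegral_image_le hq hqm hTm).trans (mul_le_mul' le_rfl ?_)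
        refine hint.trans (mul_le_mul' le_rfl (hΦz.trans (mul_le_mul' le_rfl ?_)))
        exact h.lintegral_le_image hq hqm hFm
    _ = _ := by
        rw [e2, ENNReal.ofReal_mul (by positivity), ENNReal.ofReal_mul (by positivity), sq,
          ENNReal.ofReal_mul hC]
        ring

end poincare

/-! ### Mean square approximation in a Sobolev seminorm. -/

section sobolev

variable {d D : ℕ} {C ρ : ℝ} {μ : Measure (EuclideanSpace ℝ (Fin D))}

/-- Cells of one chart have disjoint images; overlaps occur only between charts and cost the factor
`N` later. -/
theorem sum_lintegral_image_ballCell_le (hρ : 0 < ρ)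
    {ψ : EuclideanSpace ℝ (Fin d) → EuclideanSpace ℝ (Fin D)} {z : EuclideanSpace ℝ (Fin d)}
    (h : IsChartBall C ρ μ ψ z) (F : EuclideanSpace ℝ (Fin D) → ℝ≥0∞) (j : ℕ) :
    ∑ κ, ∫⁻ x in ψ '' ballCell ρ z j κ, F x ∂μ ≤ ∫⁻ x, F x ∂μ := by
  have hd : Pairwise (Function.onFun Disjoint fun κ : Fin d → Fin (2 ^ j) =>
      ψ '' ballCell ρ z j κ) := by
    intro κ κ' hne
    rw [Function.onFun, Set.disjoint_left]
    rintro _ ⟨w, hw, rfl⟩ ⟨w', hw', e⟩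
    have : w' = w := h.injOn hw'.1 hw.1 e
    subst this
    exact hne (eq_of_mem_ballCell hρ hw hw')
  have h1 := lintegral_iUnion (μ := μ) (fun κ => h.measurableSet_image (ballCell_subset κ)
    (measurableSet_ballCell κ)) hd F
  rw [tsum_fintype] at h1
  rw [← h1]
  exact setLIntegral_le_lintegral _ _

/-- Mean square approximation by piecewise polynomial functions. -/
theorem exists_coeff_lintegral_sq_le (hC : 0 < C) (hρ : 0 < ρ) {N : ℕ}
    {ψ : Fin N → EuclideanSpace ℝ (Fin d) → EuclideanSpace ℝ (Fin D)}
    {z : Fin N → EuclideanSpace ℝ (Fin d)} (h : ∀ i, IsChartBall C ρ μ (ψ i) (z i))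
    (hG : ∀ᵐ x ∂μ, x ∈ ⋃ i, ψ i '' Metric.ball (z i) ρ) {m n : ℕ} (hmn : m + 1 ≤ n)
    {j : ℕ} {T : (ℕ → ℝ) → EuclideanSpace ℝ (Fin D) → ℝ}
    (hT : ∀ a : Fin N → (Fin d → Fin (2 ^ j)) → (Fin D → Fin n) → ℝ, ∃ b : ℕ → ℝ,
        ∀ x ∈ ⋃ i, ψ i '' Metric.ball (z i) ρ, ∃ i κ, x ∈ ψ i '' ballCell ρ (z i) j κ ∧
          T b x = ∑ l, a i κ l * monomialFun l x)
    {f : EuclideanSpace ℝ (Fin D) → ℝ} (hf : ContDiff ℝ ((m + 1 : ℕ)) f) :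
    ∃ b : ℕ → ℝ, ∫⁻ x, ENNReal.ofReal ((f x - T b x) ^ 2) ∂μ ≤
      N * (ENNReal.ofReal (C ^ 2 * 2 ^ d * (C * (d * (2 * ρ / 2 ^ j))) ^ (2 * (m + 1))) *
        ∫⁻ x, ENNReal.ofReal (‖iteratedFDeriv ℝ (m + 1) f x‖ ^ 2) ∂μ) := by
  have hcell : ∀ i κ, ∃ a : (Fin D → Fin n) → ℝ, _ := fun i (κ : Fin d → Fin (2 ^ j)) =>
    (h i).exists_coeff_lintegral_sq_le hC.le hmn hf (ballCell_subset κ)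
      (measurableSet_ballCell κ) (convex_ballCell κ)
      (fun w hw w' hw' => norm_sub_le_of_mem_ballCell hw hw')
  choose a ha using hcell
  obtain ⟨b, hb⟩ := hT a
  refine ⟨b, ?_⟩
  set P : Fin N → (Fin d → Fin (2 ^ j)) → EuclideanSpace ℝ (Fin D) → ℝ≥0∞ := fun i κ x =>
    ENNReal.ofReal ((f x - ∑ l, a i κ l * monomialFun l x) ^ 2) with hP
  have hPm : ∀ i κ, Measurable (P i κ) := by
    intro i κ
    refine Measurable.ennreal_ofReal ?_
    refine ((hf.continuous.sub ?_).pow 2).measurable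
    exact continuous_finsetSum _ fun l _ => continuous_const.mul (continuous_monomialFun l)
  have hSm : ∀ i κ, MeasurableSet (ψ i '' ballCell ρ (z i) j κ) := fun i κ =>
    (h i).measurableSet_image (ballCell_subset κ) (measurableSet_ballCell κ)
  calc ∫⁻ x, ENNReal.ofReal ((f x - T b x) ^ 2) ∂μ
      ≤ ∫⁻ x, ∑ i, ∑ κ, (ψ i '' ballCell ρ (z i) j κ).indicator (P i κ) x ∂μ := by
        refine lintegral_mono_ae ?_
        filter_upwards [hG] with x hx
        obtain ⟨i, κ, hxi, hTx⟩ := hb x hx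
        rw [hTx]
        calc P i κ x = (ψ i '' ballCell ρ (z i) j κ).indicator (P i κ) x := by
              rw [Set.indicator_of_mem hxi]
          _ ≤ ∑ κ', (ψ i '' ballCell ρ (z i) j κ').indicator (P i κ') x :=
              Finset.single_le_sum (f := fun κ' =>
                (ψ i '' ballCell ρ (z i) j κ').indicator (P i κ') x) (fun _ _ => zero_le)
                (Finset.mem_univ κ)
          _ ≤ _ := Finset.single_le_sum (f := fun i => ∑ κ',
                (ψ i '' ballCell ρ (z i) j κ').indicator (P i κ') x) (fun _ _ => zero_le)
                (Finset.mem_univ i)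
    _ = ∑ i, ∑ κ, ∫⁻ x in ψ i '' ballCell ρ (z i) j κ, P i κ x ∂μ := by
        rw [lintegral_finsetSum _ fun i _ => Finset.measurable_fun_sum _ fun κ _ =>
          (hPm i κ).indicator (hSm i κ)]
        refine Finset.sum_congr rfl fun i _ => ?_
        rw [lintegral_finsetSum _ fun κ _ => (hPm i κ).indicator (hSm i κ)]
        exact Finset.sum_congr rfl fun κ _ => lintegral_indicator (hSm i κ) _
    _ ≤ ∑ i : Fin N, ENNReal.ofReal
          (C ^ 2 * 2 ^ d * (C * (d * (2 * ρ / 2 ^ j))) ^ (2 * (m + 1))) *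
          ∫⁻ x, ENNReal.ofReal (‖iteratedFDeriv ℝ (m + 1) f x‖ ^ 2) ∂μ := by
        refine Finset.sum_le_sum fun i _ => ?_
        refine (Finset.sum_le_sum fun κ _ => ha i κ).trans ?_
        rw [← Finset.mul_sum]
        exact mul_le_mul' le_rfl (sum_lintegral_image_ballCell_le hρ (h i) _ j)
    _ = _ := by simp

/-- All partial derivatives of order `m`. -/
def derivVec (m : ℕ) (f : EuclideanSpace ℝ (Fin D) → ℝ) (x : EuclideanSpace ℝ (Fin D)) :
    EuclideanSpace ℝ (Fin m → Fin D) :=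
  WithLp.toLp 2 fun s => iteratedFDeriv ℝ m f x fun i => EuclideanSpace.single (s i) 1

theorem norm_iteratedFDeriv_le_derivVec (m : ℕ) (f : EuclideanSpace ℝ (Fin D) → ℝ)
    (x : EuclideanSpace ℝ (Fin D)) :
    ‖iteratedFDeriv ℝ m f x‖ ≤ (D : ℝ) ^ m * ‖derivVec m f x‖ :=
  multilinear_norm_le_of_basis _ (norm_nonneg _) fun s =>
    PiLp.norm_apply_le (derivVec m f x) s

theorem norm_derivVec_le {m : ℕ} {f : EuclideanSpace ℝ (Fin D) → ℝ}
    {x : EuclideanSpace ℝ (Fin D)} {B : ℝ} (h : ‖iteratedFDeriv ℝ m f x‖ ≤ B) :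
    ‖derivVec m f x‖ ≤ √((D : ℝ) ^ m) * B := by
  have hB : 0 ≤ B := (norm_nonneg _).trans h
  conv_rhs => rw [← Real.sqrt_sq hB, ← Real.sqrt_mul (by positivity)]
  rw [EuclideanSpace.norm_eq]
  apply Real.sqrt_le_sqrt
  have h1 : ∀ s ∈ (Finset.univ : Finset (Fin m → Fin D)), ‖derivVec m f x s‖ ^ 2 ≤ B ^ 2 := by
    intro s _
    refine pow_le_pow_left₀ (norm_nonneg _) (le_trans ?_ h) 2
    refine ((iteratedFDeriv ℝ m f x).le_opNorm _).trans (le_of_eq ?_)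
    simp
  refine (Finset.sum_le_sum h1).trans (le_of_eq ?_)
  simp

theorem continuous_derivVec {m : ℕ} {f : EuclideanSpace ℝ (Fin D) → ℝ} (hf : ContDiff ℝ m f) :
    Continuous (derivVec m f) := by
  refine (PiLp.continuous_toLp 2 _).comp (continuous_pi fun s => ?_)
  exact (ContinuousMultilinearMap.apply ℝ _ ℝ
    fun i : Fin m => EuclideanSpace.single (s i) (1 : ℝ)).continuous.comp
    (hf.continuous_iteratedFDeriv le_rfl)

theorem derivVec_add {m : ℕ} {f g : EuclideanSpace ℝ (Fin D) → ℝ} (hf : ContDiff ℝ m f)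
    (hg : ContDiff ℝ m g) : derivVec m (f + g) = derivVec m f + derivVec m g := by
  ext x s
  have := iteratedFDeriv_add_apply (x := x) hf.contDiffAt hg.contDiffAt
  simp [derivVec, this]

theorem derivVec_smul {m : ℕ} (c : ℝ) {f : EuclideanSpace ℝ (Fin D) → ℝ}
    (hf : ContDiff ℝ m f) : derivVec m (c • f) = c • derivVec m f := by
  ext x s
  have := iteratedFDeriv_const_smul_apply (x := x) (a := c) hf.contDiffAt
  simp [derivVec, this]

/-- Functions of class `C^m` that are square integrable with their derivatives of order `m`. -/
def smoothL2 (m : ℕ) (μ : Measure (EuclideanSpace ℝ (Fin D))) :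
    Submodule ℝ (EuclideanSpace ℝ (Fin D) → ℝ) where
  carrier := {f | ContDiff ℝ m f ∧ MemLp f 2 μ ∧ MemLp (derivVec m f) 2 μ}
  add_mem' := fun ⟨h1, h2, h3⟩ ⟨k1, k2, k3⟩ =>
    ⟨h1.add k1, h2.add k2, by rw [derivVec_add h1 k1]; exact h3.add k3⟩
  zero_mem' := ⟨contDiff_const, MemLp.zero, by
    have : derivVec m (0 : EuclideanSpace ℝ (Fin D) → ℝ) = 0 := by
      have := derivVec_smul (m := m) 0 (f := (0 : EuclideanSpace ℝ (Fin D) → ℝ)) contDiff_const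
      simpa using this
    rw [this]; exact MemLp.zero⟩
  smul_mem' := fun c _ ⟨h1, h2, h3⟩ =>
    ⟨h1.const_smul c, h2.const_smul c, by rw [derivVec_smul c h1]; exact h3.const_smul c⟩

/-- The derivatives of order `m` as an element of `L²`. -/
def derivL2 (m : ℕ) (μ : Measure (EuclideanSpace ℝ (Fin D))) :
    smoothL2 m μ →ₗ[ℝ] Lp (EuclideanSpace ℝ (Fin m → Fin D)) 2 μ where
  toFun f := f.2.2.2.toLp
  map_add' f g := by
    rw [← MemLp.toLp_add]
    exact MemLp.toLp_congr _ _ (by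
      rw [← derivVec_add f.2.1 g.2.1]; rfl)
  map_smul' c f := by
    rw [RingHom.id_apply, ← MemLp.toLp_const_smul]
    exact MemLp.toLp_congr _ _ (by
      rw [← derivVec_smul c f.2.1]; rfl)

theorem lintegral_derivVec_sq (m : ℕ) (f : smoothL2 m μ) :
    ∫⁻ x, ENNReal.ofReal (‖derivVec m f x‖ ^ 2) ∂μ = ENNReal.ofReal (‖derivL2 m μ f‖ ^ 2) := by
  have h1 : ‖derivL2 m μ f‖ ^ 2 = ∫ x, ‖derivVec m f x‖ ^ 2 ∂μ := by
    rw [← real_inner_self_eq_norm_sq, L2.inner_def]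
    apply integral_congr_ae
    filter_upwards [f.2.2.2.coeFn_toLp] with x hx
    rw [show derivL2 m μ f = f.2.2.2.toLp from rfl, hx, real_inner_self_eq_norm_sq]
  rw [h1, ofReal_integral_eq_lintegral_ofReal ((memLp_two_iff_integrable_sq_norm f.2.2.2.1).1 f.2.2.2)
    (Filter.Eventually.of_forall fun x => sq_nonneg _)]

variable [IsProbabilityMeasure μ]

theorem memLp_of_mem_holderBall {γ : ℝ} {f : EuclideanSpace ℝ (Fin D) → ℝ}
    (hf : f ∈ holderBall γ 1 Set.univ) : MemLp f 2 μ :=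
  MemLp.of_bound (continuous_of_mem_holderBall_univ hf).aestronglyMeasurable 1
    (Filter.Eventually.of_forall fun x => abs_le_of_mem_holderBall zero_le_one hf (Set.mem_univ x))

theorem mem_smoothL2_of_mem_holderBall {γ : ℝ} {f : EuclideanSpace ℝ (Fin D) → ℝ}
    (hf : f ∈ holderBall γ 1 Set.univ) : ∃ h : f ∈ smoothL2 ⌊γ⌋₊ μ,
      ‖derivL2 ⌊γ⌋₊ μ ⟨f, h⟩‖ ≤ √((D : ℝ) ^ ⌊γ⌋₊) * (D : ℝ) ^ ⌊γ⌋₊ := by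
  have hfc : ContDiff ℝ (⌊γ⌋₊ : ℕ) f := contDiffOn_univ.1 hf.1
  have hb : ∀ x, ‖derivVec ⌊γ⌋₊ f x‖ ≤ √((D : ℝ) ^ ⌊γ⌋₊) * (D : ℝ) ^ ⌊γ⌋₊ := fun x => by
    have := norm_iteratedFDeriv_le_of_mem_holderBall isOpen_univ zero_le_one hf le_rfl
      (Set.mem_univ x)
    rw [mul_one] at this
    exact norm_derivVec_le this
  have hm : MemLp (derivVec ⌊γ⌋₊ f) 2 μ :=
    MemLp.of_bound (continuous_derivVec hfc).aestronglyMeasurable _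
      (Filter.Eventually.of_forall hb)
  refine ⟨⟨hfc, memLp_of_mem_holderBall hf, hm⟩, ?_⟩
  have h1 := Lp.norm_le_of_ae_bound (f := hm.toLp) (C := √((D : ℝ) ^ ⌊γ⌋₊) * (D : ℝ) ^ ⌊γ⌋₊)
    (by positivity) (hm.coeFn_toLp.mono fun x hx => by rw [hx]; exact hb x)
  have h2 : measureUnivNNReal μ = 1 := by simp [measureUnivNNReal]
  rw [h2, NNReal.coe_one, Real.one_rpow, one_mul] at h1
  exact h1

/-- The cells have diameter of order `2^(-j)`, giving an error of order `2^(-j(m+1))` times the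
seminorm. It is stated on all of `smoothL2` and homogeneously, as the representation of functionals
demands; the Hölder ball alone would not do. -/
theorem exists_coeff_integral_sq_le (hC : 0 < C) (hρ : 0 < ρ) {N K : ℕ} (hN : N ≤ K)
    {ψ : Fin N → EuclideanSpace ℝ (Fin d) → EuclideanSpace ℝ (Fin D)}
    {z : Fin N → EuclideanSpace ℝ (Fin d)} (h : ∀ i, IsChartBall C ρ μ (ψ i) (z i))
    (hG : ∀ᵐ x ∂μ, x ∈ ⋃ i, ψ i '' Metric.ball (z i) ρ) {m n : ℕ} (hmn : m + 1 ≤ n)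
    {j : ℕ} {T : (ℕ → ℝ) → EuclideanSpace ℝ (Fin D) → ℝ} (hTm : ∀ b, MemLp (T b) 2 μ)
    (hT : ∀ a : Fin N → (Fin d → Fin (2 ^ j)) → (Fin D → Fin n) → ℝ, ∃ b : ℕ → ℝ,
        ∀ x ∈ ⋃ i, ψ i '' Metric.ball (z i) ρ, ∃ i κ, x ∈ ψ i '' ballCell ρ (z i) j κ ∧
          T b x = ∑ l, a i κ l * monomialFun l x)
    (f : smoothL2 (m + 1) μ) :
    ∃ b : ℕ → ℝ, ∫ x, ((f : EuclideanSpace ℝ (Fin D) → ℝ) x - T b x) ^ 2 ∂μ ≤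
      (√(K * (C ^ 2 * 2 ^ d)) * (C * (d * (2 * ρ)) * D) ^ (m + 1) / (2 ^ j) ^ (m + 1) *
        ‖derivL2 (m + 1) μ f‖) ^ 2 := by
  obtain ⟨b, hb⟩ := exists_coeff_lintegral_sq_le hC hρ h hG hmn hT f.2.1
  refine ⟨b, ?_⟩
  rw [integral_eq_lintegral_of_nonneg_ae
    (f := fun x => ((f : EuclideanSpace ℝ (Fin D) → ℝ) x - T b x) ^ 2) (Filter.Eventually.of_forall fun x => sq_nonneg _)
    ((f.2.2.1.aestronglyMeasurable.sub (hTm b).aestronglyMeasurable).pow 2)]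
  refine ENNReal.toReal_le_of_le_ofReal (sq_nonneg _) (hb.trans ?_)
  have h1 : ∫⁻ x, ENNReal.ofReal (‖iteratedFDeriv ℝ (m + 1) (f : EuclideanSpace ℝ (Fin D) → ℝ) x‖
      ^ 2) ∂μ ≤ ENNReal.ofReal (((D : ℝ) ^ (m + 1)) ^ 2 * ‖derivL2 (m + 1) μ f‖ ^ 2) := by
    rw [ENNReal.ofReal_mul (by positivity), ← lintegral_derivVec_sq,
      ← lintegral_const_mul' _ _ ENNReal.ofReal_ne_top]
    refine lintegral_mono fun x => ?_
    rw [← ENNReal.ofReal_mul (by positivity), ← mul_pow]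
    exact ENNReal.ofReal_le_ofReal (pow_le_pow_left₀ (norm_nonneg _)
      (norm_iteratedFDeriv_le_derivVec _ _ _) 2)
  have h2 : (N : ℝ≥0∞) ≤ ENNReal.ofReal K := by
    rw [ENNReal.ofReal_natCast]; exact_mod_cast hN
  refine (mul_le_mul' h2 (mul_le_mul' le_rfl h1)).trans (le_of_eq ?_)
  rw [← ENNReal.ofReal_mul (by positivity), ← ENNReal.ofReal_mul (by positivity)]
  congr 1
  have e1 : √(K * (C ^ 2 * 2 ^ d)) ^ 2 = K * (C ^ 2 * 2 ^ d) := Real.sq_sqrt (by positivity)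
  have e2 : C * (d * (2 * ρ / 2 ^ j)) = C * (d * (2 * ρ)) / 2 ^ j := by ring
  rw [e2]
  generalize C * (d * (2 * ρ)) = u
  generalize √(K * (C ^ 2 * 2 ^ d)) = q at e1 ⊢
  generalize (2 : ℝ) ^ j = t
  linear_combination (-((u / t) ^ (2 * (m + 1)) *
    (((D : ℝ) ^ (m + 1)) ^ 2 * ‖derivL2 (m + 1) μ f‖ ^ 2))) * e1

end sobolev

/-! ### Bounds for the mean of the empirical supremum. -/

section expectation

variable {d D : ℕ}

/-- The polynomial degree is `⌊γ⌋`; chaining over dyadic scales. -/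
theorem exists_lintegral_empiricalSup_le {C ρ γ : ℝ} (hC : 0 < C) (hρ : 0 < ρ) (hγ : 0 < γ)
    (hd : 1 ≤ d) (D K : ℕ) : ∃ A : ℝ, 0 < A ∧
    ∀ (μ : Measure (EuclideanSpace ℝ (Fin D))) [IsProbabilityMeasure μ] (N : ℕ)
      (ψ : Fin N → EuclideanSpace ℝ (Fin d) → EuclideanSpace ℝ (Fin D))
      (z : Fin N → EuclideanSpace ℝ (Fin d)), N ≤ K → (∀ i, IsChartBall C ρ μ (ψ i) (z i)) →
      μ (⋃ i, ψ i '' Metric.ball (z i) ρ)ᶜ = 0 → ∀ n J : ℕ, 0 < n →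
      ∫⁻ X, empiricalSup γ μ X ∂(sampleLaw n μ) ≤ ENNReal.ofReal (A * ((2 : ℝ) ^ (-(J * γ)) +
        √(1 / n) + ∑ j ∈ Finset.range J, (2 : ℝ) ^ (-(j * γ)) * √((2 ^ j) ^ d / n))) ∧
      (∀ m : ℕ, γ = (m + 1 : ℕ) → ∫⁻ X, empiricalSup γ μ X ∂(sampleLaw n μ) ≤
        ENNReal.ofReal (A * ((2 : ℝ) ^ (-(J * γ)) + (2 : ℝ) ^ (-(J * γ)) * √((2 ^ J) ^ d / n) +
          √(1 / n) + √((n : ℝ)⁻¹ * ∑ j ∈ Finset.range J,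
            (2 ^ j) ^ d * (1 / (2 ^ j) ^ (m + 1)) ^ 2)))) := by
  set p := ⌊γ⌋₊ with hp
  set A₀ : ℝ := (D : ℝ) ^ p * (C * (d * (2 * ρ))) ^ γ with hA₀
  -- The extra factor `2^d` lets `S (2^j)^d` bound `s (j+1)` as well as `s j`.
  set S : ℝ := 2 * (K * (p + 1) ^ D) * 2 ^ d with hS
  set A₁ : ℝ := √(K * (C ^ 2 * 2 ^ d)) * (C * (d * (2 * ρ)) * D) ^ p with hA₁
  set B : ℝ := √((D : ℝ) ^ p) * (D : ℝ) ^ p with hB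
  have hA₀0 : 0 ≤ A₀ := by positivity
  have hS0 : 0 ≤ S := by positivity
  have hA₁0 : 0 ≤ A₁ := by positivity
  have hB0 : 0 ≤ B := by positivity
  -- The sum of all coefficients that occur in either bound, so that one constant dominates each of
  -- them.
  set E : ℝ := 2 * A₀ + (1 + A₀) * √S + 2 * A₀ * √S + B * (√S * A₁) + 1 with hE
  have hc1 : 0 ≤ A₀ * √S := by positivity
  have hc3 : 0 ≤ B * (√S * A₁) := by positivity
  have hSq := Real.sqrt_nonneg S
  have key : ∀ {c t : ℝ}, c ≤ E → 0 ≤ t → c * t ≤ E * t := fun h1 h2 =>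
    mul_le_mul_of_nonneg_right h1 h2
  refine ⟨E, by positivity,
    fun μ _ N ψ z hN h hG n J hn => ?_⟩
  have hn0 : (0 : ℝ) < n := by exact_mod_cast hn
  have hGae : ∀ᵐ x ∂μ, x ∈ ⋃ i, ψ i '' Metric.ball (z i) ρ := mem_ae_iff.2 hG
  obtain ⟨e, s, he, hsm, hscard, hfam⟩ := exists_piecewise_family hC hρ hd h (p + 1)
  have hsS : ∀ j, (s j : ℝ) ≤ 2 * (K * (p + 1) ^ D) * (2 ^ j) ^ d := by
    intro j
    have h1 : (s j : ℝ) ≤ 2 * (N * (p + 1) ^ D) * (2 ^ j) ^ d := by exact_mod_cast hscard j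
    refine h1.trans ?_
    have : (N : ℝ) ≤ K := by exact_mod_cast hN
    gcongr
  have hsS' : ∀ j, (s j : ℝ) ≤ S * (2 ^ j) ^ d := fun j => (hsS j).trans (by
    refine mul_le_mul_of_nonneg_right ?_ (by positivity)
    exact le_mul_of_one_le_right (by positivity) (one_le_pow₀ (by norm_num)))
  have hsS1 : ∀ j, (s (j + 1) : ℝ) ≤ S * (2 ^ j) ^ d := fun j => (hsS _).trans (le_of_eq (by
    rw [hS, pow_succ, mul_pow]; ring))
  have hsqrt : ∀ (k j : ℕ), (s k : ℝ) ≤ S * (2 ^ j) ^ d →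
      √(s k / n) ≤ √S * √((2 ^ j) ^ d / n) := by
    intro k j hk
    rw [← Real.sqrt_mul hS0]
    apply Real.sqrt_le_sqrt
    rw [mul_div_assoc']
    gcongr
  have hsqrt0 : √(s 0 / n) ≤ √S * √(1 / n) := by simpa using hsqrt 0 0 (hsS' 0)
  set ε : ℕ → ℝ := fun j => A₀ * (2 : ℝ) ^ (-(j * γ)) with hε
  have hε0 : ∀ j, 0 ≤ ε j := fun j => by positivity
  have hεanti : Antitone ε := fun i j hij => by
    refine mul_le_mul_of_nonneg_left ?_ hA₀0
    apply Real.rpow_le_rpow_of_exponent_le (by norm_num)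
    have : (i : ℝ) ≤ j := by exact_mod_cast hij
    nlinarith
  have hεz : ε 0 = A₀ := by simp [hε]
  have hF : ∀ f ∈ holderBall γ 1 (Set.univ : Set (EuclideanSpace ℝ (Fin D))),
      MemLp f 2 μ ∧ ∀ x, |f x| ≤ 1 := fun f hf =>
    ⟨memLp_of_mem_holderBall hf, fun x => abs_le_of_mem_holderBall zero_le_one hf (Set.mem_univ x)⟩
  have happ : ∀ f ∈ holderBall γ 1 (Set.univ : Set (EuclideanSpace ℝ (Fin D))), ∀ j,
      ∃ a : ℕ → ℝ, ∀ x ∈ ⋃ i, ψ i '' Metric.ball (z i) ρ,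
        |f x - ∑ t ∈ Finset.range (s j), a t * e t x| ≤ ε j := by
    intro f hf j
    choose a ha using fun i κ => exists_coeff_abs_sub_sum_le hC hρ hγ (h i) hf j κ
    obtain ⟨b, hb⟩ := hfam j a
    refine ⟨b, fun x hx => ?_⟩
    obtain ⟨i, κ, hxi, e1⟩ := hb x hx
    rw [e1]
    exact ha i κ x hxi
  set a := (2 : ℝ) ^ (-(J * γ)) with ha
  have ha0 : 0 ≤ a := by positivity
  have hq0 := Real.sqrt_nonneg (1 / (n : ℝ))
  refine ⟨?_, fun m hm => ?_⟩
  · simp only [empiricalSup_eq]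
    refine (lintegral_iSup_meanDeviation_le hn he hGae hsm hεanti hε0 hF happ J).trans
      (ENNReal.ofReal_le_ofReal ?_)
    have h1 : ∑ j ∈ Finset.range J, 2 * ε j * √(s (j + 1) / n) ≤
        2 * A₀ * √S * ∑ j ∈ Finset.range J, (2 : ℝ) ^ (-(j * γ)) * √((2 ^ j) ^ d / n) := by
      rw [Finset.mul_sum]
      refine Finset.sum_le_sum fun j _ => ?_
      refine (mul_le_mul_of_nonneg_left (hsqrt (j + 1) j (hsS1 j)) (by
        have := hε0 j; positivity)).trans (le_of_eq ?_)
      rw [hε]; ring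
    have h2 : 0 ≤ ∑ j ∈ Finset.range J, (2 : ℝ) ^ (-(j * γ)) * √((2 ^ j) ^ d / n) :=
      Finset.sum_nonneg fun j _ => by positivity
    set Q := ∑ j ∈ Finset.range J, (2 : ℝ) ^ (-(j * γ)) * √((2 ^ j) ^ d / n)
    have h3 : (1 + ε 0) * √(s 0 / n) ≤ (1 + A₀) * √S * √(1 / n) := by
      rw [hεz, mul_assoc]
      exact mul_le_mul_of_nonneg_left hsqrt0 (by linarith)
    have h4 : 2 * ε J = 2 * A₀ * a := by rw [hε]; ring
    rw [h4]
    have k1 : 2 * A₀ * a ≤ E * a := key (by linarith) ha0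
    have k2 : (1 + A₀) * √S * √(1 / n) ≤ E * √(1 / n) := key (by linarith) hq0
    have k3 : 2 * A₀ * √S * Q ≤ E * Q := key (by linarith) h2
    rw [mul_add, mul_add]
    linarith
  · have hpm : p = m + 1 := by rw [hp, hm, Nat.floor_natCast]
    set δ : ℕ → ℝ := fun j => A₁ / (2 ^ j) ^ (m + 1) with hδ
    have hδ0 : ∀ j, 0 ≤ δ j := fun j => by positivity
    have hδanti : Antitone δ := fun i j hij => by
      refine div_le_div_of_nonneg_left hA₁0 (by positivity) ?_
      gcongr
      norm_num
    simp only [empiricalSup_eq]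
    refine (lintegral_iSup_meanDeviation_le_of_hilbert hn he hGae hsm hε0 hF happ
      (smoothL2 (m + 1) μ) (derivL2 (m + 1) μ) hB0 (fun f hf => hf.2.1) (fun f hf => ?_)
      hδanti hδ0 (fun f j => ?_) J).trans (ENNReal.ofReal_le_ofReal ?_)
    · have := mem_smoothL2_of_mem_holderBall (μ := μ) hf
      rw [← hp] at this
      rw [← hB, hpm] at this
      exact this
    · have := exists_coeff_integral_sq_le hC hρ hN h hGae (m := m) (n := p + 1) (by omega)
        (T := fun b x => ∑ t ∈ Finset.range (s j), b t * e t x)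
        (fun b => memLp_finsetSum _ fun t _ => (he t).const_mul _) (hfam j) f
      rw [hδ, hA₁, hpm]
      exact this
    · have h1 : (n : ℝ)⁻¹ * ∑ j ∈ Finset.range J, ((s (j + 1) : ℝ) - s j) * δ j ^ 2 ≤
          S * A₁ ^ 2 * ((n : ℝ)⁻¹ * ∑ j ∈ Finset.range J,
            (2 ^ j) ^ d * (1 / (2 ^ j) ^ (m + 1)) ^ 2) := by
        rw [mul_left_comm]
        refine mul_le_mul_of_nonneg_left ?_ (by positivity)
        rw [Finset.mul_sum]
        refine Finset.sum_le_sum fun j _ => ?_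
        have h2 : (s (j + 1) : ℝ) - s j ≤ S * (2 ^ j) ^ d := by
          have := hsS1 j
          have : (0 : ℝ) ≤ s j := Nat.cast_nonneg _
          linarith
        refine (mul_le_mul_of_nonneg_right h2 (sq_nonneg _)).trans (le_of_eq ?_)
        rw [hδ]; ring
      have h2 := Real.sqrt_le_sqrt h1
      rw [Real.sqrt_mul (x := S * A₁ ^ 2) (by positivity), Real.sqrt_mul hS0,
        Real.sqrt_sq hA₁0] at h2
      set Q := √((n : ℝ)⁻¹ * ∑ j ∈ Finset.range J, (2 ^ j) ^ d * (1 / (2 ^ j) ^ (m + 1)) ^ 2)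
      have hQ : 0 ≤ Q := Real.sqrt_nonneg _
      have h3 := mul_le_mul_of_nonneg_left h2 hB0
      set R := √((2 ^ J) ^ d / (n : ℝ))
      have hR : 0 ≤ R := Real.sqrt_nonneg _
      have h4 : ε J * √(s J / n) ≤ A₀ * √S * (a * R) := by
        refine (mul_le_mul_of_nonneg_left (hsqrt J J (hsS' J)) (hε0 J)).trans (le_of_eq ?_)
        rw [hε]; ring
      have h5 : 2 * ε J = 2 * A₀ * a := by rw [hε]; ring
      rw [h5]
      have haR : 0 ≤ a * R := mul_nonneg ha0 hR
      have k1 : 2 * A₀ * a ≤ E * a := key (by linarith) ha0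
      have k2 : A₀ * √S * (a * R) ≤ E * (a * R) := key (by linarith) haR
      have k3 : √S * √(1 / n) ≤ E * √(1 / n) := key (by linarith) hq0
      have k4 : B * (√S * A₁) * Q ≤ E * Q := key (by linarith) hQ
      have e1 : B * (√S * A₁ * Q) = B * (√S * A₁) * Q := by ring
      rw [mul_add, mul_add, mul_add]
      linarith

end expectation

/-! ### From scales to rates. -/

section rates

/-- With `J = ⌊log₂ n⌋ / d` (integer division) the finest space has dimension comparable with the
sample size, which balances bias and fluctuation. -/
theorem exists_dyadic_scale {d n : ℕ} (hd : 1 ≤ d) (hn : 1 ≤ n) :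
    ∃ J : ℕ, ((2 : ℝ) ^ J) ^ d ≤ n ∧ (n : ℝ) ≤ (2 * 2 ^ J) ^ d := by
  refine ⟨Nat.log 2 n / d, ?_, ?_⟩
  · have h1 : (2 ^ (Nat.log 2 n / d)) ^ d ≤ n := by
      rw [← pow_mul]
      exact (Nat.pow_le_pow_right (by norm_num) (Nat.div_mul_le_self _ _)).trans
        (Nat.pow_log_le_self 2 (by omega))
    exact_mod_cast h1
  · have h1 : n ≤ (2 * 2 ^ (Nat.log 2 n / d)) ^ d := by
      rw [← pow_succ', ← pow_mul]
      refine (Nat.lt_pow_succ_log_self (by norm_num) n).le.trans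
        (Nat.pow_le_pow_right (by norm_num) ?_)
      rw [mul_comm]
      exact Nat.lt_mul_div_succ _ (by omega)
    exact_mod_cast h1

variable {d n J : ℕ} {γ : ℝ}

theorem two_rpow_neg_le (hd : 1 ≤ d) (hn : 1 ≤ n) (hγ : 0 < γ)
    (h : (n : ℝ) ≤ (2 * 2 ^ J) ^ d) :
    (2 : ℝ) ^ (-(J * γ)) ≤ 2 ^ γ * (n : ℝ) ^ (-(γ / d)) := by
  have hd0 : (0 : ℝ) < d := by exact_mod_cast hd
  have hn0 : (0 : ℝ) < n := by exact_mod_cast hn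
  have h1 : (n : ℝ) ^ (γ / d) ≤ 2 ^ γ * 2 ^ (J * γ) := by
    refine (Real.rpow_le_rpow hn0.le h (by positivity)).trans (le_of_eq ?_)
    rw [← Real.rpow_natCast (2 * 2 ^ J), ← Real.rpow_mul (by positivity),
      mul_div_cancel₀ _ hd0.ne', Real.mul_rpow (by norm_num) (by positivity),
      ← Real.rpow_natCast 2 J, ← Real.rpow_mul (by norm_num)]
  rw [Real.rpow_neg (by norm_num), Real.rpow_neg hn0.le, ← div_eq_mul_inv,
    le_div_iff₀ (by positivity), inv_mul_le_iff₀ (by positivity)]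
  linarith

theorem sum_scales_eq : ∑ j ∈ Finset.range J, (2 : ℝ) ^ (-(j * γ)) * √((2 ^ j) ^ d / n) =
    √(1 / n) * ∑ j ∈ Finset.range J, ((2 : ℝ) ^ ((d : ℝ) / 2 - γ)) ^ j := by
  rw [Finset.mul_sum]
  refine Finset.sum_congr rfl fun j _ => ?_
  have h1 : √((2 ^ j) ^ d / n) = √(1 / n) * (2 : ℝ) ^ ((j : ℝ) * (d / 2)) := by
    rw [div_eq_mul_one_div, Real.sqrt_mul (by positivity), mul_comm, Real.sqrt_eq_rpow ((2 ^ j) ^ d),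
      ← pow_mul, ← Real.rpow_natCast, ← Real.rpow_mul (by norm_num)]
    congr 2
    push_cast
    ring
  rw [h1, ← Real.rpow_natCast, ← Real.rpow_mul (by norm_num), mul_left_comm,
    ← Real.rpow_add (by norm_num)]
  congr 2
  ring

/-- One bound for both regimes, `r < 1` and `r > 1`: the sum is controlled by its first term and the
term after its last. -/
theorem geom_sum_le_of_ne_one {r : ℝ} (hr : 0 < r) (hr1 : r ≠ 1) (J : ℕ) :
    ∑ j ∈ Finset.range J, r ^ j ≤ |r - 1|⁻¹ * (1 + r ^ J) := by
  rw [geom_sum_eq hr1, div_eq_inv_mul, ← abs_inv]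
  refine (le_abs_self _).trans ?_
  rw [abs_mul]
  refine mul_le_mul_of_nonneg_left ?_ (abs_nonneg _)
  have := pow_pos hr J
  exact abs_le.2 ⟨by linarith, by linarith⟩

theorem half_le_log (hn : 2 ≤ n) : 1 / 2 ≤ Real.log n := by
  have h1 : Real.log 2 ≤ Real.log n :=
    Real.log_le_log (by norm_num) (by exact_mod_cast hn)
  linarith [Real.log_two_gt_d9]

theorem nat_le_two_mul_log (hd : 1 ≤ d) (h : ((2 : ℝ) ^ J) ^ d ≤ n) :
    (J : ℝ) ≤ 2 * Real.log n := by
  have h1 : (2 : ℝ) ^ J ≤ n :=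
    (le_self_pow₀ (one_le_pow₀ (by norm_num)) (by omega)).trans h
  have h2 := Real.log_le_log (by positivity) h1
  rw [Real.log_pow] at h2
  have h3 := Real.log_two_gt_d9
  have : (0 : ℝ) ≤ J := Nat.cast_nonneg _
  nlinarith

theorem sqrt_div_le_of_le_log (hn : 1 ≤ n) {t : ℝ} (ht : t ≤ 4 * Real.log n) :
    √(t / n) ≤ 2 * √(Real.log n / n) := by
  have e : (2 : ℝ) = √(2 ^ 2) := (Real.sqrt_sq (by norm_num)).symm
  rw [e, ← Real.sqrt_mul (by norm_num)]
  apply Real.sqrt_le_sqrt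
  rw [mul_div_assoc']
  gcongr
  linarith

/-- For `n ≥ 2` this is concentration around the mean. For `n = 1` the logarithm vanishes, but the
rate is still at least one because of the other term in the maximum, and the supremum never exceeds
`2`. -/
theorem lt_sampleLaw_of_rate {D : ℕ} {μ : Measure (EuclideanSpace ℝ (Fin D))}
    [IsProbabilityMeasure μ] (hn : 1 ≤ n) {A M : ℝ} (hA : 0 ≤ A) (hM : 0 ≤ M)
    (h1 : n = 1 → 1 ≤ M) (h2 : 2 ≤ n → √(Real.log n / n) ≤ 2 * M ∧
      ∫⁻ X, empiricalSup γ μ X ∂(sampleLaw n μ) ≤ ENNReal.ofReal (A * M)) :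
    1 - (n : ℝ≥0∞)⁻¹ < sampleLaw n μ {X | empiricalSup γ μ X ≤
      ENNReal.ofReal ((A + 8) * M)} := by
  rcases Nat.lt_or_ge n 2 with h | h
  · have e : n = 1 := by omega
    subst e
    have hM1 := h1 rfl
    have hu : {X : Fin 1 → EuclideanSpace ℝ (Fin D) | empiricalSup γ μ X ≤
        ENNReal.ofReal ((A + 8) * M)} = Set.univ := by
      refine Set.eq_univ_of_forall fun X => (empiricalSup_le_two X).trans
        (ENNReal.ofReal_le_ofReal ?_)
      nlinarith
    have : IsProbabilityMeasure (sampleLaw 1 μ) := by rw [sampleLaw]; infer_instance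
    rw [hu, measure_univ]
    simp
  · obtain ⟨h3, h4⟩ := h2 h
    exact lt_sampleLaw_of_lintegral_empiricalSup_le h (by positivity) h4 (by linarith)

variable {D : ℕ} {α β L : ℝ}

/-- For `γ ≠ d/2` the scales sum to a constant times `√(1/n)` plus `2^(-Jγ)`, whichever end
dominates. For integral `γ = d/2` the Hilbert space bound applies: `d = 2(m+1)`, every scale
contributes exactly `1` under the root, and `√(J/n)` has order `√(log n / n)`. -/
theorem exists_upper_bound (hd : 1 ≤ d) (hβ : 1 < β) (hγ : 0 < γ)
    (h : γ ≠ (d : ℝ) / 2 ∨ ∃ k : ℕ, γ = k) (hL : 0 < L) :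
    ∃ C₁ : ℝ, 0 < C₁ ∧ ∀ μ ∈ PStar d D α β L, ∀ n : ℕ, 1 ≤ n →
      1 - (n : ℝ≥0∞)⁻¹ < sampleLaw n μ {X | empiricalSup γ μ X ≤
        ENNReal.ofReal (C₁ * max √(Real.log n / n) ((n : ℝ) ^ (-(γ / d))))} := by
  obtain ⟨C, ρ, K, hC, hρ, hcov⟩ := exists_chart_cover d D hβ hL
  obtain ⟨A, hA, hbound⟩ := exists_lintegral_empiricalSup_le hC hρ hγ hd D K
  set r : ℝ := (2 : ℝ) ^ ((d : ℝ) / 2 - γ) with hr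
  set c : ℝ := |r - 1|⁻¹ with hc
  have hc0 : 0 ≤ c := by positivity
  refine ⟨A * ((2 + c) * 2 ^ γ + 4 + 2 * c) + 8, by positivity, fun μ hμ n hn => ?_⟩
  have := hμ.1
  obtain ⟨N, ψ, z, hN, hch, hG⟩ := hcov α μ hμ
  set M := max √(Real.log n / n) ((n : ℝ) ^ (-(γ / d))) with hM
  have hM0 : 0 ≤ M := (Real.sqrt_nonneg _).trans (le_max_left _ _)
  refine lt_sampleLaw_of_rate hn (by positivity) hM0 (fun h1 => ?_) fun h2 => ⟨?_, ?_⟩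
  · subst h1
    rw [hM]
    simp
  · linarith [le_max_left √(Real.log n / n) ((n : ℝ) ^ (-(γ / d)))]
  obtain ⟨J, hJ1, hJ2⟩ := exists_dyadic_scale hd hn
  have hn0 : (0 : ℝ) < n := by exact_mod_cast hn
  obtain ⟨hb1, hb2⟩ := hbound μ N ψ z hN hch hG n J hn
  have ha : (2 : ℝ) ^ (-(J * γ)) ≤ 2 ^ γ * M :=
    (two_rpow_neg_le hd hn hγ hJ2).trans
      (mul_le_mul_of_nonneg_left (le_max_right _ _) (by positivity))
  have hlog := half_le_log h2
  have hq : √(1 / n) ≤ 2 * M := (sqrt_div_le_of_le_log hn (by linarith)).trans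
    (mul_le_mul_of_nonneg_left (le_max_left _ _) (by norm_num))
  have hR : √((2 ^ J) ^ d / (n : ℝ)) ≤ 1 := by
    rw [Real.sqrt_le_one, div_le_one hn0]
    exact hJ1
  have ha0 : 0 ≤ (2 : ℝ) ^ (-(J * γ)) := by positivity
  have haR : (2 : ℝ) ^ (-(J * γ)) * √((2 ^ J) ^ d / n) ≤ 2 ^ γ * M :=
    (mul_le_of_le_one_right ha0 hR).trans ha
  by_cases hcrit : γ = (d : ℝ) / 2
  · obtain ⟨k, hk⟩ := h.resolve_left fun h => h hcrit
    have hk0 : k ≠ 0 := by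
      rintro rfl
      rw [hk] at hγ
      simp at hγ
    obtain ⟨m, rfl⟩ := Nat.exists_eq_succ_of_ne_zero hk0
    refine (hb2 m hk).trans (ENNReal.ofReal_le_ofReal ?_)
    rw [mul_assoc]
    refine mul_le_mul_of_nonneg_left ?_ hA.le
    have hdm : d = 2 * (m + 1) := by
      have : (d : ℝ) = 2 * (m + 1 : ℕ) := by
        rw [← Nat.succ_eq_add_one, ← hk, hcrit]; ring
      exact_mod_cast this
    have hsum : ∑ j ∈ Finset.range J, ((2 : ℝ) ^ j) ^ d * (1 / (2 ^ j) ^ (m + 1)) ^ 2 =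
        (J : ℝ) := by
      have : ∀ j ∈ Finset.range J, ((2 : ℝ) ^ j) ^ d * (1 / (2 ^ j) ^ (m + 1)) ^ 2 = 1 := by
        intro j _
        rw [hdm, div_pow, ← pow_mul _ (m + 1) 2, mul_comm 2 (m + 1), one_pow]
        exact mul_one_div_cancel (by positivity)
      rw [Finset.sum_congr rfl this]
      simp
    rw [hsum, inv_mul_eq_div]
    have h3 : √(J / n) ≤ 2 * M := (sqrt_div_le_of_le_log hn (by
      linarith [nat_le_two_mul_log hd hJ1])).trans
        (mul_le_mul_of_nonneg_left (le_max_left _ _) (by norm_num))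
    have h4 : 0 ≤ c * 2 ^ γ * M := by positivity
    have h5 : 0 ≤ c * M := by positivity
    nlinarith
  · refine hb1.trans (ENNReal.ofReal_le_ofReal ?_)
    rw [mul_assoc]
    refine mul_le_mul_of_nonneg_left ?_ hA.le
    have hr0 : 0 < r := by positivity
    have hr1 : r ≠ 1 := by
      intro h1
      have h2 := congrArg Real.log h1
      rw [hr, Real.log_rpow (by norm_num), Real.log_one] at h2
      have h3 := (mul_eq_zero.1 h2).resolve_right (Real.log_pos (by norm_num)).ne'
      exact hcrit (by linarith)
    -- Read off by subtracting the identity `sum_scales_eq` at `J` from the one at `J + 1`.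
    have e1 : √(1 / n) * r ^ J = (2 : ℝ) ^ (-(J * γ)) * √((2 ^ J) ^ d / n) := by
      have h1 := sum_scales_eq (d := d) (n := n) (J := J + 1) (γ := γ)
      rw [Finset.sum_range_succ, Finset.sum_range_succ, sum_scales_eq, mul_add, add_left_cancel_iff]
        at h1
      exact h1.symm
    have h3 : ∑ j ∈ Finset.range J, (2 : ℝ) ^ (-(j * γ)) * √((2 ^ j) ^ d / n) ≤
        c * (2 * M + 2 ^ γ * M) := by
      rw [sum_scales_eq]
      calc √(1 / n) * ∑ j ∈ Finset.range J, r ^ j ≤ √(1 / n) * (c * (1 + r ^ J)) :=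
            mul_le_mul_of_nonneg_left (geom_sum_le_of_ne_one hr0 hr1 J) (Real.sqrt_nonneg _)
        _ = c * (√(1 / n) + √(1 / n) * r ^ J) := by ring
        _ ≤ _ := by
            rw [e1]
            exact mul_le_mul_of_nonneg_left (add_le_add hq haR) hc0
    have h4 : 0 ≤ 2 ^ γ * M := by positivity
    nlinarith

/-- All `J` scales contribute the same amount `√(1/n)`, and `J ≤ 2 log n`. -/
theorem exists_upper_bound_critical (hd : 1 ≤ d) (hβ : 1 < β) (hγ : 0 < γ)
    (h : γ = (d : ℝ) / 2) (hL : 0 < L) :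
    ∃ C₁ : ℝ, 0 < C₁ ∧ ∀ μ ∈ PStar d D α β L, ∀ n : ℕ, 1 ≤ n →
      1 - (n : ℝ≥0∞)⁻¹ < sampleLaw n μ {X | empiricalSup γ μ X ≤
        ENNReal.ofReal (C₁ * max (Real.log n / √n) ((n : ℝ) ^ (-(γ / d))))} := by
  obtain ⟨C, ρ, K, hC, hρ, hcov⟩ := exists_chart_cover d D hβ hL
  obtain ⟨A, hA, hbound⟩ := exists_lintegral_empiricalSup_le hC hρ hγ hd D K
  refine ⟨A * (2 ^ γ + 4) + 8, by positivity, fun μ hμ n hn => ?_⟩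
  have := hμ.1
  obtain ⟨N, ψ, z, hN, hch, hG⟩ := hcov α μ hμ
  set M := max (Real.log n / √n) ((n : ℝ) ^ (-(γ / d))) with hM
  have hM0 : 0 ≤ M := le_trans (by positivity) (le_max_right _ _)
  have hM1 : Real.log n / √n ≤ M := le_max_left _ _
  have hn0 : (0 : ℝ) < n := by exact_mod_cast hn
  have hsn : 0 < √(n : ℝ) := Real.sqrt_pos.2 hn0
  refine lt_sampleLaw_of_rate hn (by positivity) hM0 (fun h1 => ?_) fun h2 => ?_
  · subst h1
    rw [hM]
    simp
  have hlog := half_le_log h2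
  refine ⟨?_, ?_⟩
  · refine le_trans ?_ (mul_le_mul_of_nonneg_left hM1 (by norm_num))
    rw [Real.sqrt_div (by linarith), mul_div_assoc']
    gcongr
    rw [Real.sqrt_le_iff]
    constructor <;> nlinarith
  obtain ⟨J, hJ1, hJ2⟩ := exists_dyadic_scale hd hn
  obtain ⟨hb1, -⟩ := hbound μ N ψ z hN hch hG n J hn
  have ha : (2 : ℝ) ^ (-(J * γ)) ≤ 2 ^ γ * M :=
    (two_rpow_neg_le hd hn hγ hJ2).trans
      (mul_le_mul_of_nonneg_left (le_max_right _ _) (by positivity))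
  have hscale : ∀ t : ℝ, t ≤ 2 * Real.log n → √(1 / n) * t ≤ 2 * M := by
    intro t ht
    rw [Real.sqrt_div zero_le_one, Real.sqrt_one, one_div, inv_mul_eq_div]
    refine le_trans ?_ (mul_le_mul_of_nonneg_left hM1 (by norm_num))
    rw [mul_div_assoc']
    gcongr
  have hq : √(1 / n) ≤ 2 * M := by
    have := hscale 1 (by linarith)
    rwa [mul_one] at this
  refine hb1.trans (ENNReal.ofReal_le_ofReal ?_)
  rw [mul_assoc]
  refine mul_le_mul_of_nonneg_left ?_ hA.le
  have h3 : ∑ j ∈ Finset.range J, (2 : ℝ) ^ (-(j * γ)) * √((2 ^ j) ^ d / n) ≤ 2 * M := by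
    rw [sum_scales_eq, h]
    simpa using hscale J (nat_le_two_mul_log hd hJ1)
  linarith

end rates

/-! ### Gnomonic coordinates of the sphere. -/

section gnomonic

variable {d k D : ℕ}

theorem norm_padZero (h : k ≤ D) (x : EuclideanSpace ℝ (Fin k)) : ‖padZero D x‖ = ‖x‖ := by
  obtain ⟨r, rfl⟩ := Nat.exists_eq_add_of_le h
  rw [EuclideanSpace.norm_eq, EuclideanSpace.norm_eq, Fin.sum_univ_add]
  congr 1
  simp [padZero]

/-- The inclusion `ℝ^k → ℝ^D` as a linear isometry. -/
def padIsometry (h : k ≤ D) : EuclideanSpace ℝ (Fin k) →ₗᵢ[ℝ] EuclideanSpace ℝ (Fin D) where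
  toFun := padZero D
  map_add' x y := by
    ext i
    by_cases hi : (i : ℕ) < k <;> simp [padZero, hi]
  map_smul' c x := by
    ext i
    by_cases hi : (i : ℕ) < k <;> simp [padZero, hi]
  norm_map' := norm_padZero h

/-- The projection `ℝ^D → ℝ^k` onto the first coordinates. -/
def firstCoords (h : k ≤ D) (x : EuclideanSpace ℝ (Fin D)) : EuclideanSpace ℝ (Fin k) :=
  WithLp.toLp 2 fun i => x (Fin.castLE h i)

theorem continuous_firstCoords (h : k ≤ D) : Continuous (firstCoords (D := D) h) :=
  (PiLp.continuous_toLp 2 _).comp (continuous_pi fun i => by fun_prop)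

theorem firstCoords_padIsometry (h : k ≤ D) (x : EuclideanSpace ℝ (Fin k)) :
    firstCoords h (padIsometry h x) = x := by
  ext i
  simp [firstCoords, padIsometry, padZero]

/-- The point `(t, z)` of `ℝ × ℝ^d`. -/
def consPoint (t : ℝ) (z : EuclideanSpace ℝ (Fin d)) : EuclideanSpace ℝ (Fin (d + 1)) :=
  WithLp.toLp 2 (Fin.cons t z.ofLp)

/-- The last `d` coordinates. -/
def tailPoint : EuclideanSpace ℝ (Fin (d + 1)) →L[ℝ] EuclideanSpace ℝ (Fin d) :=
  LinearMap.toContinuousLinearMap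
    { toFun := fun y => WithLp.toLp 2 fun i => y i.succ
      map_add' := fun x y => by ext i; simp
      map_smul' := fun c x => by ext i; simp }

@[simp] theorem tailPoint_apply (y : EuclideanSpace ℝ (Fin (d + 1))) (i : Fin d) :
    tailPoint y i = y i.succ := rfl

@[simp] theorem consPoint_zero (t : ℝ) (z : EuclideanSpace ℝ (Fin d)) : consPoint t z 0 = t := rfl

@[simp] theorem tailPoint_consPoint (t : ℝ) (z : EuclideanSpace ℝ (Fin d)) :
    tailPoint (consPoint t z) = z := by
  ext i
  simp [consPoint]

theorem consPoint_tailPoint (y : EuclideanSpace ℝ (Fin (d + 1))) :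
    consPoint (y 0) (tailPoint y) = y := by
  ext i
  refine Fin.cases ?_ (fun j => ?_) i <;> simp [consPoint]

theorem norm_consPoint_sq (t : ℝ) (z : EuclideanSpace ℝ (Fin d)) :
    ‖consPoint t z‖ ^ 2 = t ^ 2 + ‖z‖ ^ 2 := by
  rw [EuclideanSpace.norm_sq_eq, EuclideanSpace.norm_sq_eq, Fin.sum_univ_succ]
  simp [consPoint]

theorem norm_sq_eq_tailPoint (y : EuclideanSpace ℝ (Fin (d + 1))) :
    ‖y‖ ^ 2 = y 0 ^ 2 + ‖tailPoint y‖ ^ 2 := by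
  conv_lhs => rw [← consPoint_tailPoint y]
  exact norm_consPoint_sq _ _

/-- Central projection of the tangent plane to the sphere. -/
def gnomonic (z : EuclideanSpace ℝ (Fin d)) : EuclideanSpace ℝ (Fin (d + 1)) :=
  (√(1 + ‖z‖ ^ 2))⁻¹ • consPoint 1 z

theorem gnomonic_zero_pos (z : EuclideanSpace ℝ (Fin d)) : 0 < gnomonic z 0 := by
  simp only [gnomonic, PiLp.smul_apply, consPoint_zero, smul_eq_mul, mul_one]
  positivity

theorem gnomonic_zero (z : EuclideanSpace ℝ (Fin d)) : gnomonic z 0 = (√(1 + ‖z‖ ^ 2))⁻¹ := by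
  simp [gnomonic]

theorem tailPoint_gnomonic (z : EuclideanSpace ℝ (Fin d)) :
    tailPoint (gnomonic z) = gnomonic z 0 • z := by
  rw [gnomonic_zero, gnomonic, map_smul, tailPoint_consPoint]

theorem norm_gnomonic (z : EuclideanSpace ℝ (Fin d)) : ‖gnomonic z‖ = 1 := by
  have h1 : ‖consPoint 1 z‖ = √(1 + ‖z‖ ^ 2) := by
    rw [← Real.sqrt_sq (norm_nonneg (consPoint 1 z)), norm_consPoint_sq, one_pow]
  rw [gnomonic, norm_smul, h1, norm_inv, Real.norm_of_nonneg (Real.sqrt_nonneg _)]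
  exact inv_mul_cancel₀ (Real.sqrt_pos.2 (by positivity)).ne'

theorem contDiff_consPoint_one {n : WithTop ℕ∞} :
    ContDiff ℝ n (consPoint 1 : EuclideanSpace ℝ (Fin d) → _) := by
  rw [contDiff_euclidean]
  intro i
  refine Fin.cases ?_ (fun j => ?_) i
  · simpa using contDiff_const
  · have : ContDiff ℝ n fun z : EuclideanSpace ℝ (Fin d) => z j :=
      (EuclideanSpace.proj j : EuclideanSpace ℝ (Fin d) →L[ℝ] ℝ).contDiff
    simpa [consPoint] using this

theorem contDiff_gnomonic {n : WithTop ℕ∞} :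
    ContDiff ℝ n (gnomonic : EuclideanSpace ℝ (Fin d) → _) := by
  refine ContDiff.smul (ContDiff.inv (ContDiff.sqrt ?_ fun z => by positivity)
    fun z => (Real.sqrt_pos.2 (by positivity)).ne') contDiff_consPoint_one
  exact contDiff_const.add (contDiff_norm_sq ℝ)

/-- The inverse of the central projection, on the half space `y 0 > 0`. -/
def gnomonicInv (y : EuclideanSpace ℝ (Fin (d + 1))) : EuclideanSpace ℝ (Fin d) :=
  (y 0)⁻¹ • tailPoint y

theorem gnomonicInv_gnomonic (z : EuclideanSpace ℝ (Fin d)) : gnomonicInv (gnomonic z) = z := by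
  rw [gnomonicInv, tailPoint_gnomonic, smul_smul, inv_mul_cancel₀ (gnomonic_zero_pos z).ne',
    one_smul]

theorem one_add_norm_gnomonicInv_sq {y : EuclideanSpace ℝ (Fin (d + 1))} (hy : ‖y‖ = 1)
    (h0 : 0 < y 0) : 1 + ‖gnomonicInv y‖ ^ 2 = (y 0)⁻¹ ^ 2 := by
  have h1 := norm_sq_eq_tailPoint y
  rw [hy] at h1
  rw [gnomonicInv, norm_smul, mul_pow, norm_inv, Real.norm_of_nonneg h0.le]
  field_simp
  linarith

theorem gnomonic_gnomonicInv {y : EuclideanSpace ℝ (Fin (d + 1))} (hy : ‖y‖ = 1) (h0 : 0 < y 0) :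
    gnomonic (gnomonicInv y) = y := by
  have h1 : gnomonic (gnomonicInv y) 0 = y 0 := by
    rw [gnomonic_zero, one_add_norm_gnomonicInv_sq hy h0, Real.sqrt_sq (by positivity), inv_inv]
  rw [← consPoint_tailPoint (gnomonic _), tailPoint_gnomonic, h1, gnomonicInv, smul_smul,
    mul_inv_cancel₀ h0.ne', one_smul, consPoint_tailPoint]

theorem mem_ball_gnomonicInv_iff {y : EuclideanSpace ℝ (Fin (d + 1))} (hy : ‖y‖ = 1)
    (h0 : 0 < y 0) : gnomonicInv y ∈ Metric.ball (0 : EuclideanSpace ℝ (Fin d)) 1 ↔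
      1 < 2 * y 0 ^ 2 := by
  have h1 := one_add_norm_gnomonicInv_sq hy h0
  rw [mem_ball_zero_iff, ← sq_lt_one_iff₀ (norm_nonneg _)]
  have h2 : (y 0)⁻¹ ^ 2 * y 0 ^ 2 = 1 := by
    rw [← mul_pow, inv_mul_cancel₀ h0.ne', one_pow]
  have h3 : 0 < y 0 ^ 2 := by positivity
  rw [← h1] at h2
  constructor <;> intro h <;> nlinarith

theorem continuousOn_gnomonicInv :
    ContinuousOn (gnomonicInv (d := d)) {y | 0 < y 0} := by
  have h1 : Continuous fun y : EuclideanSpace ℝ (Fin (d + 1)) => y 0 := by fun_prop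
  exact ContinuousOn.smul (h1.continuousOn.inv₀ fun y hy => (ne_of_gt hy))
    tailPoint.continuous.continuousOn

/-- Differentiate `tailPoint (gnomonic z) = gnomonic z 0 • z` and solve for the term with `v`: since
`‖z‖ ≤ 1` it is at most `2 ‖u‖`, where `u` is the derivative applied to `v`, and `gnomonic z 0 ≥
1/2` gives the constant `4`. -/
theorem norm_le_norm_fderiv_gnomonic {z : EuclideanSpace ℝ (Fin d)} (hz : ‖z‖ ≤ 1)
    (v : EuclideanSpace ℝ (Fin d)) : ‖v‖ ≤ 4 * ‖fderiv ℝ gnomonic z v‖ := by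
  have hg : HasFDerivAt (gnomonic : EuclideanSpace ℝ (Fin d) → _) (fderiv ℝ gnomonic z) z :=
    ((contDiff_gnomonic (n := 1)).differentiable (by norm_num) z).hasFDerivAt
  set u := fderiv ℝ gnomonic z v with hu
  have h1 := (tailPoint (d := d)).hasFDerivAt.comp z hg
  have h2 : HasFDerivAt (fun w : EuclideanSpace ℝ (Fin d) => gnomonic w 0)
      ((EuclideanSpace.proj (0 : Fin (d + 1)) : EuclideanSpace ℝ (Fin (d + 1)) →L[ℝ] ℝ).comp
        (fderiv ℝ gnomonic z)) z :=
    ((EuclideanSpace.proj (0 : Fin (d + 1)) :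
      EuclideanSpace ℝ (Fin (d + 1)) →L[ℝ] ℝ).hasFDerivAt).comp z hg
  have h3 := h2.smul (hasFDerivAt_id z)
  have h4 : (tailPoint ∘ gnomonic : EuclideanSpace ℝ (Fin d) → _) =
      fun w => gnomonic w 0 • id w := by
    funext w
    exact tailPoint_gnomonic w
  rw [h4] at h1
  have h5 := congrArg (fun T => T v) (h1.unique h3)
  change tailPoint u = gnomonic z 0 • v + u 0 • z at h5
  have hb : ‖tailPoint u‖ ≤ ‖u‖ := by
    have := norm_sq_eq_tailPoint u
    exact abs_le_of_sq_le_sq (by nlinarith [sq_nonneg (u 0)]) (norm_nonneg _) |> (le_abs_self _).trans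
  have h0 : |u 0| ≤ ‖u‖ := PiLp.norm_apply_le u 0
  have h6 : ‖gnomonic z 0 • v‖ ≤ 2 * ‖u‖ := by
    rw [eq_sub_of_add_eq h5.symm]
    refine (norm_sub_le _ _).trans ?_
    rw [norm_smul, Real.norm_eq_abs]
    nlinarith [abs_nonneg (u 0), norm_nonneg z]
  have h7 : 1 / 2 ≤ gnomonic z 0 := by
    rw [gnomonic_zero, one_div]
    have h8 : √(1 + ‖z‖ ^ 2) ≤ 2 := by
      rw [Real.sqrt_le_iff]
      constructor <;> nlinarith [norm_nonneg z]
    exact inv_anti₀ (Real.sqrt_pos.2 (by positivity)) h8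
  rw [norm_smul, Real.norm_of_nonneg (gnomonic_zero_pos z).le] at h6
  nlinarith [norm_nonneg v]

theorem exists_norm_iteratedFDeriv_gnomonic_le (d m : ℕ) : ∃ B : ℝ, 0 < B ∧ ∀ k ≤ m,
    ∀ z ∈ Metric.ball (0 : EuclideanSpace ℝ (Fin d)) 1,
      ‖iteratedFDeriv ℝ k (gnomonic (d := d)) z‖ ≤ B := by
  have h1 : ∀ k, ∃ B, ∀ z ∈ Metric.closedBall (0 : EuclideanSpace ℝ (Fin d)) 1,
      ‖iteratedFDeriv ℝ k (gnomonic (d := d)) z‖ ≤ B := fun k =>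
    (isCompact_closedBall _ _).exists_bound_of_continuousOn
      ((contDiff_gnomonic (n := k)).continuous_iteratedFDeriv le_rfl).continuousOn
  choose B hB using h1
  refine ⟨∑ k ∈ Finset.range (m + 1), |B k| + 1,
    by have := Finset.sum_nonneg fun k (_ : k ∈ Finset.range (m + 1)) => abs_nonneg (B k); linarith,
    fun k hk z hz => ?_⟩
  have h2 := Finset.single_le_sum (f := fun k => |B k|) (fun k _ => abs_nonneg (B k))
    (Finset.mem_range.2 (Nat.lt_succ_of_le hk))
  have h3 := hB k z (Metric.ball_subset_closedBall hz)
  have h4 := le_abs_self (B k)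
  linarith

/-- Isometric images of the gnomonic parametrization are uniformly Hölder regular. -/
theorem exists_gnomonic_mem_holderBallVec (d D : ℕ) {β : ℝ} (hβ : 0 ≤ β) :
    ∃ R : ℝ, ∀ T : EuclideanSpace ℝ (Fin (d + 1)) →ₗᵢ[ℝ] EuclideanSpace ℝ (Fin D),
      (fun z => T (gnomonic z)) ∈
        holderBallVec β R (Metric.ball (0 : EuclideanSpace ℝ (Fin d)) 1) := by
  obtain ⟨B, hB, hbound⟩ := exists_norm_iteratedFDeriv_gnomonic_le d (⌊β⌋₊ + 1)
  refine ⟨holderCount d ⌊β⌋₊ * (2 * B), fun T j => ?_⟩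
  set f : EuclideanSpace ℝ (Fin d) → ℝ := fun z => T (gnomonic z) j with hf
  set P : EuclideanSpace ℝ (Fin (d + 1)) →L[ℝ] ℝ :=
    (EuclideanSpace.proj j : EuclideanSpace ℝ (Fin D) →L[ℝ] ℝ).comp T.toContinuousLinearMap
    with hP
  have hPn : ‖P‖ ≤ 1 := P.opNorm_le_bound zero_le_one fun v => by
    rw [one_mul, ← T.norm_map v]
    exact PiLp.norm_apply_le (T v) j
  have hfP : f = P ∘ gnomonic := rfl
  have hfc : ∀ n : WithTop ℕ∞, ContDiff ℝ n f := fun n => P.contDiff.comp contDiff_gnomonic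
  have hfb : ∀ k ≤ ⌊β⌋₊ + 1, ∀ z ∈ Metric.ball (0 : EuclideanSpace ℝ (Fin d)) 1,
      ‖iteratedFDeriv ℝ k f z‖ ≤ B := by
    intro k hk z hz
    rw [hfP]
    refine (P.norm_iteratedFDeriv_comp_left (N := k) contDiff_gnomonic.contDiffAt le_rfl).trans ?_
    exact (mul_le_of_le_one_left (norm_nonneg _) hPn).trans (hbound k hk z hz)
  refine mem_holderBall_of_norm_iteratedFDeriv_le Metric.isOpen_ball (hfc _).contDiffOn
    (fun k hk z hz => (hfb k (by omega) z hz).trans (by linarith)) fun x hx y hy hxy => ?_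
  have h1 : ‖iteratedFDeriv ℝ ⌊β⌋₊ f x - iteratedFDeriv ℝ ⌊β⌋₊ f y‖ ≤ B * ‖x - y‖ := by
    refine (convex_ball (0 : EuclideanSpace ℝ (Fin d)) 1).norm_image_sub_le_of_norm_fderiv_le
      (𝕜 := ℝ) (fun z _ => ?_) (fun z hz => ?_) hy hx
    · exact ((hfc (⌊β⌋₊ + 1 : ℕ)).differentiable_iteratedFDeriv (by norm_cast; omega)) z
    · rw [norm_fderiv_iteratedFDeriv]
      exact hfb _ le_rfl z hz
  refine h1.trans ?_
  have hxy0 : 0 < ‖x - y‖ := norm_pos_iff.2 (sub_ne_zero.2 hxy)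
  have hxy2 : ‖x - y‖ ≤ 2 := by
    refine (norm_sub_le _ _).trans ?_
    linarith [mem_ball_zero_iff.1 hx, mem_ball_zero_iff.1 hy]
  have hθ0 : 0 ≤ β - ⌊β⌋₊ := sub_nonneg.2 (Nat.floor_le hβ)
  have hθ1 : β - ⌊β⌋₊ ≤ 1 := by linarith [Nat.lt_floor_add_one β]
  -- The unit ball has diameter `2`, so a Lipschitz bound yields the Hölder bound at the cost of a
  -- factor at most `2`.
  have h2 : ‖x - y‖ ≤ 2 * ‖x - y‖ ^ (β - ⌊β⌋₊) := by
    calc ‖x - y‖ = ‖x - y‖ ^ (1 - (β - ⌊β⌋₊)) * ‖x - y‖ ^ (β - ⌊β⌋₊) := by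
          rw [← Real.rpow_add hxy0, sub_add_cancel, Real.rpow_one]
      _ ≤ 2 * ‖x - y‖ ^ (β - ⌊β⌋₊) := by
          refine mul_le_mul_of_nonneg_right ?_ (by positivity)
          calc ‖x - y‖ ^ (1 - (β - ⌊β⌋₊)) ≤ 2 ^ (1 - (β - ⌊β⌋₊)) :=
                Real.rpow_le_rpow hxy0.le hxy2 (by linarith)
            _ ≤ 2 ^ (1 : ℝ) := Real.rpow_le_rpow_of_exponent_le (by norm_num) (by linarith)
            _ = 2 := Real.rpow_one 2
  nlinarith

end gnomonic

/-! ### The regular atlas of the sphere. -/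

section atlas

variable {d D : ℕ}

/-- The unit sphere of dimension `d` in the first `d + 1` coordinates of `ℝ^D`. -/
def sphereSet (h : d + 1 ≤ D) : Set (EuclideanSpace ℝ (Fin D)) :=
  padIsometry h '' Metric.sphere (0 : EuclideanSpace ℝ (Fin (d + 1))) 1

variable {h : d + 1 ≤ D}

theorem isCompact_sphereSet : IsCompact (sphereSet h) :=
  (isCompact_sphere _ _).image (padIsometry h).continuous

theorem norm_firstCoords (x : sphereSet h) :
    ‖firstCoords h (x : EuclideanSpace ℝ (Fin D))‖ = 1 := by
  obtain ⟨_, y, hy, rfl⟩ := x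
  simpa [firstCoords_padIsometry] using hy

theorem padIsometry_firstCoords (x : sphereSet h) :
    padIsometry h (firstCoords h (x : EuclideanSpace ℝ (Fin D))) = x := by
  obtain ⟨_, y, hy, rfl⟩ := x
  simp [firstCoords_padIsometry]

/-- The point of the sphere with given gnomonic coordinate. -/
def spherePoint (h : d + 1 ≤ D)
    (Q : EuclideanSpace ℝ (Fin (d + 1)) ≃ₗᵢ[ℝ] EuclideanSpace ℝ (Fin (d + 1)))
    (z : EuclideanSpace ℝ (Fin d)) : sphereSet h :=
  ⟨padIsometry h (Q (gnomonic z)), Q (gnomonic z), by simp [norm_gnomonic], rfl⟩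

theorem symm_firstCoords_spherePoint
    (Q : EuclideanSpace ℝ (Fin (d + 1)) ≃ₗᵢ[ℝ] EuclideanSpace ℝ (Fin (d + 1)))
    (z : EuclideanSpace ℝ (Fin d)) :
    Q.symm (firstCoords h (spherePoint h Q z : EuclideanSpace ℝ (Fin D))) = gnomonic z := by
  simp [spherePoint, firstCoords_padIsometry]

theorem continuous_symm_firstCoords
    (Q : EuclideanSpace ℝ (Fin (d + 1)) ≃ₗᵢ[ℝ] EuclideanSpace ℝ (Fin (d + 1))) :
    Continuous fun x : sphereSet h => Q.symm (firstCoords h (x : EuclideanSpace ℝ (Fin D))) :=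
  Q.symm.continuous.comp ((continuous_firstCoords h).comp continuous_subtype_val)

/-- Gnomonic charts of the sphere, turned by a linear isometry. -/
def sphereChart (h : d + 1 ≤ D)
    (Q : EuclideanSpace ℝ (Fin (d + 1)) ≃ₗᵢ[ℝ] EuclideanSpace ℝ (Fin (d + 1))) :
    OpenPartialHomeomorph (sphereSet h) (EuclideanSpace ℝ (Fin d)) where
  toFun x := gnomonicInv (Q.symm (firstCoords h (x : EuclideanSpace ℝ (Fin D))))
  invFun := spherePoint h Q
  source := {x | 0 < Q.symm (firstCoords h (x : EuclideanSpace ℝ (Fin D))) 0 ∧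
    1 < 2 * (Q.symm (firstCoords h (x : EuclideanSpace ℝ (Fin D))) 0) ^ 2}
  target := Metric.ball 0 1
  map_source' x hx := (mem_ball_gnomonicInv_iff
    (by rw [LinearIsometryEquiv.norm_map, norm_firstCoords]) hx.1).2 hx.2
  map_target' z hz := by
    have h0 := gnomonic_zero_pos z
    change 0 < Q.symm _ 0 ∧ 1 < 2 * (Q.symm _ 0) ^ 2
    rw [symm_firstCoords_spherePoint]
    refine ⟨h0, (mem_ball_gnomonicInv_iff (norm_gnomonic z) h0).1 ?_⟩
    rwa [gnomonicInv_gnomonic]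
  left_inv' x hx := by
    apply Subtype.ext
    change padIsometry h (Q (gnomonic (gnomonicInv _))) = x
    rw [gnomonic_gnomonicInv (by rw [LinearIsometryEquiv.norm_map, norm_firstCoords]) hx.1,
      LinearIsometryEquiv.apply_symm_apply, padIsometry_firstCoords]
  right_inv' z hz := by
    rw [symm_firstCoords_spherePoint, gnomonicInv_gnomonic]
  open_source := by
    have h1 : Continuous fun x : sphereSet h =>
        Q.symm (firstCoords h (x : EuclideanSpace ℝ (Fin D))) 0 :=
      (EuclideanSpace.proj (0 : Fin (d + 1)) :
        EuclideanSpace ℝ (Fin (d + 1)) →L[ℝ] ℝ).continuous.comp (continuous_symm_firstCoords Q)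
    exact (isOpen_lt continuous_const h1).inter
      (isOpen_lt continuous_const (continuous_const.mul (h1.pow 2)))
  open_target := Metric.isOpen_ball
  continuousOn_toFun := continuousOn_gnomonicInv.comp
    (continuous_symm_firstCoords Q).continuousOn fun x hx => hx.1
  continuousOn_invFun := by
    refine Continuous.continuousOn ?_
    refine Continuous.subtype_mk ?_ _
    exact (padIsometry h).continuous.comp (Q.continuous.comp (contDiff_gnomonic (n := 0)).continuous)

theorem chartInv_sphereChart
    (Q : EuclideanSpace ℝ (Fin (d + 1)) ≃ₗᵢ[ℝ] EuclideanSpace ℝ (Fin (d + 1))) :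
    chartInv (sphereChart h Q) =
      fun z => ((padIsometry h).comp Q.toLinearIsometry) (gnomonic z) := rfl

theorem fderiv_chartInv_sphereChart
    (Q : EuclideanSpace ℝ (Fin (d + 1)) ≃ₗᵢ[ℝ] EuclideanSpace ℝ (Fin (d + 1)))
    (z v : EuclideanSpace ℝ (Fin d)) :
    fderiv ℝ (chartInv (sphereChart h Q)) z v =
      ((padIsometry h).comp Q.toLinearIsometry) (fderiv ℝ gnomonic z v) := by
  have hg : HasFDerivAt (gnomonic : EuclideanSpace ℝ (Fin d) → _) (fderiv ℝ gnomonic z) z :=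
    ((contDiff_gnomonic (n := 1)).differentiable (by norm_num) z).hasFDerivAt
  have h1 := (((padIsometry h).comp Q.toLinearIsometry).toContinuousLinearMap.hasFDerivAt).comp z hg
  rw [chartInv_sphereChart]
  exact congrArg (fun T => T v) h1.fderiv

theorem exists_isometry_map_eq {b : EuclideanSpace ℝ (Fin (d + 1))} (hb : ‖b‖ = 1) :
    ∃ Q : EuclideanSpace ℝ (Fin (d + 1)) ≃ₗᵢ[ℝ] EuclideanSpace ℝ (Fin (d + 1)),
      Q.symm b = consPoint 1 0 := by
  have he : ‖consPoint 1 (0 : EuclideanSpace ℝ (Fin d))‖ = 1 := by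
    have h1 := norm_consPoint_sq 1 (0 : EuclideanSpace ℝ (Fin d))
    rw [norm_zero] at h1
    nlinarith [norm_nonneg (consPoint 1 (0 : EuclideanSpace ℝ (Fin d)))]
  refine ⟨(ℝ ∙ (consPoint 1 0 - b))ᗮ.reflection, ?_⟩
  rw [LinearIsometryEquiv.symm_apply_eq]
  exact (Submodule.reflection_sub (he.trans hb.symm)).symm

/-- The chart is centred at `x`. A point of the sphere within `1/4` of `x` has first rotated
coordinate at least `3/4`, and `2 (3/4)² > 1` is the condition for lying in the domain of the chart.
-/
theorem closedBall_subset_source {L : ℝ} (hL : 4 ≤ L)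
    {Q : EuclideanSpace ℝ (Fin (d + 1)) ≃ₗᵢ[ℝ] EuclideanSpace ℝ (Fin (d + 1))}
    {x : sphereSet h}
    (hQ : Q.symm (firstCoords h (x : EuclideanSpace ℝ (Fin D))) = consPoint 1 0) :
    Metric.closedBall x (1 / L) ⊆ (sphereChart h Q).source ∧
      Metric.closedBall (sphereChart h Q x) (1 / L) ⊆ (sphereChart h Q).target := by
  have hL4 : 1 / L ≤ 1 / 4 := one_div_le_one_div_of_le (by norm_num) hL
  constructor
  · intro x' hx'
    have h1 : ‖firstCoords h (x' : EuclideanSpace ℝ (Fin D)) -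
        firstCoords h (x : EuclideanSpace ℝ (Fin D))‖ ≤ 1 / 4 := by
      rw [← (padIsometry h).norm_map, map_sub, padIsometry_firstCoords, padIsometry_firstCoords,
        ← dist_eq_norm]
      exact (Metric.mem_closedBall.1 hx').trans hL4
    have h2 : |Q.symm (firstCoords h (x' : EuclideanSpace ℝ (Fin D))) 0 - 1| ≤ 1 / 4 := by
      refine le_trans ?_ h1
      rw [← Q.symm.norm_map, map_sub, hQ]
      exact PiLp.norm_apply_le (Q.symm (firstCoords h (x' : EuclideanSpace ℝ (Fin D))) -
        consPoint 1 0) 0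
    have h3 := abs_le.1 h2
    change 0 < Q.symm _ 0 ∧ 1 < 2 * (Q.symm _ 0) ^ 2
    constructor <;> nlinarith
  · have h1 : sphereChart h Q x = 0 := by
      change gnomonicInv (Q.symm _) = 0
      rw [hQ, gnomonicInv, tailPoint_consPoint, smul_zero]
    rw [h1]
    change _ ⊆ Metric.ball 0 1
    exact Metric.closedBall_subset_ball (by linarith)

theorem exists_isRegularAtlas_sphereChart {β : ℝ} (hβ : 0 ≤ β) (h : d + 1 ≤ D) :
    ∃ L₀ : ℝ, 0 < L₀ ∧ ∀ L, L₀ ≤ L →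
      IsRegularAtlas β L (sphereSet h) (Set.range (sphereChart h)) := by
  obtain ⟨R, hR⟩ := exists_gnomonic_mem_holderBallVec d D hβ
  refine ⟨max 4 R, by positivity, fun L hL => ?_⟩
  have hL4 : 4 ≤ L := (le_max_left _ _).trans hL
  have hballs : ∀ x : sphereSet h, ∃ φ ∈ Set.range (sphereChart h),
      Metric.closedBall x (1 / L) ⊆ φ.source ∧ Metric.closedBall (φ x) (1 / L) ⊆ φ.target := by
    intro x
    obtain ⟨Q, hQ⟩ := exists_isometry_map_eq (norm_firstCoords x)
    exact ⟨sphereChart h Q, ⟨Q, rfl⟩, closedBall_subset_source hL4 hQ⟩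
  refine ⟨fun x => ?_, ?_, ?_, hballs⟩
  · obtain ⟨φ, hφ, h1, -⟩ := hballs x
    exact ⟨φ, hφ, h1 (Metric.mem_closedBall_self (by positivity))⟩
  · rintro _ ⟨Q, rfl⟩ j
    rw [chartInv_sphereChart]
    exact holderBall_mono ((le_max_right _ _).trans hL) (hR _ j)
  · rintro _ ⟨Q, rfl⟩ z hz v
    rw [fderiv_chartInv_sphereChart, LinearIsometry.norm_map]
    have h1 := norm_le_norm_fderiv_gnomonic (mem_ball_zero_iff.1 hz).le v
    rw [one_div, inv_mul_le_iff₀ (by linarith)]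
    exact h1.trans (mul_le_mul_of_nonneg_right hL4 (norm_nonneg _))

theorem const_mem_holderBall {α c : ℝ} (Ω : Set (EuclideanSpace ℝ (Fin d))) (hΩ : IsOpen Ω)
    (hc : 0 ≤ c) : (fun _ => c) ∈ holderBall α (holderCount d ⌊α⌋₊ * c) Ω := by
  refine mem_holderBall_of_norm_iteratedFDeriv_le hΩ contDiffOn_const (fun k _ x _ => ?_)
    fun x _ y _ _ => ?_
  · rcases Nat.eq_zero_or_pos k with rfl | hk
    · rw [norm_iteratedFDeriv_zero, Real.norm_of_nonneg hc]
    · rw [iteratedFDeriv_const_of_ne hk.ne']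
      simpa using hc
  · have : iteratedFDeriv ℝ ⌊α⌋₊ (fun _ : EuclideanSpace ℝ (Fin d) => c) x =
        iteratedFDeriv ℝ ⌊α⌋₊ (fun _ : EuclideanSpace ℝ (Fin d) => c) y := by
      rcases Nat.eq_zero_or_pos ⌊α⌋₊ with h0 | h0
      · rw [h0]; ext; simp
      · rw [iteratedFDeriv_const_of_ne h0.ne']; rfl
    rw [this, sub_self, norm_zero]
    positivity

end atlas

/-! ### The volume measure of the sphere. -/

section sphere_volume

variable {d D k : ℕ}

theorem jacobianMatrix_transpose_mul_apply
    (ψ : EuclideanSpace ℝ (Fin d) → EuclideanSpace ℝ (Fin D)) (z : EuclideanSpace ℝ (Fin d))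
    (i j : Fin d) :
    ((jacobianMatrix ψ z).transpose * jacobianMatrix ψ z) i j =
      inner ℝ (fderiv ℝ ψ z (EuclideanSpace.single i 1))
        (fderiv ℝ ψ z (EuclideanSpace.single j 1)) := by
  simp [Matrix.mul_apply, jacobianMatrix, PiLp.inner_apply, mul_comm]

theorem det_fderiv_eq_det_jacobianMatrix
    (ψ : EuclideanSpace ℝ (Fin d) → EuclideanSpace ℝ (Fin d)) (z : EuclideanSpace ℝ (Fin d)) :
    (fderiv ℝ ψ z).det = (jacobianMatrix ψ z).det := by
  rw [ContinuousLinearMap.det,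
    ← LinearMap.det_toMatrix (EuclideanSpace.basisFun (Fin d) ℝ).toBasis]
  congr 1

theorem jacobian_chartInv_sphereChart (h : d + 1 ≤ D)
    (Q : EuclideanSpace ℝ (Fin (d + 1)) ≃ₗᵢ[ℝ] EuclideanSpace ℝ (Fin (d + 1)))
    (z : EuclideanSpace ℝ (Fin d)) :
    (jacobianMatrix (chartInv (sphereChart h Q)) z).transpose *
        jacobianMatrix (chartInv (sphereChart h Q)) z =
      (jacobianMatrix gnomonic z).transpose * jacobianMatrix gnomonic z := by
  ext i j
  rw [jacobianMatrix_transpose_mul_apply, jacobianMatrix_transpose_mul_apply,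
    fderiv_chartInv_sphereChart, fderiv_chartInv_sphereChart, LinearIsometry.inner_map_map]

/-- The cone parametrization `(t, z) ↦ t • gnomonic z`. -/
def gnomonicCone (w : EuclideanSpace ℝ (Fin (d + 1))) : EuclideanSpace ℝ (Fin (d + 1)) :=
  w 0 • gnomonic (tailPoint w)

theorem hasFDerivAt_gnomonic (z : EuclideanSpace ℝ (Fin d)) :
    HasFDerivAt gnomonic (fderiv ℝ gnomonic z) z :=
  ((contDiff_gnomonic (n := 1)).differentiable (by norm_num) z).hasFDerivAt

theorem differentiable_gnomonicCone : Differentiable ℝ (gnomonicCone (d := d)) := fun w =>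
  ((EuclideanSpace.proj (0 : Fin (d + 1)) :
      EuclideanSpace ℝ (Fin (d + 1)) →L[ℝ] ℝ).differentiableAt.smul
    ((hasFDerivAt_gnomonic _).differentiableAt.comp w tailPoint.differentiableAt) :)

theorem fderiv_gnomonicCone_apply (w v : EuclideanSpace ℝ (Fin (d + 1))) :
    fderiv ℝ gnomonicCone w v =
      w 0 • fderiv ℝ gnomonic (tailPoint w) (tailPoint v) + v 0 • gnomonic (tailPoint w) := by
  have h1 := ((EuclideanSpace.proj (0 : Fin (d + 1)) :
      EuclideanSpace ℝ (Fin (d + 1)) →L[ℝ] ℝ).hasFDerivAt (x := w)).smul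
    ((hasFDerivAt_gnomonic _).comp w tailPoint.hasFDerivAt)
  exact congrArg (fun T => T v) (HasFDerivAt.fderiv (f := gnomonicCone) h1)

theorem inner_gnomonic_fderiv (z v : EuclideanSpace ℝ (Fin d)) :
    inner ℝ (gnomonic z) (fderiv ℝ gnomonic z v) = 0 := by
  have h1 := (hasFDerivAt_gnomonic z).inner ℝ (hasFDerivAt_gnomonic z)
  have h2 : (fun z : EuclideanSpace ℝ (Fin d) => inner ℝ (gnomonic z) (gnomonic z)) =
      fun _ => (1 : ℝ) := by
    funext z
    rw [real_inner_self_eq_norm_sq, norm_gnomonic, one_pow]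
  rw [h2] at h1
  have h3 := congrArg (fun T => T v) (h1.unique (hasFDerivAt_const 1 z))
  simp [fderivInnerCLM_apply] at h3
  rw [real_inner_comm (gnomonic z)] at h3
  linarith

/-- The radial column is the unit vector `gnomonic z`, orthogonal to the other columns, which are `w
0` times those of `gnomonic`. The Gram matrix is thus block diagonal with blocks `1` and `(w 0)²`
times the Gram matrix of `gnomonic`. -/
theorem det_jacobian_gnomonicCone (w : EuclideanSpace ℝ (Fin (d + 1))) :
    ((jacobianMatrix gnomonicCone w).transpose * jacobianMatrix gnomonicCone w).det =
      (w 0 ^ d) ^ 2 * ((jacobianMatrix gnomonic (tailPoint w)).transpose *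
        jacobianMatrix gnomonic (tailPoint w)).det := by
  set z := tailPoint w with hz
  have t0 : tailPoint (EuclideanSpace.single (0 : Fin (d + 1)) (1 : ℝ)) = 0 := by
    ext i; simp
  have ts : ∀ j : Fin d, tailPoint (EuclideanSpace.single j.succ (1 : ℝ)) =
      EuclideanSpace.single j 1 := by
    intro j; ext i; simp
  have e0 : fderiv ℝ gnomonicCone w (EuclideanSpace.single 0 1) = gnomonic z := by
    rw [fderiv_gnomonicCone_apply, t0]; simp [hz]
  have es : ∀ j : Fin d, fderiv ℝ gnomonicCone w (EuclideanSpace.single j.succ 1) =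
      w 0 • fderiv ℝ gnomonic z (EuclideanSpace.single j 1) := by
    intro j
    rw [fderiv_gnomonicCone_apply, ts]; simp [hz]
  rw [Matrix.det_succ_row_zero, Fin.sum_univ_succ, Finset.sum_eq_zero fun j _ => ?_]
  · have hsub : ((jacobianMatrix gnomonicCone w).transpose *
        jacobianMatrix gnomonicCone w).submatrix Fin.succ (Fin.succAbove 0) =
        (w 0 ^ 2) • ((jacobianMatrix gnomonic z).transpose * jacobianMatrix gnomonic z) := by
      ext i j
      rw [Matrix.submatrix_apply, Fin.succAbove_zero, jacobianMatrix_transpose_mul_apply,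
        Matrix.smul_apply, jacobianMatrix_transpose_mul_apply, es, es, real_inner_smul_left,
        real_inner_smul_right, smul_eq_mul]
      ring
    rw [hsub, Matrix.det_smul, jacobianMatrix_transpose_mul_apply, e0,
      real_inner_self_eq_norm_sq, norm_gnomonic]
    simp [← pow_mul, mul_comm]
  · rw [jacobianMatrix_transpose_mul_apply, e0, es, real_inner_smul_right,
      inner_gnomonic_fderiv]
    simp

theorem abs_det_fderiv_gnomonicCone {w : EuclideanSpace ℝ (Fin (d + 1))} (hw : 0 < w 0) :
    |(fderiv ℝ gnomonicCone w).det| =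
      w 0 ^ d * √((jacobianMatrix gnomonic (tailPoint w)).transpose *
        jacobianMatrix gnomonic (tailPoint w)).det := by
  have h1 := det_jacobian_gnomonicCone w
  rw [Matrix.det_mul, Matrix.det_transpose, ← sq] at h1
  rw [det_fderiv_eq_det_jacobianMatrix, ← Real.sqrt_sq_eq_abs, h1,
    Real.sqrt_mul (sq_nonneg _), Real.sqrt_sq (by positivity)]

theorem gnomonicCone_injOn :
    Set.InjOn gnomonicCone {w : EuclideanSpace ℝ (Fin (d + 1)) | 0 < w 0} := by
  intro w hw w' hw' e
  rw [Set.mem_ofPred_eq] at hw hw'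
  have h0 : w 0 = w' 0 := by
    have := congrArg norm e
    simpa [gnomonicCone, norm_smul, norm_gnomonic, abs_of_pos hw, abs_of_pos hw'] using this
  have h1 : gnomonic (tailPoint w) = gnomonic (tailPoint w') := by
    rw [gnomonicCone, gnomonicCone, ← h0] at e
    exact smul_right_injective _ hw.ne' e
  have h2 := congrArg gnomonicInv h1
  rw [gnomonicInv_gnomonic, gnomonicInv_gnomonic] at h2
  rw [← consPoint_tailPoint w, ← consPoint_tailPoint w', h0, h2]

theorem measurePreserving_head_tailPoint :
    MeasurePreserving (fun w : EuclideanSpace ℝ (Fin (d + 1)) => (w 0, tailPoint w))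
      volume (volume.prod volume) :=
  (((MeasurePreserving.id volume).prod (PiLp.volume_preserving_toLp (Fin d))).comp
    (volume_preserving_piFinSuccAbove (fun _ : Fin (d + 1) => ℝ) 0)).comp
      (PiLp.volume_preserving_ofLp (Fin (d + 1)))

theorem measurable_sqrt_det_gnomonic : Measurable fun z : EuclideanSpace ℝ (Fin d) =>
    ENNReal.ofReal √((jacobianMatrix gnomonic z).transpose * jacobianMatrix gnomonic z).det := by
  have h1 : Continuous fun z : EuclideanSpace ℝ (Fin d) => jacobianMatrix gnomonic z := by
    refine continuous_matrix fun i j => ?_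
    have h2 : Continuous fun z : EuclideanSpace ℝ (Fin d) =>
        fderiv ℝ gnomonic z (EuclideanSpace.single j 1) :=
      ((contDiff_gnomonic (n := 1)).continuous_fderiv (by norm_num)).clm_apply continuous_const
    exact (EuclideanSpace.proj i : EuclideanSpace ℝ (Fin (d + 1)) →L[ℝ] ℝ).continuous.comp h2
  exact ((h1.matrix_transpose.matrix_mul h1).matrix_det.sqrt.measurable).ennreal_ofReal

theorem lintegral_Ioo_pow (d : ℕ) :
    ∫⁻ t in Set.Ioo (0 : ℝ) 1, ENNReal.ofReal (t ^ d) = (d + 1 : ℝ≥0∞)⁻¹ := by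
  rw [← ofReal_integral_eq_lintegral_ofReal, ← integral_Ioc_eq_integral_Ioo,
    ← intervalIntegral.integral_of_le zero_le_one, integral_pow]
  · rw [one_pow, zero_pow (by omega), sub_zero, one_div, ENNReal.ofReal_inv_of_pos (by positivity)]
    norm_cast
  · exact ((continuous_pow d).integrableOn_Icc (a := 0) (b := 1)).mono_set Set.Ioo_subset_Icc_self
  · filter_upwards [self_mem_ae_restrict measurableSet_Ioo] with t ht
    exact pow_nonneg ht.1.le d

/-- The volume of the cone over a patch of the sphere in gnomonic coordinates. -/
theorem volume_gnomonicCone_image {W : Set (EuclideanSpace ℝ (Fin d))} (hW : MeasurableSet W) :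
    volume (gnomonicCone '' {w | w 0 ∈ Set.Ioo (0 : ℝ) 1 ∧ tailPoint w ∈ W}) =
      (d + 1 : ℝ≥0∞)⁻¹ * ∫⁻ z in W, ENNReal.ofReal
        √((jacobianMatrix gnomonic z).transpose * jacobianMatrix gnomonic z).det := by
  set g := fun z : EuclideanSpace ℝ (Fin d) => ENNReal.ofReal
    √((jacobianMatrix gnomonic z).transpose * jacobianMatrix gnomonic z).det with hg
  have hgm : Measurable g := measurable_sqrt_det_gnomonic
  have hp := measurePreserving_head_tailPoint (d := d)
  have hT : MeasurableSet (Set.Ioo (0 : ℝ) 1 ×ˢ W) := measurableSet_Ioo.prod hW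
  have hS : MeasurableSet {w : EuclideanSpace ℝ (Fin (d + 1)) |
      w 0 ∈ Set.Ioo (0 : ℝ) 1 ∧ tailPoint w ∈ W} := hp.measurable hT
  have hpow : Measurable fun t : ℝ => ENNReal.ofReal (t ^ d) :=
    (measurable_id.pow_const d).ennreal_ofReal
  rw [← lintegral_abs_det_fderiv_eq_addHaar_image volume hS
    (fun w _ => (differentiable_gnomonicCone w).hasFDerivAt.hasFDerivWithinAt)
    (gnomonicCone_injOn.mono fun w hw => hw.1.1)]
  rw [setLIntegral_congr_fun (g := fun w : EuclideanSpace ℝ (Fin (d + 1)) =>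
    (fun q : ℝ × EuclideanSpace ℝ (Fin d) => ENNReal.ofReal (q.1 ^ d) * g q.2)
      (w 0, tailPoint w)) hS fun w hw => ?_]
  · refine (hp.setLIntegral_comp_preimage hT
      ((hpow.comp measurable_fst).mul (hgm.comp measurable_snd))).trans ?_
    -- Radial and angular variables separate; the radial integral of `t^d` is `1 / (d + 1)`.
    rw [← Measure.prod_restrict]
    refine (lintegral_prod_mul hpow.aemeasurable hgm.aemeasurable).trans ?_
    rw [lintegral_Ioo_pow]
  · simp only [hg]
    rw [abs_det_fderiv_gnomonicCone hw.1.1, ENNReal.ofReal_mul (pow_nonneg hw.1.1.le d)]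

/-- The inclusion of the unit sphere of `ℝ^{d+1}` into `ℝ^D`. -/
def sphereInclusion (h : d + 1 ≤ D)
    (y : Metric.sphere (0 : EuclideanSpace ℝ (Fin (d + 1))) 1) : sphereSet h :=
  ⟨padIsometry h y, y, y.2, rfl⟩

theorem measurable_sphereInclusion (h : d + 1 ≤ D) : Measurable (sphereInclusion h) :=
  (Continuous.subtype_mk ((padIsometry h).continuous.comp continuous_subtype_val) _).measurable

/-- The surface measure of the sphere. -/
def sphereVolume (h : d + 1 ≤ D) : Measure (sphereSet h) :=
  (volume : Measure (EuclideanSpace ℝ (Fin (d + 1)))).toSphere.map (sphereInclusion h)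

open scoped Pointwise in
-- Links the two descriptions of surface measure: `toSphere` is defined by the volume of the cone
-- over a set, and in a chart this cone is a rotated image under `gnomonicCone`.
theorem cone_preimage_sphereInclusion (h : d + 1 ≤ D)
    (Q : EuclideanSpace ℝ (Fin (d + 1)) ≃ₗᵢ[ℝ] EuclideanSpace ℝ (Fin (d + 1)))
    {A : Set (sphereSet h)} (hA : A ⊆ (sphereChart h Q).source) :
    Set.Ioo (0 : ℝ) 1 • (Subtype.val '' (sphereInclusion h ⁻¹' A)) =
      Q '' (gnomonicCone '' {w | w 0 ∈ Set.Ioo (0 : ℝ) 1 ∧ tailPoint w ∈ sphereChart h Q '' A}) := by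
  have key : ∀ y, sphereInclusion h y ∈ A →
      Q (gnomonic (sphereChart h Q (sphereInclusion h y))) = y := by
    intro y hy
    have h1 : Q.symm (firstCoords h (sphereInclusion h y : EuclideanSpace ℝ (Fin D))) =
        Q.symm y := by
      rw [sphereInclusion, firstCoords_padIsometry]
    have h2 : 0 < Q.symm (y : EuclideanSpace ℝ (Fin (d + 1))) 0 := h1 ▸ (hA hy).1
    change Q (gnomonic (gnomonicInv (Q.symm (firstCoords h _)))) = y
    rw [h1, gnomonic_gnomonicInv (by simp) h2, LinearIsometryEquiv.apply_symm_apply]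
  ext x
  constructor
  · rintro ⟨r, hr, _, ⟨y, hy, rfl⟩, rfl⟩
    refine ⟨_, ⟨consPoint r (sphereChart h Q (sphereInclusion h y)), ⟨hr, ?_⟩, rfl⟩, ?_⟩
    · rw [tailPoint_consPoint]
      exact ⟨_, hy, rfl⟩
    · rw [gnomonicCone, consPoint_zero, tailPoint_consPoint, map_smul, key y hy]
  · rintro ⟨_, ⟨w, ⟨hw, x, hx, hxw⟩, rfl⟩, rfl⟩
    obtain ⟨y, rfl⟩ : ∃ y, sphereInclusion h y = x := by
      obtain ⟨_, y, hy, rfl⟩ := x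
      exact ⟨⟨y, hy⟩, rfl⟩
    refine ⟨w 0, hw, y, ⟨y, hx, rfl⟩, ?_⟩
    change w 0 • (y : EuclideanSpace ℝ (Fin (d + 1))) = _
    rw [gnomonicCone, map_smul, ← hxw, key y hx]

/-- The dimension factor `d + 1` in `toSphere` cancels the radial integral, and rotations preserve
Lebesgue measure and the Gram matrix; what remains is the Riemannian density. -/
theorem isVolumeMeasure_sphereVolume (h : d + 1 ≤ D) :
    IsVolumeMeasure (Set.range (sphereChart h)) (sphereVolume h) := by
  rintro _ ⟨Q, rfl⟩ A hAm hA
  have hW : MeasurableSet (sphereChart h Q '' A) := by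
    have h1 := (sphereChart h Q).toPartialEquiv.image_eq_target_inter_inv_preimage hA
    have h2 : Measurable (spherePoint h Q) :=
      (Continuous.subtype_mk ((padIsometry h).continuous.comp
        (Q.continuous.comp (contDiff_gnomonic (n := 0)).continuous)) _).measurable
    refine (h1 ▸ (Metric.isOpen_ball.measurableSet.inter (h2 hAm)) :)
  rw [sphereVolume, Measure.map_apply (measurable_sphereInclusion h) hAm,
    Measure.toSphere_apply' _ (measurable_sphereInclusion h hAm),
    cone_preimage_sphereInclusion h Q hA, LinearIsometryEquiv.image_eq_preimage_symm,
    Q.symm.measurePreserving.measure_preimage_emb Q.symm.toHomeomorph.measurableEmbedding,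
    volume_gnomonicCone_image hW, finrank_euclideanSpace_fin, ← mul_assoc, Nat.cast_add,
    Nat.cast_one, ENNReal.mul_inv_cancel (by simp) (by finiteness), one_mul]
  simp only [jacobian_chartInv_sphereChart]

theorem toSphere_univ_ne_zero : (volume : Measure (EuclideanSpace ℝ (Fin (d + 1)))).toSphere
    Set.univ ≠ 0 := by
  rw [Measure.measure_univ_ne_zero]
  exact Measure.toSphere_ne_zero _

theorem isProbabilityMeasure_sphereLaw (h : d + 1 ≤ D) : IsProbabilityMeasure (sphereLaw d D) := by
  refine ⟨?_⟩
  have hm : Measurable fun x : Metric.sphere (0 : EuclideanSpace ℝ (Fin (d + 1))) 1 =>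
      padZero D (x : EuclideanSpace ℝ (Fin (d + 1))) :=
    ((padIsometry h).continuous.comp continuous_subtype_val).measurable
  rw [sphereLaw, Measure.map_apply hm MeasurableSet.univ, Set.preimage_univ, Measure.smul_apply,
    smul_eq_mul, ENNReal.inv_mul_cancel toSphere_univ_ne_zero (measure_ne_top _ _)]

theorem sphereLaw_eq_map_withDensity (h : d + 1 ≤ D) :
    sphereLaw d D = ((sphereVolume h).withDensity fun _ =>
      ENNReal.ofReal ((volume : Measure (EuclideanSpace ℝ (Fin (d + 1)))).toSphere
        Set.univ)⁻¹.toReal).map Subtype.val := by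
  rw [ENNReal.ofReal_toReal (ENNReal.inv_ne_top.2 toSphere_univ_ne_zero), withDensity_const,
    Measure.map_smul, sphereVolume,
    Measure.map_map measurable_subtype_coe (measurable_sphereInclusion h), sphereLaw,
    Measure.map_smul]
  rfl

/-- Beyond the atlas, `L` has only to dominate the inverse of the constant density and its Hölder
norm. -/
theorem exists_sphereLaw_mem_PStar (h : d + 1 ≤ D) (α : ℝ) {β : ℝ} (hβ : 0 ≤ β) :
    ∃ L₀ : ℝ, 0 < L₀ ∧ ∀ L : ℝ, L₀ ≤ L → sphereLaw d D ∈ PStar d D α β L := by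
  obtain ⟨L₁, hL₁, hatlas⟩ := exists_isRegularAtlas_sphereChart hβ h
  set c := ((volume : Measure (EuclideanSpace ℝ (Fin (d + 1)))).toSphere Set.univ)⁻¹.toReal
    with hc
  have hc0 : 0 < c := ENNReal.toReal_pos (ENNReal.inv_ne_zero.2 (measure_ne_top _ _))
    (ENNReal.inv_ne_top.2 toSphere_univ_ne_zero)
  refine ⟨max L₁ (max c⁻¹ (holderCount d ⌊α⌋₊ * c)), lt_max_of_lt_left hL₁, fun L hL => ?_⟩
  obtain ⟨hL1, hL2, hL3⟩ : L₁ ≤ L ∧ c⁻¹ ≤ L ∧ holderCount d ⌊α⌋₊ * c ≤ L := by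
    simpa [max_le_iff] using hL
  refine ⟨isProbabilityMeasure_sphereLaw h, sphereSet h, Set.range (sphereChart h),
    sphereVolume h, fun _ => c, isCompact_sphereSet, hatlas L hL1,
    isVolumeMeasure_sphereVolume h, sphereLaw_eq_map_withDensity h, fun _ => ?_, ?_⟩
  · rw [one_div]
    exact inv_le_of_inv_le₀ hc0 hL2
  · rintro φ -
    exact holderBall_mono hL3 (const_mem_holderBall _ φ.open_target hc0.le)

end sphere_volume

/-! ### The lower bound for the class, and the theorem. -/

theorem exists_isChartBall_of_mem_PStar {d D : ℕ} {α β L : ℝ} (hβ : 1 < β) (hL : 0 < L)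
    {μ : Measure (EuclideanSpace ℝ (Fin D))} (hμ : μ ∈ PStar d D α β L) :
    ∃ C ρ : ℝ, 0 < C ∧ 0 < ρ ∧ ∃ ψ z, IsChartBall (d := d) C ρ μ ψ z := by
  obtain ⟨C, ρ, K, hC, hρ, hcover⟩ := exists_chart_cover d D hβ hL
  obtain ⟨N, ψ, z, -, hball, hnull⟩ := hcover α μ hμ
  have := hμ.1
  refine ⟨C, ρ, hC, hρ, ?_⟩
  -- Without any chart ball the whole space would be a null set.
  rcases Nat.eq_zero_or_pos N with rfl | hN
  · simp at hnull
  · exact ⟨ψ ⟨0, hN⟩, z ⟨0, hN⟩, hball _⟩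

/-- The lower bound, for every measure of the class. -/
theorem exists_lower_bound {d D : ℕ} (hd : 1 ≤ d) {α β γ L : ℝ} (hβ : 1 < β) (hγ : 0 < γ)
    (hL : 0 < L) {μ : Measure (EuclideanSpace ℝ (Fin D))} (hμ : μ ∈ PStar d D α β L) :
    ∃ C₂ : ℝ, 0 < C₂ ∧ ∀ n : ℕ, 2 ≤ n →
      ENNReal.ofReal (C₂ * max √(1 / n) ((n : ℝ) ^ (-(γ / d)) / Real.log n)) ≤
        ∫⁻ X, empiricalSup γ μ X ∂(sampleLaw n μ) := by
  have := hμ.1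
  obtain ⟨C, ρ, hC, hρ, ψ, z, hball⟩ := exists_isChartBall_of_mem_PStar hβ hL hμ
  obtain ⟨a, ha, hpoint⟩ := hball.exists_le_empiricalSup hd hC hρ hγ
  obtain ⟨b, hb, hmean⟩ := hball.exists_le_lintegral_empiricalSup hd hC hρ hγ
  refine ⟨min (a / 2) b, by positivity, fun n hn => ?_⟩
  have hlog := half_le_log hn
  have hn1 : 1 ≤ n := by omega
  rw [mul_max_of_nonneg _ _ (by positivity), ENNReal.ofReal_max]
  refine max_le ?_ ?_
  · refine le_trans (ENNReal.ofReal_le_ofReal ?_) (hmean n hn1)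
    rw [Real.sqrt_div zero_le_one, Real.sqrt_one, mul_one_div]
    gcongr
    exact min_le_right _ _
  · calc ENNReal.ofReal (min (a / 2) b * ((n : ℝ) ^ (-(γ / d)) / Real.log n))
        ≤ ENNReal.ofReal (a * (n : ℝ) ^ (-(γ / d))) := by
          refine ENNReal.ofReal_le_ofReal ?_
          -- The pointwise bound carries no logarithm; as `log n ≥ 1/2`, dividing by it costs at
          -- most a factor `2`, which is why `a / 2` is taken.
          have h1 : (n : ℝ) ^ (-(γ / d)) / Real.log n ≤ 2 * (n : ℝ) ^ (-(γ / d)) := by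
            rw [div_le_iff₀ (by linarith)]
            have : 0 ≤ (n : ℝ) ^ (-(γ / d)) := by positivity
            nlinarith
          calc min (a / 2) b * ((n : ℝ) ^ (-(γ / d)) / Real.log n)
              ≤ a / 2 * (2 * (n : ℝ) ^ (-(γ / d))) := by
                refine mul_le_mul (min_le_left _ _) h1 ?_ (by positivity)
                have : 0 ≤ Real.log n := by linarith
                positivity
            _ = a * (n : ℝ) ^ (-(γ / d)) := by ring
      _ = ∫⁻ _, ENNReal.ofReal (a * (n : ℝ) ^ (-(γ / d))) ∂(sampleLaw n μ) := by
          have : IsProbabilityMeasure (sampleLaw n μ) := by unfold sampleLaw; infer_instance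
          rw [lintegral_const, measure_univ, mul_one]
      _ ≤ _ := lintegral_mono fun X => hpoint n hn1 X

end

theorem mainTheorem8 (d D : ℕ) (hd : 1 ≤ d) (hdD : d < D) (α β γ : ℝ) (hα : 0 ≤ α)
    (hβ : 1 < β) (hαβ : α ≤ β - 1) (hγ : 0 < γ) :
    ((γ ≠ (d : ℝ) / 2 ∨ ∃ k : ℕ, γ = k) →
      ∀ L : ℝ, 0 < L → ∃ C₁ : ℝ, 0 < C₁ ∧ ∀ μ ∈ PStar d D α β L, ∀ n : ℕ, 1 ≤ n →
        1 - (n : ℝ≥0∞)⁻¹ < sampleLaw n μ {X | empiricalSup γ μ X ≤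
          ENNReal.ofReal (C₁ * max √(Real.log n / n) ((n : ℝ) ^ (-(γ / d))))}) ∧
    (γ = (d : ℝ) / 2 →
      ∀ L : ℝ, 0 < L → ∃ C₁ : ℝ, 0 < C₁ ∧ ∀ μ ∈ PStar d D α β L, ∀ n : ℕ, 1 ≤ n →
        1 - (n : ℝ≥0∞)⁻¹ < sampleLaw n μ {X | empiricalSup γ μ X ≤
          ENNReal.ofReal (C₁ * max (Real.log n / √n) ((n : ℝ) ^ (-(γ / d))))}) ∧
    (∃ L₀ : ℝ, 0 < L₀ ∧ ∀ L : ℝ, L₀ ≤ L → sphereLaw d D ∈ PStar d D α β L) ∧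
    (∃ C₂ : ℝ, 0 < C₂ ∧ ∀ n : ℕ, 2 ≤ n →
      ENNReal.ofReal (C₂ * max √(1 / n) ((n : ℝ) ^ (-(γ / d)) / Real.log n)) ≤
        ∫⁻ X, empiricalSup γ (sphereLaw d D) X ∂(sampleLaw n (sphereLaw d D))) := by
  have hpStar := exists_sphereLaw_mem_PStar hdD α (zero_le_one.trans hβ.le)
  refine ⟨fun h L hL => exists_upper_bound hd hβ hγ h hL,
    fun h L hL => exists_upper_bound_critical hd hβ hγ h hL, hpStar, ?_⟩
  obtain ⟨L, hL, hmem⟩ := hpStar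
  exact exists_lower_bound hd hβ hγ hL (hmem L le_rfl)
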